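/- A simple two-dimensional lattice path is a nonempty finite sequence of steps from $\{\uparrow,\rightarrow,\downarrow,\leftarrow\}$. For a path $\ell$ of length at least $2$, its reduction $\Phi_L(\ell)$ is obtained as follows. If $\ell$ starts with a vertical step, rotate the entire path clockwise by $90^\circ$. If the resulting path ends with a horizontal step, rotate this last step clockwise by $90^\circ$. The path is now a concatenation of segments, each consisting of a maximal nonempty run of horizontal steps followed by a maximal nonempty run of vertical steps. Replace each segment by a single step determined by its first horizontal and its first vertical step: $(\rightarrow,\uparrow)\mapsto\nearrow$, $(\rightarrow,\downarrow)\mapsto\searrow$, $(\leftarrow,\downarrow)\mapsto\swarrow$, $(\leftarrow,\uparrow)\mapsto\nwarrow$; finally rotate the path by $45^\circ$ clockwise (so $\nearrow$ becomes $\rightarrow$, $\searrow$ becomes $\downarrow$, $\swarrow$ becomes $\leftarrow$, $\nwarrow$ becomes $\uparrow$). The reduction degree of $\ell$ is the unique $r\ge 0$ such that $\Phi_L^{r}(\ell)$ is a single step. Let $D_n$ be the reduction degree of a uniformly random path among the $4^n$ paths of length $n$. Let $\gamma$ be the Euler–Mascheroni constant, $\zeta$ the Riemann zeta function, $\psi=\Gamma'/\Gamma$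 the digamma function, $\log$ the natural logarithm, and for nonzero integers $k$ put $\chi_k = \frac{2\pi i k}{\log 2}$, \[ c_k = \frac{2}{\sqrt{\pi}\,\log^2 2}\,\Gamma\Big(\frac{3+\chi_k}{2}\Big)\zeta(1+\chi_k), \] \[ d_k = \frac{4}{\sqrt{\pi}\,\log^2 2}\,\Gamma\Big(\frac{3+\chi_k}{2}\Big)\big(\psi(2+\chi_k)\zeta(1+\chi_k)+\zeta'(1+\chi_k)\big) - 3c_k\log 2. \] **Theorem.** For every $x\in\mathbb{R}$ the series \[ \delta_1(x) = \log 2\sum_{k\ne 0} c_k e^{2k\pi i x}, \qquad \delta_2(x) = \sum_{k\neq 0}\Big(d_k - c_k\,\psi\Big(1+\frac{\chi_k}{2}\Big)\Big)e^{2k\pi i x} \] converge absolutely to real numbers, and they define $1$-periodic functions with mean zero, that is, $\int_0^1\delta_j(x)\,dx=0$. As $n\to\infty$, the expected value satisfies \[ \mathbb{E} D_n = \log_4 n + \frac{\gamma+2-3\log 2}{2\log 2} + \delta_1(\log_4 n) + O(n^{-1}), \] and the variance satisfies \[ \mathbb{V} D_n = \frac{\pi^2 - 24\log^2\pi - 48\zeta''(0)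 - 24}{24\log^2 2} - \frac{2\log\pi}{\log 2} - \frac{11}{12} + \delta_2(\log_4 n) - \frac{\gamma+2-3\log 2}{\log 2}\,\delta_1(\log_4 n) - \delta_1^2(\log_4 n) + O\Big(\frac{\log n}{n}\Big), \] where $\zeta''(0)$ is real. -/

import Mathlib

/-- The four unit steps of a simple two-dimensional lattice path. -/
inductive Step where
  | up
  | right
  | down
  | left
  deriving DecidableEq

namespace Step

instance : Fintype Step := ⟨{up, right, down, left}, fun s => by cases s <;> simp⟩

instance : MeasurableSpace Step := ⊤

instance : DiscreteMeasurableSpace Step := ⟨fun _ => trivial⟩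

/-- Whether a step is horizontal (as opposed to vertical). -/
def isHorizontal : Step → Bool
  | right => true
  | left => true
  | up => false
  | down => false

/-- Clockwise rotation of a step by a right angle. -/
def rotate : Step → Step
  | up => right
  | right => down
  | down => left
  | left => up

/-- The step replacing a horizontal-vertical segment whose first horizontal step is `h` and
whose first vertical step is `v`: the diagonal step in direction `h + v`, rotated clockwise
by 45 degrees (north-east becomes right, south-east becomes down, south-west becomes left,
north-west becomes up). The value is irrelevant unless `h` is horizontal and `v` is vertical. -/
def merge : Step → Step → Step
  | right, up => right
  | right, down => down
  | left, down => left
  | left, up => up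
  | h, _ => h

end Step

namespace LatticePath

/-- If the path starts vertically, rotate the entire path clockwise. -/
def rotateAll : List Step → List Step
  | [] => []
  | a :: l => if a.isHorizontal then a :: l else (a :: l).map Step.rotate

/-- If the path ends horizontally, rotate its very last step clockwise. -/
def rotateLast : List Step → List Step
  | [] => []
  | [a] => if a.isHorizontal then [a.rotate] else [a]
  | a :: b :: l => a :: rotateLast (b :: l)

/-- Collapse each horizontal-vertical segment of a path that starts horizontally and ends
vertically into a single step. A segment is a maximal nonempty run of horizontal steps
(first step `a`) followed by a maximal nonempty run of vertical steps (first step `b`). -/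
def collapse : List Step → List Step
  | [] => []
  | a :: l =>
    match h : l.dropWhile (fun s => s.isHorizontal) with
    | [] => []
    | b :: l' => Step.merge a b :: collapse (l'.dropWhile (fun s => !s.isHorizontal))
  termination_by l => l.length
  decreasing_by
    have h1 := (List.dropWhile_sublist (l := l) (fun s => s.isHorizontal)).length_le
    have h2 := (List.dropWhile_sublist (l := l') (fun s => !s.isHorizontal)).length_le
    rw [h] at h1
    simp only [List.length_cons] at h1 ⊢
    omega

/-- The reduction `Φ_L`, a partial function: it is defined exactly on the paths of length at
least two. -/
def reduce (l : List Step) : Option (List Step) :=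
  if 2 ≤ l.length then some (collapse (rotateLast (rotateAll l))) else none

/-- The `n`-fold iterate of the partial function `reduce`. -/
def iterReduce : ℕ → List Step → Option (List Step)
  | 0, l => some l
  | n + 1, l => (reduce l).bind (iterReduce n)

/-- The `n`-fold reduction of `l` is defined and is a single step. -/
def ReducesToStepIn (l : List Step) (n : ℕ) : Prop :=
  ∃ s : Step, iterReduce n l = some [s]

/-- The reduction degree of a path: the number `n` such that the `n`-fold reduction of the
path is a single step. For a nonempty path there is exactly one such `n`, see
`rdeg_eq_iff`. -/
noncomputable def rdeg (l : List Step) : ℕ :=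
  sInf {n | ReducesToStepIn l n}

theorem length_rotateAll (l : List Step) : (rotateAll l).length = l.length := by
  cases l with
  | nil => rfl
  | cons a l => rw [rotateAll]; split_ifs <;> simp

theorem length_rotateLast (l : List Step) : (rotateLast l).length = l.length := by
  fun_induction rotateLast l <;> simp_all

theorem two_mul_length_collapse_le (l : List Step) :
    2 * (collapse l).length ≤ l.length := by
  fun_induction collapse l with
  | case1 => simp
  | case2 => simp
  | case3 a l b l' h ih =>
    have h1 := (List.dropWhile_sublist (l := l) (fun s => s.isHorizontal)).length_le
    have h2 := (List.dropWhile_sublist (l := l') (fun s => !s.isHorizontal)).length_le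
    rw [h] at h1
    simp only [List.length_cons] at h1 ⊢
    omega

theorem exists_vertical_mem_rotateLast (l : List Step) (hl : l ≠ []) :
    ∃ s ∈ rotateLast l, s.isHorizontal = false := by
  fun_induction rotateLast l with
  | case1 => simp at hl
  | case2 a h => exact ⟨a.rotate, by simp, by cases a <;> simp_all [Step.isHorizontal, Step.rotate]⟩
  | case3 a h => exact ⟨a, by simp, by simpa using h⟩
  | case4 a b l ih =>
    obtain ⟨s, hs, h⟩ := ih (by simp)
    exact ⟨s, List.mem_cons_of_mem _ hs, h⟩

theorem collapse_ne_nil (a : Step) (l : List Step) (h : ∃ s ∈ l, s.isHorizontal = false) :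
    collapse (a :: l) ≠ [] := by
  rw [collapse]
  split
  · rename_i h0
    rw [List.dropWhile_eq_nil_iff] at h0
    obtain ⟨s, hs, h⟩ := h
    have := h0 s hs
    simp_all
  · simp

theorem reduce_spec (l : List Step) (hl : 2 ≤ l.length) :
    ∃ l', reduce l = some l' ∧ l' ≠ [] ∧ l'.length < l.length := by
  refine ⟨_, if_pos hl, ?_, ?_⟩
  · have hlen := length_rotateAll l
    match hr : rotateAll l with
    | [] => rw [hr] at hlen; simp at hlen; omega
    | [a] => rw [hr] at hlen; simp at hlen; omega
    | a :: b :: t =>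
      rw [rotateLast]
      exact collapse_ne_nil _ _ (exists_vertical_mem_rotateLast _ (by simp))
  · have := two_mul_length_collapse_le (rotateLast (rotateAll l))
    rw [length_rotateLast, length_rotateAll] at this
    omega

theorem existsUnique_reducesToStepIn (l : List Step) (hl : l ≠ []) :
    ∃! n, ReducesToStepIn l n := by
  induction hk : l.length using Nat.strong_induction_on generalizing l with
  | _ k ih =>
    by_cases h2 : 2 ≤ l.length
    · obtain ⟨l', hr, hne, hlt⟩ := reduce_spec l h2
      obtain ⟨n, hn, hu⟩ := ih _ (hk ▸ hlt) l' hne rfl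
      refine ⟨n + 1, ?_, ?_⟩
      · simpa [ReducesToStepIn, iterReduce, hr] using hn
      · rintro (_ | m) hm
        · obtain ⟨s, hs⟩ := hm
          simp only [iterReduce, Option.some.injEq] at hs
          simp [hs] at h2
        · congr 1
          exact hu m (by simpa [ReducesToStepIn, iterReduce, hr] using hm)
    · match l, hl, h2 with
      | [a], _, _ =>
        refine ⟨0, ⟨a, rfl⟩, ?_⟩
        rintro (_ | m) hm
        · rfl
        · obtain ⟨s, hs⟩ := hm
          simp [iterReduce, reduce] at hs
      | a :: b :: t, _, h => simp at h

theorem rdeg_eq_iff (l : List Step) (hl : l ≠ []) (n : ℕ) :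
    rdeg l = n ↔ ∃ s : Step, iterReduce n l = some [s] := by
  obtain ⟨m, hm, hu⟩ := existsUnique_reducesToStepIn l hl
  have hr : ReducesToStepIn l (rdeg l) :=
    Nat.sInf_mem (s := {n | ReducesToStepIn l n}) ⟨m, hm⟩
  constructor
  · rintro rfl
    exact hr
  · intro h
    rw [hu _ hr, hu n h]

/-- The uniform distribution on the `4 ^ n` lattice paths of length `n`. -/
noncomputable def uniformPath (n : ℕ) : MeasureTheory.Measure (Fin n → Step) :=
  ProbabilityTheory.uniformOn Set.univ

/-- The random variable `D_n`: the reduction degree of a path of length `n`. -/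
noncomputable def D (n : ℕ) (p : Fin n → Step) : ℝ := (rdeg (List.ofFn p) : ℝ)

/-- The expected value of `D_n` under the uniform distribution. -/
noncomputable def expectedD (n : ℕ) : ℝ := ∫ p, D n p ∂(uniformPath n)

/-- The variance of `D_n` under the uniform distribution. -/
noncomputable def varianceD (n : ℕ) : ℝ := ProbabilityTheory.variance (D n) (uniformPath n)

/-- `χ_k = 2 π i k / log 2`. -/
noncomputable def chi (k : ℤ) : ℂ := 2 * Real.pi * Complex.I * k / Real.log 2

/-- The constants `c_k` (for `k ≠ 0`). -/
noncomputable def coeffC (k : ℤ) : ℂ :=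
  2 / (Real.sqrt Real.pi * Real.log 2 ^ 2) * Complex.Gamma ((3 + chi k) / 2)
    * riemannZeta (1 + chi k)

/-- The constants `d_k` (for `k ≠ 0`). -/
noncomputable def coeffD (k : ℤ) : ℂ :=
  4 / (Real.sqrt Real.pi * Real.log 2 ^ 2) * Complex.Gamma ((3 + chi k) / 2)
    * (Complex.digamma (2 + chi k) * riemannZeta (1 + chi k) + deriv riemannZeta (1 + chi k))
    - 3 * coeffC k * Real.log 2

/-- `f` is the real-valued function given by the (unconditionally convergent) Fourier series
with coefficients `a k`, where `k` ranges over the nonzero integers. -/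
def HasFourierSeries (a : ℤ → ℂ) (f : ℝ → ℝ) : Prop :=
  ∀ x : ℝ, HasSum
    (fun k : {k : ℤ // k ≠ 0} => a k * Complex.exp (2 * (k : ℤ) * Real.pi * Complex.I * x))
    (f x : ℂ)

/-- `f` is `1`-periodic with mean zero. -/
def IsPeriodicMeanZero (f : ℝ → ℝ) : Prop :=
  Function.Periodic f 1 ∧ IntervalIntegrable f MeasureTheory.volume 0 1 ∧
    ∫ x in (0 : ℝ)..1, f x = 0

end LatticePath

/-!
# Asymptotics of the reduction degree of a random lattice path

The reduction of a uniformly random path of length `n`, conditioned on its length, is again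
uniformly random, so `P(D n ≥ r)` satisfies a linear recurrence in `r` with binomial coefficients.
Its solution is a sum over `2 ^ r`-th roots of unity, and also a sum of binomial coefficients of
order `2n` over the multiples of `2 ^ r`. The first form is accurate when `4 ^ r` is small compared
with `n`, the second when it is large; by the functional equation of the theta series both are
within `O(1 / n)`, times a factor decaying geometrically in `|r - log₄ n|`, of the same function
`limitTail (4 ^ r / n)`.

Hence the first two moments are, up to the error terms, regularised sums over all integers `r` of
`logTail (log₄ n - r)`, with weights `1` and `2 r - 1`. Such a sum is periodic in `log₄ n` up to an
explicit polynomial. Unfolding turns its Fourier coefficients into values at `χ_k / 2` of the Mellin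
transform of `limitTail`, a product of Gamma and zeta factors, and of its derivative; the constant
terms are its Taylor coefficients at `0`.
-/

open Filter Topology MeasureTheory Asymptotics

/-! ### Counting paths by their reduction -/

namespace LatticePath

theorem sum_step {M : Type*} [AddCommMonoid M] (f : Step → M) :
    ∑ s, f s = f .up + f .right + f .down + f .left := by
  have huniv : (Finset.univ : Finset Step) = {.up, .right, .down, .left} := rfl
  simp [huniv, add_assoc]

section PathSum

variable {M : Type*} [AddCommMonoid M]

/-- The sum of `F` over all lattice paths of length `n`. -/
def pathSum (n : ℕ) (F : List Step → M) : M :=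
  ∑ p : Fin n → Step, F (List.ofFn p)

theorem pathSum_zero (F : List Step → M) : pathSum 0 F = F [] := by
  simp [pathSum]

theorem pathSum_succ (n : ℕ) (F : List Step → M) :
    pathSum (n + 1) F = ∑ s, pathSum n fun l => F (s :: l) := by
  simp only [pathSum]
  rw [← (Fin.consEquiv fun _ => Step).sum_comp, Fintype.sum_prod_type]
  simp [Fin.consEquiv, List.ofFn_succ]

theorem pathSum_congr {n : ℕ} {F G : List Step → M}
    (h : ∀ l : List Step, l.length = n → F l = G l) : pathSum n F = pathSum n G :=
  Finset.sum_congr rfl fun p _ => h _ (List.length_ofFn (f := p))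

theorem pathSum_map_rotate (n : ℕ) (F : List Step → M) :
    pathSum n (fun l => F (l.map Step.rotate)) = pathSum n F := by
  have hrot : Function.Bijective Step.rotate := by decide
  rw [pathSum, pathSum, ← (Equiv.piCongrRight fun _ => Equiv.ofBijective _ hrot).sum_comp
    fun p : Fin n → Step => F (List.ofFn p)]
  exact Finset.sum_congr rfl fun p _ => by rw [List.map_ofFn]; rfl

end PathSum

theorem pathSum_const (n : ℕ) (c : ℝ) : pathSum n (fun _ => c) = 4 ^ n * c := by
  have hcard : Fintype.card Step = 4 := rfl
  simp [pathSum, hcard]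

theorem rotateLast_cons {l : List Step} (a : Step) (hl : l ≠ []) :
    rotateLast (a :: l) = a :: rotateLast l := by
  cases l with
  | nil => exact absurd rfl hl
  | cons b l => rw [rotateLast]

theorem collapse_cons_congr (a : Step) {l m : List Step}
    (h : l.dropWhile (fun s => s.isHorizontal) = m.dropWhile (fun s => s.isHorizontal)) :
    collapse (a :: l) = collapse (a :: m) := by
  rw [collapse, collapse]
  split <;> split <;> simp_all

theorem collapse_cons_horizontal (a b : Step) (l : List Step) (hb : b.isHorizontal = true) :
    collapse (a :: b :: l) = collapse (a :: l) :=
  collapse_cons_congr a (by simp [hb])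

theorem collapse_cons_vertical (a b : Step) (l : List Step) (hb : b.isHorizontal = false) :
    collapse (a :: b :: l) =
      Step.merge a b :: collapse (l.dropWhile fun s => !s.isHorizontal) := by
  rw [collapse]
  split
  · simp_all
  · rename_i h
    rw [List.dropWhile_cons_of_neg (by simp [hb]), List.cons.injEq] at h
    rw [h.1, h.2]

theorem pathSum_succ_eq_merge {M : Type*} [AddCommMonoid M] (n : ℕ) (F : List Step → M) :
    pathSum (n + 1) F = pathSum n (fun l => F (Step.merge .right .up :: l))
      + pathSum n (fun l => F (Step.merge .right .down :: l))
      + (pathSum n (fun l => F (Step.merge .left .up :: l))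
      + pathSum n (fun l => F (Step.merge .left .down :: l))) := by
  simp only [pathSum_succ, sum_step, Step.merge]
  abel

/-- The sum of `F` over the reductions of all paths that consist of a first horizontal step `a`
and `n` further steps. -/
def horizontalSum (n : ℕ) (a : Step) (F : List Step → ℝ) : ℝ :=
  pathSum n fun l => F (collapse (a :: rotateLast l))

/-- The sum of `F` over the reductions of what follows a vertical run, when that run is extended
by `n` further steps in all possible ways. -/
def verticalSum (n : ℕ) (F : List Step → ℝ) : ℝ :=
  pathSum n fun l => F (collapse ((rotateLast l).dropWhile fun s => !s.isHorizontal))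

theorem horizontalSum_one (a : Step) (F : List Step → ℝ) :
    horizontalSum 1 a F = 2 * (F [Step.merge a .up] + F [Step.merge a .down]) := by
  have hpair (b : Step) (hb : b.isHorizontal = false) : collapse [a, b] = [Step.merge a b] := by
    rw [collapse_cons_vertical _ _ _ hb, List.dropWhile_nil, collapse]
  simp only [horizontalSum, pathSum_succ, pathSum_zero, sum_step, rotateLast, Step.isHorizontal,
    Step.rotate, if_true, Bool.false_eq_true, if_false, hpair .up rfl, hpair .down rfl]
  ring

theorem verticalSum_one (F : List Step → ℝ) : verticalSum 1 F = 4 * F [] := by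
  simp [verticalSum, pathSum_succ, pathSum_zero, sum_step, rotateLast, Step.isHorizontal,
    Step.rotate, collapse]
  ring

theorem horizontalSum_add_two (n : ℕ) (a : Step) (F : List Step → ℝ) :
    horizontalSum (n + 2) a F = 2 * horizontalSum (n + 1) a F
      + verticalSum (n + 1) (fun l => F (Step.merge a .up :: l))
      + verticalSum (n + 1) (fun l => F (Step.merge a .down :: l)) := by
  have hhor (s : Step) (hs : s.isHorizontal = true) :
      pathSum (n + 1) (fun l => F (collapse (a :: rotateLast (s :: l))))
        = horizontalSum (n + 1) a F :=
    pathSum_congr fun l hl => by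
      rw [rotateLast_cons _ (List.ne_nil_of_length_eq_add_one hl),
        collapse_cons_horizontal _ _ _ hs]
  have hver (s : Step) (hs : s.isHorizontal = false) :
      pathSum (n + 1) (fun l => F (collapse (a :: rotateLast (s :: l))))
        = verticalSum (n + 1) (fun l => F (Step.merge a s :: l)) :=
    pathSum_congr fun l hl => by
      rw [rotateLast_cons _ (List.ne_nil_of_length_eq_add_one hl), collapse_cons_vertical _ _ _ hs]
  rw [horizontalSum, pathSum_succ, sum_step, hhor .right rfl, hhor .left rfl, hver .up rfl,
    hver .down rfl]
  ring

theorem verticalSum_add_two (n : ℕ) (F : List Step → ℝ) :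
    verticalSum (n + 2) F = 2 * verticalSum (n + 1) F
      + horizontalSum (n + 1) .right F + horizontalSum (n + 1) .left F := by
  have hhor (s : Step) (hs : s.isHorizontal = true) :
      pathSum (n + 1) (fun l => F (collapse ((rotateLast (s :: l)).dropWhile
        fun s => !s.isHorizontal))) = horizontalSum (n + 1) s F :=
    pathSum_congr fun l hl => by
      rw [rotateLast_cons _ (List.ne_nil_of_length_eq_add_one hl),
        List.dropWhile_cons_of_neg (by simp [hs])]
  have hver (s : Step) (hs : s.isHorizontal = false) :
      pathSum (n + 1) (fun l => F (collapse ((rotateLast (s :: l)).dropWhile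
        fun s => !s.isHorizontal))) = verticalSum (n + 1) F :=
    pathSum_congr fun l hl => by
      rw [rotateLast_cons _ (List.ne_nil_of_length_eq_add_one hl),
        List.dropWhile_cons_of_pos (by simp [hs])]
  rw [verticalSum, pathSum_succ, sum_step, hhor .right rfl, hhor .left rfl, hver .up rfl,
    hver .down rfl]
  ring

/-- The number `2 ^ (n + 1 - j) * n.choose j` of ways to append `n` steps to a run so that the
path, after rotation of its last step, has `j` changes between horizontal and vertical runs with
prescribed first steps: each other step is free to choose between two directions, and the last
step has two preimages under the final rotation. The quotient form avoids a truncated exponent. -/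
noncomputable def switchCount (n j : ℕ) : ℝ := 2 * (2 ^ n / 2 ^ j * n.choose j)

theorem switchCount_eq_zero {n j : ℕ} (h : n < j) : switchCount n j = 0 := by
  simp [switchCount, Nat.choose_eq_zero_of_lt h]

theorem switchCount_succ_zero (n : ℕ) : switchCount (n + 1) 0 = 2 * switchCount n 0 := by
  simp only [switchCount, Nat.choose_zero_right]
  ring

theorem switchCount_succ_succ (n j : ℕ) :
    switchCount (n + 1) (j + 1) = 2 * switchCount n (j + 1) + switchCount n j := by
  simp only [switchCount, Nat.choose_succ_succ]
  push_cast
  field_simp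
  ring

theorem horizontalSum_and_verticalSum_eq (n R : ℕ) (hR : n + 1 ≤ R) :
    (∀ a F, horizontalSum (n + 1) a F = ∑ k ∈ Finset.range R, switchCount (n + 1) (2 * k + 1) *
        (pathSum k (fun l => F (Step.merge a .up :: l))
          + pathSum k (fun l => F (Step.merge a .down :: l)))) ∧
    (∀ F, verticalSum (n + 1) F =
      ∑ k ∈ Finset.range (R + 1), switchCount (n + 1) (2 * k) * pathSum k F) := by
  induction n with
  | zero =>
    have hone : switchCount 1 1 = 2 := by norm_num [switchCount]
    have hzero : switchCount 1 0 = 4 := by norm_num [switchCount]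
    constructor
    · intro a F
      rw [Finset.sum_eq_single_of_mem 0 (Finset.mem_range.2 hR)
        fun k _ hk => by rw [switchCount_eq_zero (by omega), zero_mul]]
      simp only [zero_add, mul_zero, hone, horizontalSum_one, pathSum_zero]
    · intro F
      rw [Finset.sum_eq_single_of_mem 0 (by simp)
        fun k _ hk => by rw [switchCount_eq_zero (by omega), zero_mul]]
      simp only [zero_add, mul_zero, hzero, verticalSum_one, pathSum_zero]
  | succ n ih =>
    obtain ⟨ih_hor, ih_ver⟩ := ih (by omega)
    constructor
    · intro a F
      simp only [horizontalSum_add_two, ih_hor, ih_ver, Finset.sum_range_succ _ R,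
        switchCount_eq_zero (show n + 1 < 2 * R by omega), zero_mul, add_zero,
        switchCount_succ_succ (n + 1), Finset.mul_sum, ← Finset.sum_add_distrib]
      exact Finset.sum_congr rfl fun k _ => by ring
    · intro F
      simp only [verticalSum_add_two, ih_ver, ih_hor, Finset.sum_range_succ' _ R, mul_zero,
        switchCount_succ_zero (n + 1), Nat.mul_add_one 2, switchCount_succ_succ (n + 1),
        pathSum_succ_eq_merge _ F]
      rw [add_assoc, ← Finset.sum_add_distrib, mul_add, Finset.mul_sum, add_right_comm,
        ← Finset.sum_add_distrib, ← mul_assoc]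
      exact congrArg (· + _) (Finset.sum_congr rfl fun k _ => by ring)

theorem pathSum_collapse_rotate (n R : ℕ) (hR : n + 1 ≤ R) (F : List Step → ℝ) :
    pathSum (n + 2) (fun l => F (collapse (rotateLast (rotateAll l)))) =
      ∑ k ∈ Finset.range R, 2 * switchCount (n + 1) (2 * k + 1) * pathSum (k + 1) F := by
  have hhor (s : Step) (hs : s.isHorizontal = true) :
      pathSum (n + 1) (fun l => F (collapse (rotateLast (rotateAll (s :: l)))))
        = horizontalSum (n + 1) s F :=
    pathSum_congr fun l hl => by
      rw [rotateAll, if_pos hs, rotateLast_cons _ (List.ne_nil_of_length_eq_add_one hl)]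
  have hver (s : Step) (hs : s.isHorizontal = false) :
      pathSum (n + 1) (fun l => F (collapse (rotateLast (rotateAll (s :: l)))))
        = horizontalSum (n + 1) s.rotate F := by
    rw [horizontalSum,
      ← pathSum_map_rotate (n + 1) fun l => F (collapse (s.rotate :: rotateLast l))]
    refine pathSum_congr fun l hl => ?_
    have hmap : l.map Step.rotate ≠ [] :=
      List.ne_nil_of_length_eq_add_one (by rw [List.length_map, hl])
    rw [rotateAll, if_neg (by simp [hs]), List.map_cons, rotateLast_cons _ hmap]
  rw [pathSum_succ, sum_step, hhor .right rfl, hhor .left rfl, hver .up rfl, hver .down rfl]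
  simp only [Step.rotate, (horizontalSum_and_verticalSum_eq n R hR).1,
    ← Finset.sum_add_distrib, pathSum_succ_eq_merge _ F]
  exact Finset.sum_congr rfl fun k _ => by ring

theorem rdeg_of_two_le_length {l : List Step} (hl : 2 ≤ l.length) :
    rdeg l = rdeg (collapse (rotateLast (rotateAll l))) + 1 := by
  obtain ⟨l', hr, hne, -⟩ := reduce_spec l hl
  have hcollapse : collapse (rotateLast (rotateAll l)) = l' := by
    rwa [reduce, if_pos hl, Option.some.injEq] at hr
  obtain ⟨s, hs⟩ := (rdeg_eq_iff l' hne _).1 rfl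
  rw [hcollapse, rdeg_eq_iff l (by rintro rfl; simp at hl)]
  exact ⟨s, by rw [iterReduce, hr]; exact hs⟩

theorem rdeg_singleton (s : Step) : rdeg [s] = 0 :=
  (rdeg_eq_iff [s] (by simp) 0).2 ⟨s, rfl⟩

/-- The probability that a uniformly random path of length `n` has reduction degree at least
`r`. -/
noncomputable def degreeTail (r n : ℕ) : ℝ :=
  pathSum n (fun l => if r ≤ rdeg l then 1 else 0) / 4 ^ n

theorem degreeTail_zero (n : ℕ) : degreeTail 0 n = 1 := by
  simp [degreeTail, pathSum_const]

theorem degreeTail_succ (r n R : ℕ) (hR : n ≤ R) :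
    degreeTail (r + 1) (n + 1) = ∑ k ∈ Finset.range R,
      2 / 2 ^ n * (n.choose (2 * k + 1) : ℝ) * degreeTail r (k + 1) := by
  cases n with
  | zero => simp [degreeTail, pathSum_succ, pathSum_zero, rdeg_singleton]
  | succ n =>
    have hreduce : pathSum (n + 2) (fun l => if r + 1 ≤ rdeg l then (1 : ℝ) else 0) =
        ∑ k ∈ Finset.range R, 2 * switchCount (n + 1) (2 * k + 1) *
          pathSum (k + 1) (fun l => if r ≤ rdeg l then 1 else 0) := by
      rw [← pathSum_collapse_rotate n R hR fun l => if r ≤ rdeg l then 1 else 0]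
      exact pathSum_congr fun l hl => by
        simp only [rdeg_of_two_le_length (l := l) (by omega), Nat.add_le_add_iff_right]
    rw [degreeTail, hreduce, Finset.sum_div]
    refine Finset.sum_congr rfl fun k _ => ?_
    have hfour (m : ℕ) : (4 : ℝ) ^ m = 2 ^ m * 2 ^ m := by rw [← mul_pow]; norm_num
    rw [degreeTail, switchCount, hfour, hfour]
    field_simp
    ring

end LatticePath

/-! ### Binomial sums and roots of unity -/

theorem sum_range_two_mul_eq_add {M : Type*} [AddCommMonoid M] (f : ℕ → M) (n : ℕ) :
    ∑ i ∈ Finset.range (2 * n), f i =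
      ∑ k ∈ Finset.range n, f (2 * k) + ∑ k ∈ Finset.range n, f (2 * k + 1) := by
  induction n with
  | zero => simp
  | succ n ih =>
    simp only [Nat.mul_succ, Finset.sum_range_succ, ih]
    abel

theorem sum_range_choose_odd_mul_pow (n R : ℕ) (hR : n < 2 * R) (x : ℝ) :
    ∑ k ∈ Finset.range R, (n.choose (2 * k + 1) : ℝ) * x ^ (2 * k + 1)
      = ((1 + x) ^ n - (1 - x) ^ n) / 2 := by
  have hbinomial (y : ℝ) : (1 + y) ^ n = ∑ k ∈ Finset.range R, (n.choose (2 * k)) * y ^ (2 * k)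
      + ∑ k ∈ Finset.range R, (n.choose (2 * k + 1) : ℝ) * y ^ (2 * k + 1) := by
    rw [← sum_range_two_mul_eq_add fun i => (n.choose i : ℝ) * y ^ i, add_comm 1 y, add_pow]
    simp only [one_pow, mul_one]
    refine (Finset.sum_subset (Finset.range_subset_range.2 hR) fun i _ hi => ?_).trans
      (Finset.sum_congr rfl fun i _ => mul_comm _ _)
    rw [Nat.choose_eq_zero_of_lt (by simpa [Nat.lt_succ_iff] using hi), Nat.cast_zero, mul_zero]
  have hneg := hbinomial (-x)
  simp only [(even_two_mul _).neg_pow, Odd.neg_pow (odd_two_mul_add_one _), mul_neg,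
    Finset.sum_neg_distrib] at hneg
  rw [hbinomial x, sub_eq_add_neg 1 x, hneg]
  ring

theorem sum_range_choose_odd_mul_deriv_pow (n R : ℕ) (hR : n < 2 * R) (x : ℝ) :
    ∑ k ∈ Finset.range R, (n.choose (2 * k + 1) : ℝ) * ((2 * k + 1) * x ^ (2 * k))
      = n * ((1 + x) ^ (n - 1) + (1 - x) ^ (n - 1)) / 2 := by
  have hsum : HasDerivAt
      (fun y : ℝ => ∑ k ∈ Finset.range R, (n.choose (2 * k + 1) : ℝ) * y ^ (2 * k + 1))
      (∑ k ∈ Finset.range R, (n.choose (2 * k + 1) : ℝ) * ((2 * k + 1) * x ^ (2 * k))) x :=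
    HasDerivAt.fun_sum fun k _ => by
      simpa using (hasDerivAt_pow (2 * k + 1) x).const_mul (n.choose (2 * k + 1) : ℝ)
  have hpow : HasDerivAt (fun y : ℝ => ((1 + y) ^ n - (1 - y) ^ n) / 2)
      (n * ((1 + x) ^ (n - 1) + (1 - x) ^ (n - 1)) / 2) x := by
    convert! ((((hasDerivAt_id x).const_add 1).fun_pow n).sub
      (((hasDerivAt_id x).const_sub 1).fun_pow n)).div_const 2 using 1
    simp only [id_eq]
    ring
  simp only [sum_range_choose_odd_mul_pow n R hR] at hsum
  exact hsum.unique hpow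

theorem two_mul_cos_pow (m : ℕ) (x : ℝ) :
    (2 * Real.cos x) ^ m =
      ∑ i ∈ Finset.range (m + 1), (m.choose i : ℝ) * Real.cos ((2 * i - m) * x) := by
  have hcomplex : ((2 : ℂ) * Complex.cos x) ^ m =
      ∑ i ∈ Finset.range (m + 1),
        (m.choose i : ℂ) * Complex.exp (((2 * i - m) * x : ℝ) * Complex.I) := by
    rw [Complex.two_cos, add_pow]
    refine Finset.sum_congr rfl fun i hi => ?_
    have him : i ≤ m := Nat.lt_succ_iff.1 (Finset.mem_range.1 hi)
    rw [mul_comm, ← Complex.exp_nat_mul, ← Complex.exp_nat_mul, ← Complex.exp_add]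
    congr 2
    push_cast [him]
    ring
  have hre := congrArg Complex.re hcomplex
  simp only [← Complex.ofReal_cos, Complex.re_sum, ← Complex.ofReal_natCast, Complex.re_ofReal_mul,
    Complex.exp_ofReal_mul_I_re] at hre
  rw [← hre]
  norm_cast

theorem sum_range_sq_mul_choose_mul_cos (m : ℕ) (x : ℝ) :
    ∑ i ∈ Finset.range (m + 3),
        (2 * i - (m + 2)) ^ 2 * ((m + 2).choose i : ℝ) * Real.cos ((2 * i - (m + 2)) * x)
      = (m + 2) * 2 ^ (m + 2) * (Real.cos x ^ m * (1 - (m + 2) * Real.sin x ^ 2)) := by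
  have hlin (i : ℕ) (y : ℝ) :
      HasDerivAt (fun y : ℝ => (2 * (i : ℝ) - (m + 2)) * y) (2 * i - (m + 2)) y := by
    simpa using (hasDerivAt_id y).const_mul (2 * (i : ℝ) - (m + 2))
  have hsum₁ (y : ℝ) : HasDerivAt (fun y => (2 * Real.cos y) ^ (m + 2))
      (∑ i ∈ Finset.range (m + 3), ((m + 2).choose i : ℝ)
        * (-Real.sin ((2 * i - (m + 2)) * y) * (2 * i - (m + 2)))) y := by
    simp only [two_mul_cos_pow, Nat.cast_add, Nat.cast_ofNat]
    exact HasDerivAt.fun_sum fun i _ => (hlin i y).cos.const_mul _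
  have hpow₁ (y : ℝ) : HasDerivAt (fun y => (2 * Real.cos y) ^ (m + 2))
      (-(m + 2) * 2 ^ (m + 2) * (Real.cos y ^ (m + 1) * Real.sin y)) y := by
    convert! ((Real.hasDerivAt_cos y).const_mul 2).fun_pow (m + 2) using 1
    push_cast
    ring
  have hsum₂ := HasDerivAt.fun_sum (u := Finset.range (m + 3)) fun i _ =>
    ((((hlin i x).sin.neg.mul_const (2 * (i : ℝ) - (m + 2))).const_mul ((m + 2).choose i : ℝ)))
  have hpow₂ := (((Real.hasDerivAt_cos x).fun_pow (m + 1)).mul (Real.hasDerivAt_sin x)).const_mul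
    (-(m + 2) * 2 ^ (m + 2) : ℝ)
  have hderiv := hsum₂.unique (hpow₂.congr_of_eventuallyEq
    (Filter.Eventually.of_forall fun y => (hsum₁ y).unique (hpow₁ y)))
  calc _ = -∑ i ∈ Finset.range (m + 3), ((m + 2).choose i : ℝ)
        * (-(Real.cos ((2 * i - (m + 2)) * x) * (2 * i - (m + 2))) * (2 * i - (m + 2))) := by
        rw [← Finset.sum_neg_distrib]
        exact Finset.sum_congr rfl fun i _ => by ring
    _ = _ := by
        rw [hderiv, Nat.add_sub_cancel, Real.sin_sq]
        push_cast
        ring_nf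
        rw [Real.sin_sq]
        ring

theorem sum_range_cos_two_pi_mul_div {N : ℕ} (hN : N ≠ 0) (m : ℤ) :
    ∑ j ∈ Finset.range N, Real.cos (m * (2 * Real.pi * j / N)) =
      if (N : ℤ) ∣ m then (N : ℝ) else 0 := by
  have hroot := Complex.isPrimitiveRoot_exp N hN
  set ζ := Complex.exp (2 * Real.pi * Complex.I / N) with hζ
  have hcos (j : ℕ) : Real.cos (m * (2 * Real.pi * j / N)) = ((ζ ^ m) ^ j).re := by
    rw [hζ, ← Complex.exp_int_mul, ← Complex.exp_nat_mul, ← Complex.exp_ofReal_mul_I_re]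
    congr 2
    push_cast
    ring
  simp only [hcos, ← Complex.re_sum]
  split_ifs with hdvd
  · simp [(hroot.zpow_eq_one_iff_dvd m).2 hdvd]
  · have hpow : (ζ ^ m) ^ N = 1 := by
      rw [← zpow_natCast, zpow_comm, zpow_natCast, hroot.pow_eq_one, one_zpow]
    rw [geom_sum_eq (fun h => hdvd ((hroot.zpow_eq_one_iff_dvd m).1 h)), hpow]
    simp

theorem sum_range_two_mul_add_one_of_even {f : ℤ → ℝ} (hf : f.Even) (n : ℕ) :
    ∑ i ∈ Finset.range (2 * n + 1), f (i - n) = f 0 + 2 * ∑ k ∈ Finset.range n, f (k + 1) := by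
  have hreflect : ∑ i ∈ Finset.range n, f (i - n) = ∑ k ∈ Finset.range n, f (k + 1) := by
    rw [← Finset.sum_range_reflect]
    refine Finset.sum_congr rfl fun k hk => ?_
    rw [← hf]
    congr 1
    have := Finset.mem_range.1 hk
    omega
  rw [two_mul, add_assoc, Finset.sum_range_add, hreflect, Finset.sum_range_succ']
  push_cast
  simp only [add_sub_cancel_left]
  ring

theorem sum_range_ite_dvd_eq_tsum {N : ℕ} (hN : N ≠ 0) {M : ℕ} {f : ℕ → ℝ} (hzero : f 0 = 0)
    (hf : ∀ k, M ≤ k → f k = 0) :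
    ∑ k ∈ Finset.range M, (if N ∣ k then f k else 0) = ∑' l : ℕ, f ((l + 1) * N) := by
  have hinj : Function.Injective fun l : ℕ => (l + 1) * N := fun a b h =>
    Nat.succ_injective (Nat.eq_of_mul_eq_mul_right (Nat.pos_of_ne_zero hN) h)
  have hsupport : Function.support (fun k => if N ∣ k then f k else 0) ⊆
      Set.range fun l : ℕ => (l + 1) * N := by
    intro k hk
    obtain ⟨⟨d, rfl⟩, hne⟩ : N ∣ k ∧ f k ≠ 0 := by simpa using hk
    rcases d with _ | d
    · exact absurd hzero (by simpa using hne)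
    · exact ⟨d, mul_comm _ _⟩
  have hsum : ∑' k, (if N ∣ k then f k else 0) =
      ∑ k ∈ Finset.range M, if N ∣ k then f k else 0 :=
    tsum_eq_sum fun k hk => by simp [hf k (not_lt.1 fun h => hk (Finset.mem_range.2 h))]
  rw [← hsum, ← hinj.tsum_eq hsupport]
  simp

theorem choose_two_mul_eq_choose_add_natAbs {n i : ℕ} (hi : i ≤ 2 * n) :
    (2 * n).choose i = (2 * n).choose (n + ((i : ℤ) - n).natAbs) := by
  rcases le_total n i with h | h
  · congr 1
    omega
  · rw [← Nat.choose_symm hi]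
    congr 1
    omega

namespace LatticePath

/-- The trigonometric polynomial whose values at the points `2 π j / 2 ^ r` add up to the tail
probability `degreeTail r (n + 1)`. It is `-2 / (n + 1)` times the second derivative of
`cos (θ / 2) ^ (2 * (n + 1))`. -/
noncomputable def kernel (n : ℕ) (θ : ℝ) : ℝ :=
  Real.cos (θ / 2) ^ (2 * n) * (1 - 2 * (n + 1) * Real.sin (θ / 2) ^ 2)

theorem sum_choose_odd_mul_kernel (n R : ℕ) (hR : n < 2 * R) (θ : ℝ) :
    ∑ k ∈ Finset.range R, 2 / 2 ^ n * (n.choose (2 * k + 1) : ℝ) * kernel k θ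
      = kernel n (θ / 2) + kernel n (θ / 2 + Real.pi) := by
  set c := Real.cos (θ / 2) with hc
  have hsplit : ∑ k ∈ Finset.range R, 2 / 2 ^ n * (n.choose (2 * k + 1) : ℝ) * kernel k θ =
      2 / 2 ^ n * (c * ∑ k ∈ Finset.range R, (n.choose (2 * k + 1) : ℝ) * c ^ (2 * k + 1)
        - (1 - c ^ 2) * ∑ k ∈ Finset.range R,
          (n.choose (2 * k + 1) : ℝ) * ((2 * k + 1) * c ^ (2 * k))) := by
    rw [Finset.mul_sum, Finset.mul_sum, ← Finset.sum_sub_distrib, Finset.mul_sum]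
    refine Finset.sum_congr rfl fun k _ => ?_
    rw [kernel, Real.sin_sq, ← hc]
    ring
  have hderiv : (1 - c ^ 2) * (n * ((1 + c) ^ (n - 1) + (1 - c) ^ (n - 1)) / 2) =
      n / 2 * ((1 - c) * (1 + c) ^ n + (1 + c) * (1 - c) ^ n) := by
    cases n with
    | zero => simp
    | succ n =>
      rw [Nat.add_sub_cancel]
      ring
  have hcos : c = 2 * Real.cos (θ / 2 / 2) ^ 2 - 1 := by
    rw [hc, ← Real.cos_two_mul, mul_div_cancel₀ _ two_ne_zero]
  have hadd : (1 + c) ^ n = 2 ^ n * Real.cos (θ / 2 / 2) ^ (2 * n) := by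
    rw [hcos, pow_mul, ← mul_pow]
    ring
  have hsub : (1 - c) ^ n = 2 ^ n * Real.sin (θ / 2 / 2) ^ (2 * n) := by
    rw [hcos, pow_mul, Real.sin_sq, ← mul_pow]
    ring
  rw [hsplit, sum_range_choose_odd_mul_pow n R hR, sum_range_choose_odd_mul_deriv_pow n R hR,
    hderiv, hadd, hsub, kernel, kernel, add_div (θ / 2), Real.cos_add_pi_div_two,
    Real.sin_add_pi_div_two, (even_two_mul n).neg_pow, hcos, Real.sin_sq]
  field_simp
  ring

theorem degreeTail_eq_sum_kernel (r n : ℕ) :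
    degreeTail r (n + 1) = ∑ j ∈ Finset.range (2 ^ r), kernel n (2 * Real.pi * j / 2 ^ r) := by
  induction r generalizing n with
  | zero => simp [degreeTail_zero, kernel]
  | succ r ih =>
    simp only [degreeTail_succ r n (n + 1) n.le_succ, ih, Finset.mul_sum]
    rw [Finset.sum_comm, pow_succ 2 r, mul_two, Finset.sum_range_add, ← Finset.sum_add_distrib]
    refine Finset.sum_congr rfl fun j _ => ?_
    rw [sum_choose_odd_mul_kernel n (n + 1) (by omega)]
    congr 2
    · field_simp
      ring
    · push_cast
      field_simp
      ring

theorem kernel_eq_sum_choose (n : ℕ) (θ : ℝ) :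
    kernel n θ = 4 / (n + 1) * ∑ k ∈ Finset.range (n + 2),
      (k : ℝ) ^ 2 * ((2 * (n + 1)).choose (n + 1 + k) / 4 ^ (n + 1)) * Real.cos (k * θ) := by
  let f (k : ℤ) : ℝ :=
    (2 * k) ^ 2 * (2 * (n + 1)).choose (n + 1 + k.natAbs) * Real.cos (k * θ)
  have hf : f.Even := fun k => by simp [f]
  have hsum := sum_range_sq_mul_choose_mul_cos (2 * n) (θ / 2)
  have hcenter : ∑ i ∈ Finset.range (2 * n + 3), (2 * i - ((2 * n : ℕ) + 2)) ^ 2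
      * ((2 * n + 2).choose i : ℝ) * Real.cos ((2 * i - ((2 * n : ℕ) + 2)) * (θ / 2))
      = ∑ i ∈ Finset.range (2 * (n + 1) + 1), f (i - (n + 1 : ℕ)) := by
    refine Finset.sum_congr rfl fun i hi => ?_
    have hi' : i ≤ 2 * (n + 1) := Nat.lt_succ_iff.1 (Finset.mem_range.1 hi)
    simp only [f, ← choose_two_mul_eq_choose_add_natAbs hi']
    push_cast
    ring_nf
  have hpow : (2 : ℝ) ^ (2 * n + 2) = 4 ^ (n + 1) := by
    rw [← mul_add_one, pow_mul]
    norm_num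
  rw [hcenter, sum_range_two_mul_add_one_of_even hf, hpow] at hsum
  have hterm (k : ℕ) : f (k + 1) = 4 * 4 ^ (n + 1) * (((k + 1 : ℕ) : ℝ) ^ 2 *
      ((2 * (n + 1)).choose (n + 1 + (k + 1)) / 4 ^ (n + 1)) * Real.cos ((k + 1 : ℕ) * θ)) := by
    have habs : ((k : ℤ) + 1).natAbs = k + 1 := by omega
    simp only [f, habs]
    push_cast
    field_simp
    ring
  have hf_zero : f 0 = 0 := by simp [f]
  rw [Finset.sum_congr rfl fun k _ => hterm k, ← Finset.mul_sum, hf_zero, zero_add] at hsum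
  rw [Finset.sum_range_succ', kernel]
  set S := ∑ k ∈ Finset.range (n + 1), ((k + 1 : ℕ) : ℝ) ^ 2 *
    ((2 * (n + 1)).choose (n + 1 + (k + 1)) / 4 ^ (n + 1)) * Real.cos ((k + 1 : ℕ) * θ)
  push_cast at hsum ⊢
  field_simp
  linear_combination (-1 / 2 : ℝ) * hsum

theorem degreeTail_eq_tsum_choose (r n : ℕ) :
    degreeTail r (n + 1) = ∑' l : ℕ, 4 * 2 ^ r / (n + 1) * ((l + 1) * 2 ^ r) ^ 2 *
      ((2 * (n + 1)).choose (n + 1 + (l + 1) * 2 ^ r) / 4 ^ (n + 1) : ℝ) := by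
  have hN : 2 ^ r ≠ 0 := by positivity
  let f (k : ℕ) : ℝ := 4 * 2 ^ r / (n + 1) * k ^ 2 *
    ((2 * (n + 1)).choose (n + 1 + k) / 4 ^ (n + 1) : ℝ)
  have hcos (k : ℕ) : ∑ j ∈ Finset.range (2 ^ r), Real.cos (k * (2 * Real.pi * j / 2 ^ r)) =
      if 2 ^ r ∣ k then (2 : ℝ) ^ r else 0 := by
    have h := sum_range_cos_two_pi_mul_div hN k
    simp only [Int.natCast_dvd_natCast] at h
    exact_mod_cast h
  calc degreeTail r (n + 1)
      = ∑ k ∈ Finset.range (n + 2), if 2 ^ r ∣ k then f k else 0 := by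
        simp only [degreeTail_eq_sum_kernel, kernel_eq_sum_choose, ← Finset.mul_sum]
        rw [Finset.sum_comm]
        simp only [← Finset.mul_sum, hcos]
        rw [Finset.mul_sum]
        refine Finset.sum_congr rfl fun k _ => ?_
        simp only [f]
        split_ifs <;> ring
    _ = ∑' l : ℕ, f ((l + 1) * 2 ^ r) := by
        refine sum_range_ite_dvd_eq_tsum hN (by simp [f]) fun k hk => ?_
        simp only [f]
        rw [Nat.choose_eq_zero_of_lt (by omega), Nat.cast_zero, zero_div, mul_zero]
    _ = _ := by simp [f]

end LatticePath

/-! ### Theta series and the limiting tail -/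

/-- The partial theta series `∑ k ^ (2 * m) * exp (-k² * t)` over positive integers `k`; these are,
up to sign, the successive derivatives of the one with `m = 0`. -/
noncomputable def thetaSum (m : ℕ) (t : ℝ) : ℝ :=
  ∑' i : ℕ, ((i : ℝ) + 1) ^ (2 * m) * Real.exp (-((i : ℝ) + 1) ^ 2 * t)

theorem summable_thetaSum (m : ℕ) {t : ℝ} (ht : 0 < t) :
    Summable fun i : ℕ => ((i : ℝ) + 1) ^ (2 * m) * Real.exp (-((i : ℝ) + 1) ^ 2 * t) := by
  have h := (summable_nat_add_iff 1).2 (Real.summable_pow_mul_exp_neg_nat_mul (2 * m) ht)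
  refine h.of_nonneg_of_le (fun i => by positivity) fun i => ?_
  push_cast
  gcongr _ * Real.exp ?_
  have hi : (1 : ℝ) ≤ i + 1 := by simp
  nlinarith [mul_nonneg ht.le (sub_nonneg.2 hi)]

theorem thetaSum_nonneg (m : ℕ) (t : ℝ) : 0 ≤ thetaSum m t :=
  tsum_nonneg fun i => by positivity

theorem hasDerivAt_thetaSum (m : ℕ) {t : ℝ} (ht : 0 < t) :
    HasDerivAt (thetaSum m) (-thetaSum (m + 1) t) t := by
  have hmem : t ∈ Set.Ioi (t / 2) := half_lt_self ht
  rw [thetaSum, ← tsum_neg]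
  refine hasDerivAt_tsum_of_isPreconnected
    (g := fun (i : ℕ) y => ((i : ℝ) + 1) ^ (2 * m) * Real.exp (-((i : ℝ) + 1) ^ 2 * y))
    (g' := fun (i : ℕ) y =>
      -(((i : ℝ) + 1) ^ (2 * (m + 1)) * Real.exp (-((i : ℝ) + 1) ^ 2 * y)))
    (summable_thetaSum (m + 1) (half_pos ht)) isOpen_Ioi
    isPreconnected_Ioi (fun i y _ => ?_) (fun i y hy => ?_) hmem (summable_thetaSum m ht) hmem
  · have hlin : HasDerivAt (fun y : ℝ => -((i : ℝ) + 1) ^ 2 * y) (-((i : ℝ) + 1) ^ 2) y := by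
      simpa using (hasDerivAt_id y).const_mul (-((i : ℝ) + 1) ^ 2)
    exact (hlin.exp.const_mul (((i : ℝ) + 1) ^ (2 * m))).congr_deriv (by ring)
  · rw [norm_neg, Real.norm_of_nonneg (by positivity)]
    gcongr _ * Real.exp ?_
    nlinarith [sq_nonneg ((i : ℝ) + 1), Set.mem_Ioi.1 hy]

theorem continuousOn_thetaSum (m : ℕ) : ContinuousOn (thetaSum m) (Set.Ioi 0) := fun _ ht =>
  (hasDerivAt_thetaSum m ht).continuousAt.continuousWithinAt

theorem thetaSum_le (m : ℕ) {t : ℝ} (ht : 1 ≤ t) :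
    thetaSum m t ≤ thetaSum m 1 * Real.exp 1 * Real.exp (-t) := by
  rw [thetaSum, thetaSum, mul_assoc, ← Real.exp_add, ← tsum_mul_right]
  refine Summable.tsum_le_tsum (fun i => ?_) (summable_thetaSum m (by linarith))
    ((summable_thetaSum m one_pos).mul_right _)
  rw [mul_assoc, ← Real.exp_add]
  gcongr
  have hi : (1 : ℝ) ≤ ((i : ℝ) + 1) ^ 2 := one_le_pow₀ (by simp)
  nlinarith

theorem pow_mul_exp_neg_le (k : ℕ) {x : ℝ} (hx : 0 ≤ x) :
    x ^ k * Real.exp (-x) ≤ k.factorial := by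
  have h := Real.pow_div_factorial_le_exp x hx k
  rw [div_le_iff₀ (by positivity)] at h
  rwa [Real.exp_neg, ← div_eq_mul_inv, div_le_iff₀ (Real.exp_pos x), mul_comm]

theorem isBigO_rpow_mul_thetaSum (p : ℝ) (m : ℕ) :
    (fun t => t ^ p * thetaSum m t) =O[𝓟 (Set.Ici 1)] fun t => t⁻¹ := by
  let k := ⌈p⌉₊
  refine isBigO_principal.2 ⟨thetaSum m 1 * Real.exp 1 * (k + 1).factorial, fun t ht => ?_⟩
  have ht' : 1 ≤ t := ht
  have ht_pos : 0 < t := one_pos.trans_le ht'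
  have hm := thetaSum_nonneg m 1
  have hpow : t ^ p ≤ t ^ k := by
    rw [← Real.rpow_natCast]
    exact Real.rpow_le_rpow_of_exponent_le ht' (Nat.le_ceil p)
  rw [Real.norm_of_nonneg (mul_nonneg (by positivity) (thetaSum_nonneg m t)),
    Real.norm_of_nonneg (by positivity)]
  calc t ^ p * thetaSum m t
      ≤ t ^ k * (thetaSum m 1 * Real.exp 1 * Real.exp (-t)) := by
        gcongr
        exacts [thetaSum_nonneg m t, thetaSum_le m ht']
    _ = thetaSum m 1 * Real.exp 1 * (t ^ (k + 1) * Real.exp (-t)) * t⁻¹ := by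
        field_simp
        ring
    _ ≤ _ := by
        gcongr
        exact pow_mul_exp_neg_le (k + 1) ht_pos.le

theorem tsum_int_exp_neg_mul_sq {t : ℝ} (ht : 0 < t) :
    ∑' n : ℤ, Real.exp (-t * (n : ℝ) ^ 2) = 1 + 2 * thetaSum 0 t := by
  have heven : (fun n : ℤ => Real.exp (-t * (n : ℝ) ^ 2)).Even := fun n => by simp
  have hterm (i : ℕ) : ((i : ℝ) + 1) ^ (2 * 0) * Real.exp (-((i : ℝ) + 1) ^ 2 * t)
      = Real.exp (-t * ((i + 1 : ℕ) : ℝ) ^ 2) := by simp [mul_comm]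
  have hsum_nat : Summable fun n : ℕ => Real.exp (-t * (n : ℝ) ^ 2) :=
    (summable_nat_add_iff 1).1 ((summable_thetaSum 0 ht).congr hterm)
  have hsum_int : Summable fun n : ℤ => Real.exp (-t * (n : ℝ) ^ 2) :=
    .of_nat_of_neg (by simpa using hsum_nat) (by simpa using hsum_nat)
  rw [tsum_int_eq_zero_add_two_mul_tsum_pnat heven hsum_int, thetaSum, tsum_congr hterm]
  simp [tsum_pnat_eq_tsum_succ (f := fun n : ℕ => Real.exp (-(t * (n : ℝ) ^ 2)))]

theorem thetaSum_functional_equation {t : ℝ} (ht : 0 < t) :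
    1 + 2 * thetaSum 0 t =
      Real.sqrt Real.pi * t ^ (-(1 / 2) : ℝ) * (1 + 2 * thetaSum 0 (Real.pi ^ 2 / t)) := by
  have h := Real.tsum_exp_neg_mul_int_sq (a := t / Real.pi) (by positivity)
  have harg : -Real.pi * (t / Real.pi) = -t := by field_simp
  have hdual : -Real.pi / (t / Real.pi) = -(Real.pi ^ 2 / t) := by field_simp
  rw [harg, hdual, tsum_int_exp_neg_mul_sq ht, tsum_int_exp_neg_mul_sq (by positivity)] at h
  rw [h, Real.div_rpow ht.le Real.pi_pos.le, Real.rpow_neg ht.le, Real.sqrt_eq_rpow]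
  field_simp

namespace LatticePath

/-- The limit law of the reduction degree: `P(D n ≥ r)` is approximated by
`limitTail (4 ^ r / n)`. -/
noncomputable def limitTail (t : ℝ) : ℝ :=
  4 / Real.sqrt Real.pi * t ^ (3 / 2 : ℝ) * thetaSum 1 t

/-- The derivative of `limitTail` on the positive half-line. -/
noncomputable def limitTailDeriv (t : ℝ) : ℝ :=
  4 / Real.sqrt Real.pi * ((3 / 2) * t ^ (1 / 2 : ℝ) * thetaSum 1 t
    - t ^ (3 / 2 : ℝ) * thetaSum 2 t)

theorem hasDerivAt_limitTail {t : ℝ} (ht : 0 < t) :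
    HasDerivAt limitTail (limitTailDeriv t) t := by
  have hrpow := Real.hasDerivAt_rpow_const (x := t) (p := 3 / 2) (Or.inl ht.ne')
  refine ((hrpow.const_mul (4 / Real.sqrt Real.pi)).mul (hasDerivAt_thetaSum 1 ht)).congr_deriv ?_
  rw [limitTailDeriv]
  norm_num
  ring

theorem continuousOn_limitTail : ContinuousOn limitTail (Set.Ioi 0) := fun _ ht =>
  (hasDerivAt_limitTail ht).continuousAt.continuousWithinAt

theorem continuousOn_limitTailDeriv : ContinuousOn limitTailDeriv (Set.Ioi 0) := by
  have hrpow (p : ℝ) : ContinuousOn (fun t : ℝ => t ^ p) (Set.Ioi 0) :=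
    continuousOn_id.rpow_const fun t ht => Or.inl (ne_of_gt ht)
  exact continuousOn_const.mul (((continuousOn_const.mul (hrpow _)).mul
    (continuousOn_thetaSum 1)).sub ((hrpow _).mul (continuousOn_thetaSum 2)))

theorem hasDerivAt_const_div (c : ℝ) {t : ℝ} (ht : t ≠ 0) :
    HasDerivAt (fun t : ℝ => c / t) (-(c / t) / t) t :=
  ((hasDerivAt_inv ht).const_mul c).congr_deriv (by field_simp)

-- Obtained by differentiating the functional equation of the theta series.
theorem limitTail_eq_dual {t : ℝ} (ht : 0 < t) :
    limitTail t = 1 + 2 * thetaSum 0 (Real.pi ^ 2 / t)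
      - 4 * (Real.pi ^ 2 / t) * thetaSum 1 (Real.pi ^ 2 / t) := by
  have hw : 0 < Real.pi ^ 2 / t := by positivity
  have hleft : HasDerivAt (fun t => 1 + 2 * thetaSum 0 t) (2 * -thetaSum 1 t) t :=
    ((hasDerivAt_thetaSum 0 ht).const_mul 2).const_add 1
  have hright := ((Real.hasDerivAt_rpow_const (x := t) (p := -(1 / 2)) (Or.inl ht.ne')).const_mul
    (Real.sqrt Real.pi)).mul ((((hasDerivAt_thetaSum 0 hw).comp t
      (hasDerivAt_const_div _ ht.ne')).const_mul 2).const_add 1)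
  have hderiv := hleft.unique (hright.congr_of_eventuallyEq
    ((eventually_gt_nhds ht).mono fun s hs => thetaSum_functional_equation hs))
  have hpow_sub_one : t ^ (-(1 / 2) - 1 : ℝ) = (t ^ (3 / 2 : ℝ))⁻¹ := by
    rw [← Real.rpow_neg ht.le]; norm_num
  have hpow : t ^ (-(1 / 2) : ℝ) = t * (t ^ (3 / 2 : ℝ))⁻¹ := by
    rw [← Real.rpow_neg ht.le, ← Real.rpow_one_add' ht.le] <;> norm_num
  have hsqrt : 0 < Real.sqrt Real.pi := Real.sqrt_pos.2 Real.pi_pos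
  have hrpow_pos : 0 < t ^ (3 / 2 : ℝ) := by positivity
  rw [hpow_sub_one, hpow] at hderiv
  simp only [Function.comp, zero_add] at hderiv
  rw [limitTail]
  field_simp at hderiv ⊢
  linarith

theorem mul_limitTailDeriv_eq_dual {t : ℝ} (ht : 0 < t) :
    t * limitTailDeriv t = 6 * (Real.pi ^ 2 / t) * thetaSum 1 (Real.pi ^ 2 / t)
      - 4 * (Real.pi ^ 2 / t) ^ 2 * thetaSum 2 (Real.pi ^ 2 / t) := by
  have hw : 0 < Real.pi ^ 2 / t := by positivity
  have hdiv := hasDerivAt_const_div (Real.pi ^ 2) ht.ne'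
  have hright := ((((hasDerivAt_thetaSum 0 hw).comp t hdiv).const_mul 2).const_add 1).sub
    ((hdiv.const_mul 4).mul ((hasDerivAt_thetaSum 1 hw).comp t hdiv))
  have hderiv := (hasDerivAt_limitTail ht).unique (hright.congr_of_eventuallyEq
    ((eventually_gt_nhds ht).mono fun s hs => by simpa using limitTail_eq_dual hs))
  rw [hderiv]
  simp only [Function.comp, zero_add]
  field_simp
  ring

theorem isBigO_limitTail : limitTail =O[𝓟 (Set.Ici 1)] fun t => t⁻¹ := by
  refine ((isBigO_rpow_mul_thetaSum (3 / 2) 1).const_mul_left (4 / Real.sqrt Real.pi)).congr_left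
    fun t => ?_
  rw [limitTail, mul_assoc]

theorem isBigO_mul_limitTailDeriv : (fun t => t * limitTailDeriv t) =O[𝓟 (Set.Ici 1)]
    fun t => t⁻¹ := by
  refine ((((isBigO_rpow_mul_thetaSum (3 / 2) 1).const_mul_left (3 / 2)).sub
    (isBigO_rpow_mul_thetaSum (5 / 2) 2)).const_mul_left (4 / Real.sqrt Real.pi)).congr' ?_
    EventuallyEq.rfl
  refine mem_principal.2 fun t ht => ?_
  have ht_pos : 0 < t := one_pos.trans_le ht
  have hrpow (p : ℝ) : t ^ (p + 1) = t * t ^ p := by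
    rw [Real.rpow_add_one ht_pos.ne', mul_comm]
  have hthree : (3 / 2 : ℝ) = 1 / 2 + 1 := by norm_num
  have hfive : (5 / 2 : ℝ) = 3 / 2 + 1 := by norm_num
  simp only [Set.mem_ofPred_eq, limitTailDeriv]
  rw [hfive, hrpow, hthree, hrpow]
  ring

theorem isBigO_dual_pow_mul_thetaSum (k m : ℕ) :
    (fun t => (Real.pi ^ 2 / t) ^ k * thetaSum m (Real.pi ^ 2 / t)) =O[𝓟 (Set.Ioc 0 1)]
      fun t => t := by
  have hmaps : Tendsto (fun t => Real.pi ^ 2 / t) (𝓟 (Set.Ioc 0 1)) (𝓟 (Set.Ici 1)) := by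
    refine tendsto_principal_principal.2 fun t ht => ?_
    rw [Set.mem_Ici, le_div_iff₀ ht.1]
    nlinarith [Real.pi_gt_three, ht.2]
  have h := (isBigO_rpow_mul_thetaSum k m).comp_tendsto hmaps
  simp only [Function.comp_def, Real.rpow_natCast, inv_div, div_eq_inv_mul _ (Real.pi ^ 2)] at h
  simpa only [div_eq_inv_mul] using h.trans ((isBigO_refl _ _).const_mul_left _)

theorem isBigO_limitTail_sub_one : (fun t => limitTail t - 1) =O[𝓟 (Set.Ioc 0 1)]
    fun t => t := by
  refine (((isBigO_dual_pow_mul_thetaSum 0 0).const_mul_left 2).sub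
    ((isBigO_dual_pow_mul_thetaSum 1 1).const_mul_left 4)).congr' ?_ EventuallyEq.rfl
  refine mem_principal.2 fun t ht => ?_
  simp only [Set.mem_ofPred_eq, limitTail_eq_dual ht.1]
  ring

theorem isBigO_mul_limitTailDeriv_Ioc : (fun t => t * limitTailDeriv t) =O[𝓟 (Set.Ioc 0 1)]
    fun t => t := by
  refine (((isBigO_dual_pow_mul_thetaSum 1 1).const_mul_left 6).sub
    ((isBigO_dual_pow_mul_thetaSum 2 2).const_mul_left 4)).congr' ?_ EventuallyEq.rfl
  refine mem_principal.2 fun t ht => ?_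
  simp only [Set.mem_ofPred_eq, mul_limitTailDeriv_eq_dual ht.1]
  ring

end LatticePath

/-! ### Trigonometric and exponential estimates -/

section CosineBounds

variable {x : ℝ}

theorem mul_cos_le_sin (hx : 0 ≤ x) (hx' : x ≤ Real.pi / 2) : x * Real.cos x ≤ Real.sin x := by
  rcases hx'.lt_or_eq with hlt | rfl
  · have hcos : 0 < Real.cos x := Real.cos_pos_of_mem_Ioo ⟨by linarith [Real.pi_pos], hlt⟩
    rw [← le_div_iff₀ hcos, ← Real.tan_eq_sin_div_cos]
    exact Real.le_tan hx hlt
  · simp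

theorem cos_mul_exp_sq_div_two_le_one (hx : 0 ≤ x) (hx' : x ≤ Real.pi / 2) :
    Real.cos x * Real.exp (x ^ 2 / 2) ≤ 1 := by
  have hderiv (y : ℝ) : HasDerivAt (fun y => Real.cos y * Real.exp (y ^ 2 / 2))
      (Real.exp (y ^ 2 / 2) * (y * Real.cos y - Real.sin y)) y := by
    have hsq : HasDerivAt (fun y : ℝ => y ^ 2 / 2) y y :=
      ((hasDerivAt_pow 2 y).div_const 2).congr_deriv (by norm_num)
    exact ((Real.hasDerivAt_cos y).mul hsq.exp).congr_deriv (by ring)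
  have hanti : AntitoneOn (fun y => Real.cos y * Real.exp (y ^ 2 / 2))
      (Set.Icc 0 (Real.pi / 2)) := by
    refine antitoneOn_of_deriv_nonpos (convex_Icc _ _)
      (fun y _ => (hderiv y).continuousAt.continuousWithinAt)
      (fun y _ => (hderiv y).differentiableAt.differentiableWithinAt) fun y hy => ?_
    rw [interior_Icc] at hy
    rw [(hderiv y).deriv]
    exact mul_nonpos_of_nonneg_of_nonpos (Real.exp_pos _).le
      (sub_nonpos.2 (mul_cos_le_sin hy.1.le hy.2.le))
  simpa using hanti ⟨le_rfl, by positivity⟩ ⟨hx, hx'⟩ hx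

theorem one_sub_le_cos_mul_exp_sq_div_two (hx : 0 ≤ x) (hx' : x ≤ Real.pi / 2) :
    1 - x ^ 4 / 4 ≤ Real.cos x * Real.exp (x ^ 2 / 2) := by
  have hcos : 0 ≤ Real.cos x := Real.cos_nonneg_of_mem_Icc ⟨by linarith [Real.pi_pos], hx'⟩
  rcases le_total 0 (1 - x ^ 2 / 2) with h | h
  · calc 1 - x ^ 4 / 4 = (1 - x ^ 2 / 2) * (x ^ 2 / 2 + 1) := by ring
      _ ≤ _ := by
        gcongr
        exacts [Real.one_sub_sq_div_two_le_cos, Real.add_one_le_exp _]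
  · have hmul : 0 ≤ Real.cos x * Real.exp (x ^ 2 / 2) := by positivity
    nlinarith

theorem abs_cos_pow_sub_exp_le (n : ℕ) (hx : 0 ≤ x) (hx' : x ≤ Real.pi / 2) :
    |Real.cos x ^ (2 * n) - Real.exp (-(n * x ^ 2))| ≤ n * x ^ 4 / 2 * Real.exp (-(n * x ^ 2)) := by
  have hcos : 0 ≤ Real.cos x := Real.cos_nonneg_of_mem_Icc ⟨by linarith [Real.pi_pos], hx'⟩
  set c := Real.cos x * Real.exp (x ^ 2 / 2) with hc
  have hc_nonneg : 0 ≤ c := by positivity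
  have hc_le : c ≤ 1 := cos_mul_exp_sq_div_two_le_one hx hx'
  have hc_ge : 1 - x ^ 4 / 4 ≤ c := one_sub_le_cos_mul_exp_sq_div_two hx hx'
  have hfactor : Real.cos x ^ (2 * n) = c ^ (2 * n) * Real.exp (-(n * x ^ 2)) := by
    have hexp : ((2 * n : ℕ) : ℝ) * (x ^ 2 / 2) + -(n * x ^ 2) = 0 := by push_cast; ring
    rw [hc, mul_pow, ← Real.exp_nat_mul, mul_assoc, ← Real.exp_add, hexp, Real.exp_zero, mul_one]
  have hpow_ge : 1 - n * x ^ 4 / 2 ≤ c ^ (2 * n) := by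
    have hbernoulli := one_add_mul_le_pow (a := c - 1) (by linarith) (2 * n)
    rw [add_sub_cancel] at hbernoulli
    push_cast at hbernoulli
    nlinarith [mul_le_mul_of_nonneg_left hc_ge n.cast_nonneg]
  have hpow_le : c ^ (2 * n) ≤ 1 := pow_le_one₀ hc_nonneg hc_le
  have hexp_pos := Real.exp_pos (-(n * x ^ 2))
  rw [hfactor, abs_le]
  constructor <;> nlinarith

theorem sq_sub_sin_sq_le (hx : 0 ≤ x) (hx' : x ≤ Real.pi / 2) :
    x ^ 2 - Real.sin x ^ 2 ≤ x ^ 4 := by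
  have hcos : 0 ≤ Real.cos x := Real.cos_nonneg_of_mem_Icc ⟨by linarith [Real.pi_pos], hx'⟩
  calc x ^ 2 - Real.sin x ^ 2 ≤ x ^ 2 - (x * Real.cos x) ^ 2 := by
        gcongr
        exact mul_cos_le_sin hx hx'
    _ = x ^ 2 * Real.sin x ^ 2 := by linear_combination (-x ^ 2) * Real.sin_sq_add_cos_sq x
    _ ≤ x ^ 2 * x ^ 2 := mul_le_mul_of_nonneg_left Real.sin_sq_le_sq (sq_nonneg x)
    _ = x ^ 4 := by ring

theorem exp_sq_le_of_le_pi_div_two (hx : 0 ≤ x) (hx' : x ≤ Real.pi / 2) :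
    Real.exp (x ^ 2) ≤ 60 := by
  have hsq : x ^ 2 ≤ (4 : ℕ) := by push_cast; nlinarith [Real.pi_lt_four]
  calc Real.exp (x ^ 2) ≤ Real.exp (4 : ℕ) := Real.exp_le_exp.2 hsq
    _ = Real.exp 1 ^ 4 := by rw [← Real.exp_nat_mul, mul_one]
    _ ≤ 2.7182818286 ^ 4 := by gcongr; exact Real.exp_one_lt_d9.le
    _ ≤ 60 := by norm_num

end CosineBounds

theorem cubic_mul_exp_neg_le {z : ℝ} (hz : 0 < z) :
    (z + (9 / 2) * z ^ 2 + z ^ 3) * Real.exp (-z) ≤ 53 / z := by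
  have htwo := pow_mul_exp_neg_le 2 hz.le
  have hthree := pow_mul_exp_neg_le 3 hz.le
  have hfour := pow_mul_exp_neg_le 4 hz.le
  norm_num [Nat.factorial] at htwo hthree hfour
  rw [le_div_iff₀ hz]
  linarith

theorem hasSum_one_div_succ_sq :
    HasSum (fun i : ℕ => 1 / ((i : ℝ) + 1) ^ 2) (Real.pi ^ 2 / 6) := by
  simpa using (hasSum_nat_add_iff' 1).2 hasSum_zeta_two

theorem sum_range_two_mul_of_even_of_periodic {M : Type*} [AddCommMonoid M] {f : ℤ → M} {m : ℕ}
    (hf : f.Even) (hper : f.Periodic (2 * m)) (hm : m ≠ 0) :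
    ∑ j ∈ Finset.range (2 * m), f j = f 0 + ∑ i ∈ Finset.range (m - 1), f (i + 1)
      + ∑ i ∈ Finset.range m, f (i + 1) := by
  rw [two_mul, Finset.sum_range_add]
  congr 1
  · obtain ⟨k, rfl⟩ := Nat.exists_eq_succ_of_ne_zero hm
    rw [Nat.succ_eq_add_one, Finset.sum_range_succ', Nat.add_sub_cancel, add_comm]
    simp
  · rw [← Finset.sum_range_reflect]
    refine Finset.sum_congr rfl fun i hi => ?_
    rw [Finset.mem_range] at hi
    rw [← hf, ← hper]
    congr 1
    omega

/-! ### Comparison of the tail with its limit for large arguments -/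

namespace LatticePath

/-- The Gaussian limit of `kernel`: `kernel n (2 * x)` is close to
`gaussianKernel ((n + 1) * x²)`. -/
noncomputable def gaussianKernel (z : ℝ) : ℝ :=
  Real.exp (-z) * (1 - 2 * z)

theorem hasSum_gaussianKernel {t : ℝ} (ht : 0 < t) :
    HasSum (fun i : ℕ => gaussianKernel (Real.pi ^ 2 * (i + 1) ^ 2 / t))
      ((limitTail t - 1) / 2) := by
  have hw : 0 < Real.pi ^ 2 / t := by positivity
  have h := (summable_thetaSum 0 hw).hasSum.sub
    ((summable_thetaSum 1 hw).hasSum.mul_left (2 * (Real.pi ^ 2 / t)))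
  convert! h using 1
  · ext i
    have harg : -((i : ℝ) + 1) ^ 2 * (Real.pi ^ 2 / t) = -(Real.pi ^ 2 * (i + 1) ^ 2 / t) := by
      ring
    rw [gaussianKernel, harg]
    ring
  · rw [limitTail_eq_dual ht, thetaSum, thetaSum]
    ring

theorem abs_kernel_sub_gaussianKernel_le_exp_mul (n : ℕ) {x : ℝ} (hx : 0 ≤ x)
    (hx' : x ≤ Real.pi / 2) :
    |kernel n (2 * x) - gaussianKernel ((n + 1) * x ^ 2)| ≤ Real.exp (-(n * x ^ 2)) / (n + 1) *
      ((n + 1) * x ^ 2 + (9 / 2) * ((n + 1) * x ^ 2) ^ 2 + ((n + 1) * x ^ 2) ^ 3) := by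
  set E := Real.exp (-(n * x ^ 2))
  have hE_pos : 0 < E := Real.exp_pos _
  have hexp : Real.exp (-((n + 1) * x ^ 2)) = Real.exp (-x ^ 2) * E := by
    rw [← Real.exp_add]; ring_nf
  have hdecomp : kernel n (2 * x) - gaussianKernel ((n + 1) * x ^ 2) =
      (Real.cos x ^ (2 * n) - E) * (1 - 2 * (n + 1) * Real.sin x ^ 2)
      + E * (2 * (n + 1) * (x ^ 2 - Real.sin x ^ 2))
      + E * (1 - Real.exp (-x ^ 2)) * (1 - 2 * ((n + 1) * x ^ 2)) := by
    rw [kernel, mul_div_cancel_left₀ _ (two_ne_zero' ℝ), gaussianKernel, hexp]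
    ring
  have hcos : |Real.cos x ^ (2 * n) - E| ≤ (n + 1) * x ^ 4 / 2 * E :=
    (abs_cos_pow_sub_exp_le n hx hx').trans (by gcongr; linarith)
  have hsin : |1 - 2 * (n + 1) * Real.sin x ^ 2| ≤ 1 + 2 * ((n + 1) * x ^ 2) := by
    have hle : (n + 1) * Real.sin x ^ 2 ≤ (n + 1) * x ^ 2 :=
      mul_le_mul_of_nonneg_left Real.sin_sq_le_sq (by positivity)
    have hpos : 0 ≤ (n + 1) * Real.sin x ^ 2 := by positivity
    rw [abs_le]; constructor <;> linarith
  have hsin_nonneg : 0 ≤ x ^ 2 - Real.sin x ^ 2 := sub_nonneg.2 Real.sin_sq_le_sq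
  have hexp_sub : |1 - Real.exp (-x ^ 2)| ≤ x ^ 2 := by
    rw [abs_of_nonneg (sub_nonneg.2 (Real.exp_le_one_iff.2 (by nlinarith)))]
    linarith [Real.one_sub_le_exp_neg (x ^ 2)]
  have hgauss : |1 - 2 * ((n + 1) * x ^ 2)| ≤ 1 + 2 * ((n + 1) * x ^ 2) := by
    have hpos : 0 ≤ (n + 1) * x ^ 2 := by positivity
    rw [abs_le]; constructor <;> linarith
  calc |kernel n (2 * x) - gaussianKernel ((n + 1) * x ^ 2)|
      ≤ (n + 1) * x ^ 4 / 2 * E * (1 + 2 * ((n + 1) * x ^ 2)) + E * (2 * (n + 1) * x ^ 4)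
        + E * x ^ 2 * (1 + 2 * ((n + 1) * x ^ 2)) := by
        rw [hdecomp]
        refine (abs_add_three _ _ _).trans ?_
        rw [abs_mul, abs_mul (E * _), abs_mul E, abs_mul E, abs_of_pos hE_pos,
          abs_of_nonneg (by positivity : 0 ≤ 2 * ((n : ℝ) + 1) * (x ^ 2 - Real.sin x ^ 2))]
        gcongr
        exact sq_sub_sin_sq_le hx hx'
    _ = _ := by field_simp; ring

theorem abs_kernel_sub_gaussianKernel_le (n : ℕ) {x : ℝ} (hx : 0 < x) (hx' : x ≤ Real.pi / 2) :
    |kernel n (2 * x) - gaussianKernel ((n + 1) * x ^ 2)|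
      ≤ 4000 / ((n + 1) * ((n + 1) * x ^ 2)) := by
  refine (abs_kernel_sub_gaussianKernel_le_exp_mul n hx.le hx').trans ?_
  set z := (n + 1) * x ^ 2 with hz
  have hz_pos : 0 < z := by positivity
  have hexp : Real.exp (-(n * x ^ 2)) = Real.exp (x ^ 2) * Real.exp (-z) := by
    rw [← Real.exp_add, hz]; ring_nf
  calc Real.exp (-(n * x ^ 2)) / (n + 1) * (z + (9 / 2) * z ^ 2 + z ^ 3)
      = Real.exp (x ^ 2) / (n + 1) * ((z + (9 / 2) * z ^ 2 + z ^ 3) * Real.exp (-z)) := by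
        rw [hexp]; ring
    _ ≤ 60 / (n + 1) * (53 / z) := by
        gcongr
        exacts [exp_sq_le_of_le_pi_div_two hx.le hx', cubic_mul_exp_neg_le hz_pos]
    _ ≤ 4000 / ((n + 1) * z) := by
        rw [div_mul_div_comm]
        gcongr
        norm_num

theorem abs_gaussianKernel_le {a z : ℝ} (ha : 0 < a) (haz : a ≤ z) :
    |gaussianKernel z| ≤ 4000 / (a * z) := by
  have hz : 0 < z := ha.trans_le haz
  have hle : |1 - 2 * z| ≤ 1 + 2 * z := by rw [abs_le]; constructor <;> linarith
  rw [gaussianKernel, abs_mul, abs_of_pos (Real.exp_pos _), mul_comm]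
  calc |1 - 2 * z| * Real.exp (-z)
      ≤ z / a * (1 + 2 * z) * Real.exp (-z) := by
        gcongr
        exact hle.trans (le_mul_of_one_le_left (by positivity) ((one_le_div ha).2 haz))
    _ = 1 / a * ((z + 2 * z ^ 2) * Real.exp (-z)) := by ring
    _ ≤ 1 / a * ((z + (9 / 2) * z ^ 2 + z ^ 3) * Real.exp (-z)) := by
        gcongr 1 / a * (?_ * _)
        nlinarith [sq_nonneg z, pow_pos hz 3]
    _ ≤ 1 / a * (53 / z) := by gcongr; exact cubic_mul_exp_neg_le hz
    _ ≤ 4000 / (a * z) := by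
        rw [div_mul_div_comm]
        gcongr
        norm_num

theorem kernel_neg (n : ℕ) (θ : ℝ) : kernel n (-θ) = kernel n θ := by
  simp [kernel, neg_div]

theorem kernel_add_two_pi (n : ℕ) (θ : ℝ) : kernel n (θ + 2 * Real.pi) = kernel n θ := by
  rw [kernel, kernel, add_div, mul_div_cancel_left₀ _ (two_ne_zero' ℝ), Real.cos_add_pi,
    Real.sin_add_pi, (even_two_mul n).neg_pow, neg_sq]

theorem degreeTail_succ_eq_sum_kernel (r n : ℕ) :
    degreeTail (r + 1) (n + 1) =
      1 + ∑ i ∈ Finset.range (2 ^ r - 1), kernel n (2 * (Real.pi * (i + 1) / (2 * 2 ^ r)))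
        + ∑ i ∈ Finset.range (2 ^ r), kernel n (2 * (Real.pi * (i + 1) / (2 * 2 ^ r))) := by
  let f (j : ℤ) : ℝ := kernel n (2 * (Real.pi * j / (2 * 2 ^ r)))
  have heven : f.Even := fun j => by
    simp only [f]
    rw [← kernel_neg]
    push_cast
    ring_nf
  have hper : f.Periodic (2 * (2 ^ r : ℕ)) := fun j => by
    simp only [f]
    rw [← kernel_add_two_pi n (2 * (Real.pi * j / (2 * 2 ^ r)))]
    congr 1
    push_cast
    field_simp
  have h := sum_range_two_mul_of_even_of_periodic heven hper (by positivity)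
  have hzero : f 0 = 1 := by simp [f, kernel]
  rw [hzero] at h
  rw [degreeTail_eq_sum_kernel, pow_succ']
  simp only [f] at h
  push_cast at h
  rw [← h]
  refine Finset.sum_congr rfl fun j _ => ?_
  congr 1
  ring

theorem abs_ite_kernel_sub_gaussianKernel_le (n : ℕ) {L M : ℕ} (hM : 0 < M) (hLM : L ≤ M)
    (hML : M ≤ L + 1) (i : ℕ) :
    |(if i < L then kernel n (2 * (Real.pi * (i + 1) / (2 * M))) else 0)
        - gaussianKernel ((n + 1) * (Real.pi * (i + 1) / (2 * M)) ^ 2)|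
      ≤ 4000 / ((n + 1) * ((n + 1) * (Real.pi * (i + 1) / (2 * M)) ^ 2)) := by
  have hM' : (0 : ℝ) < M := Nat.cast_pos.2 hM
  have harg : Real.pi * (i + 1) / (2 * M) = Real.pi / 2 * ((i + 1 : ℕ) / M) := by
    push_cast
    ring
  split_ifs with hi
  · refine abs_kernel_sub_gaussianKernel_le n (by positivity) ?_
    rw [harg]
    refine mul_le_of_le_one_right (by positivity) ((div_le_one hM').2 ?_)
    exact_mod_cast (by omega : i + 1 ≤ M)
  · rw [zero_sub, abs_neg]
    refine abs_gaussianKernel_le (by positivity) (le_mul_of_one_le_right (by positivity) ?_)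
    have hratio : (1 : ℝ) ≤ (i + 1 : ℕ) / M := by
      rw [one_le_div hM']
      exact_mod_cast (by omega : M ≤ i + 1)
    rw [harg]
    refine one_le_pow₀ ?_
    nlinarith [Real.pi_gt_three]

theorem abs_sum_kernel_sub_limitTail_le (n : ℕ) {L M : ℕ} (hM : 0 < M) (hLM : L ≤ M)
    (hML : M ≤ L + 1) :
    |∑ i ∈ Finset.range L, kernel n (2 * (Real.pi * (i + 1) / (2 * M)))
        - (limitTail ((2 * M) ^ 2 / (n + 1)) - 1) / 2|
      ≤ 1000 / (n + 1) * ((2 * M) ^ 2 / (n + 1)) := by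
  set t : ℝ := (2 * M) ^ 2 / (n + 1) with ht
  have ht_pos : 0 < t := by positivity
  have harg (i : ℕ) : ((n : ℝ) + 1) * (Real.pi * (i + 1) / (2 * M)) ^ 2
      = Real.pi ^ 2 * (i + 1) ^ 2 / t := by
    rw [ht]
    field_simp
  have hkernel : HasSum
      (fun i : ℕ => if i < L then kernel n (2 * (Real.pi * (i + 1) / (2 * M))) else 0)
      (∑ i ∈ Finset.range L, kernel n (2 * (Real.pi * (i + 1) / (2 * M)))) := by
    simpa [Finset.sum_ite_of_true] using hasSum_sum_of_ne_finset_zero (s := Finset.range L)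
      (f := fun i : ℕ => if i < L then kernel n (2 * (Real.pi * (i + 1) / (2 * M))) else 0)
      (by simp +contextual)
  have hdiff := hkernel.sub (hasSum_gaussianKernel ht_pos)
  have hbasel := hasSum_one_div_succ_sq.mul_left (4000 / (n + 1) * t / Real.pi ^ 2)
  rw [← hdiff.tsum_eq, ← Real.norm_eq_abs]
  refine (tsum_of_norm_bounded hbasel fun i => ?_).trans ?_
  · rw [← harg, Real.norm_eq_abs]
    refine (abs_ite_kernel_sub_gaussianKernel_le n hM hLM hML i).trans (le_of_eq ?_)
    rw [harg]
    field_simp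
  · have hle : 0 ≤ t / (n + 1) := by positivity
    field_simp at hle ⊢
    norm_num

theorem abs_degreeTail_sub_limitTail_le_mul (r n : ℕ) :
    |degreeTail (r + 1) (n + 1) - limitTail (4 ^ (r + 1) / (n + 1))|
      ≤ 2000 / (n + 1) * (4 ^ (r + 1) / (n + 1)) := by
  have hpow : (2 * (2 ^ r : ℕ) : ℝ) ^ 2 = 4 ^ (r + 1) := by
    push_cast
    rw [← pow_succ', ← pow_mul', pow_mul]
    norm_num
  have hshort := abs_sum_kernel_sub_limitTail_le n (Nat.two_pow_pos r) (Nat.sub_le _ 1)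
    (by omega)
  have hlong := abs_sum_kernel_sub_limitTail_le n (Nat.two_pow_pos r) le_rfl (Nat.le_succ _)
  rw [hpow] at hshort hlong
  push_cast at hshort hlong
  rw [degreeTail_succ_eq_sum_kernel]
  calc _ ≤ _ := (congrArg abs (by ring)).trans_le (abs_add_le _ _)
    _ ≤ _ := add_le_add hshort hlong
    _ = _ := by ring

end LatticePath

/-! ### Comparison of binomial coefficients with a Gaussian -/

section ExpMulOneSubDiv

variable {x : ℝ}

theorem exp_two_mul_mul_one_sub_div_one_add_nonneg (hx : 0 ≤ x) (hx' : x ≤ 1) :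
    0 ≤ Real.exp (2 * x) * ((1 - x) / (1 + x)) :=
  mul_nonneg (Real.exp_pos _).le (div_nonneg (by linarith) (by linarith))

theorem exp_two_mul_mul_one_sub_div_one_add_le_one (hx : 0 ≤ x) (hx' : x ≤ 1) :
    Real.exp (2 * x) * ((1 - x) / (1 + x)) ≤ 1 := by
  have hadd : 0 < 1 + x := by linarith
  rcases hx'.eq_or_lt with rfl | hlt
  · simp
  · have hsub : 0 < 1 - x := by linarith
    have hlog : x ≤ 1 / 2 * Real.log ((1 + x) / (1 - x)) := by
      simpa using Real.sum_range_le_log_div hx hlt 1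
    have hexp : Real.exp (2 * x) ≤ (1 + x) / (1 - x) := by
      rw [← Real.le_log_iff_exp_le (div_pos hadd hsub)]
      linarith
    calc Real.exp (2 * x) * ((1 - x) / (1 + x)) ≤ (1 + x) / (1 - x) * ((1 - x) / (1 + x)) := by
          gcongr
      _ = 1 := by field_simp

theorem one_sub_le_exp_two_mul_mul_one_sub_div_one_add (hx : 0 ≤ x) (hx' : x ≤ 1) :
    1 - 2 * x ^ 3 ≤ Real.exp (2 * x) * ((1 - x) / (1 + x)) := by
  have hadd : 0 < 1 + x := by linarith
  have hexp := mul_le_mul_of_nonneg_right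
    (Real.quadratic_le_exp_of_nonneg (by linarith : 0 ≤ 2 * x)) (sub_nonneg.2 hx')
  rw [← mul_div_assoc, le_div_iff₀ hadd]
  nlinarith [pow_nonneg hx 3, pow_nonneg hx 4]

end ExpMulOneSubDiv

/-- The quotient of the binomial coefficient `(2n).choose (n + m)` by the central one, divided by
its Gaussian approximation. The variance is taken to be `n + 1 / 2` rather than `n` because this
makes the ratio of consecutive values a function of `(m + 1 / 2) / (n + 1 / 2)` alone. -/
noncomputable def chooseGaussianRatio (n m : ℕ) : ℝ :=
  (2 * n).choose (n + m) / (2 * n).choose n * Real.exp (m ^ 2 / (n + 1 / 2))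

theorem chooseGaussianRatio_nonneg (n m : ℕ) : 0 ≤ chooseGaussianRatio n m := by
  unfold chooseGaussianRatio
  positivity

theorem centralBinom_cast_pos (n : ℕ) : (0 : ℝ) < (2 * n).choose n := by
  exact_mod_cast n.centralBinom_pos

theorem chooseGaussianRatio_zero (n : ℕ) : chooseGaussianRatio n 0 = 1 := by
  simp [chooseGaussianRatio, (centralBinom_cast_pos n).ne']

theorem chooseGaussianRatio_of_lt {n m : ℕ} (hnm : n < m) : chooseGaussianRatio n m = 0 := by
  rw [chooseGaussianRatio, Nat.choose_eq_zero_of_lt (by omega)]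
  simp

theorem choose_two_mul_succ {n m : ℕ} (hmn : m ≤ n) :
    ((2 * n).choose (n + (m + 1)) : ℝ) = (2 * n).choose (n + m) * ((n - m) / (n + m + 1)) := by
  have hchoose := congrArg (Nat.cast (R := ℝ)) (Nat.choose_succ_right_eq (2 * n) (n + m))
  rw [show 2 * n - (n + m) = n - m by omega] at hchoose
  push_cast [Nat.cast_sub hmn] at hchoose
  rw [← add_assoc]
  field_simp
  linear_combination hchoose

theorem chooseGaussianRatio_succ {n m : ℕ} (hmn : m ≤ n) :
    chooseGaussianRatio n (m + 1) = chooseGaussianRatio n m *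
      (Real.exp (2 * ((m + 1 / 2) / (n + 1 / 2)))
        * ((1 - (m + 1 / 2) / (n + 1 / 2)) / (1 + (m + 1 / 2) / (n + 1 / 2)))) := by
  have hfrac : (1 - ((m : ℝ) + 1 / 2) / (n + 1 / 2)) / (1 + (m + 1 / 2) / (n + 1 / 2))
      = (n - m) / (n + m + 1) := by
    rw [div_eq_div_iff (by positivity) (by positivity)]
    field_simp
    ring
  have hexp : Real.exp (((m + 1 : ℕ) : ℝ) ^ 2 / (n + 1 / 2))
      = Real.exp (m ^ 2 / (n + 1 / 2)) * Real.exp (2 * ((m + 1 / 2) / (n + 1 / 2))) := by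
    rw [← Real.exp_add]
    congr 1
    push_cast
    field_simp
    ring
  rw [chooseGaussianRatio, chooseGaussianRatio, hfrac, hexp, choose_two_mul_succ hmn]
  ring

theorem add_half_div_add_half_mem_Icc {n m : ℕ} (hmn : m ≤ n) :
    ((m : ℝ) + 1 / 2) / (n + 1 / 2) ∈ Set.Icc 0 1 := by
  refine ⟨by positivity, (div_le_one (by positivity)).2 ?_⟩
  gcongr

theorem chooseGaussianRatio_le_one (n m : ℕ) : chooseGaussianRatio n m ≤ 1 := by
  induction m with
  | zero => exact (chooseGaussianRatio_zero n).le
  | succ m ih =>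
    rcases lt_or_ge n m with hnm | hmn
    · exact (chooseGaussianRatio_of_lt (by omega)).trans_le zero_le_one
    · obtain ⟨hx, hx'⟩ := add_half_div_add_half_mem_Icc hmn
      rw [chooseGaussianRatio_succ hmn]
      exact mul_le_one₀ ih (exp_two_mul_mul_one_sub_div_one_add_nonneg hx hx')
        (exp_two_mul_mul_one_sub_div_one_add_le_one hx hx')

theorem one_sub_le_chooseGaussianRatio (n m : ℕ) :
    1 - 2 * m ^ 4 / (n + 1 / 2 : ℝ) ^ 3 ≤ chooseGaussianRatio n m := by
  induction m with
  | zero => simp [chooseGaussianRatio_zero]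
  | succ m ih =>
    rcases lt_or_ge n m with hnm | hmn
    · rw [chooseGaussianRatio_of_lt (by omega), sub_nonpos, le_div_iff₀ (by positivity), one_mul]
      have hle : (n : ℝ) + 1 / 2 ≤ (m + 1 : ℕ) := by
        have : (n : ℝ) ≤ m := by exact_mod_cast hnm.le
        push_cast
        linarith
      calc ((n : ℝ) + 1 / 2) ^ 3 ≤ ((m + 1 : ℕ) : ℝ) ^ 3 := by gcongr
        _ ≤ ((m + 1 : ℕ) : ℝ) ^ 4 := pow_le_pow_right₀ (by simp) (by norm_num)
        _ ≤ 2 * ((m + 1 : ℕ) : ℝ) ^ 4 := le_mul_of_one_le_left (by positivity) one_le_two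
    · obtain ⟨hx, hx'⟩ := add_half_div_add_half_mem_Icc hmn
      set x : ℝ := (m + 1 / 2) / (n + 1 / 2)
      have hfactor := one_sub_le_exp_two_mul_mul_one_sub_div_one_add hx hx'
      have hratio := chooseGaussianRatio_nonneg n m
      have hratio' := chooseGaussianRatio_le_one n m
      calc 1 - 2 * ((m + 1 : ℕ) : ℝ) ^ 4 / (n + 1 / 2) ^ 3
          ≤ 1 - (2 * m ^ 4 + 2 * (m + 1 / 2) ^ 3) / (n + 1 / 2 : ℝ) ^ 3 := by
            have hm : (0 : ℝ) ≤ m := m.cast_nonneg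
            gcongr
            push_cast
            nlinarith [pow_nonneg hm 2, pow_nonneg hm 3]
        _ = 1 - 2 * m ^ 4 / (n + 1 / 2 : ℝ) ^ 3 - 2 * x ^ 3 := by rw [div_pow]; ring
        _ ≤ chooseGaussianRatio n m - 2 * x ^ 3 := by gcongr
        _ ≤ chooseGaussianRatio n m * (1 - 2 * x ^ 3) := by nlinarith [pow_nonneg hx 3]
        _ ≤ _ := by rw [chooseGaussianRatio_succ hmn]; gcongr

/-! ### The central binomial coefficient -/

theorem wallis_mul_choose_div_sq (n : ℕ) :
    Real.Wallis.W n * (((2 * n).choose n / 4 ^ n : ℝ) ^ 2 * (2 * n + 1)) = 1 := by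
  have hfactorial : ((2 * n).factorial : ℝ) = (2 * n).choose n * n.factorial ^ 2 := by
    rw [← Nat.choose_mul_factorial_mul_factorial (by omega : n ≤ 2 * n),
      show 2 * n - n = n by omega]
    push_cast
    ring
  have hpow : (2 : ℝ) ^ (4 * n) = (4 ^ n) ^ 2 := by
    rw [← pow_mul, mul_comm n 2, pow_mul, pow_mul]
    norm_num
  have hchoose := centralBinom_cast_pos n
  rw [Real.Wallis.W_eq_factorial_ratio, hfactorial, hpow]
  field_simp

theorem sq_choose_div_mul_sqrt (n : ℕ) :
    ((2 * n).choose n / 4 ^ n * √(Real.pi * n) : ℝ) ^ 2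
      = Real.pi * n / (Real.Wallis.W n * (2 * n + 1)) := by
  have hW := Real.Wallis.W_pos n
  rw [mul_pow, Real.sq_sqrt (by positivity), eq_div_iff (by positivity)]
  linear_combination (Real.pi * n) * wallis_mul_choose_div_sq n

theorem choose_div_mul_sqrt_le_one (n : ℕ) :
    (2 * n).choose n / 4 ^ n * √(Real.pi * n) ≤ 1 := by
  have hW := Real.Wallis.W_pos n
  have hWallis := Real.Wallis.le_W n
  refine (sq_le_one_iff₀ (by positivity)).1 ?_
  rw [sq_choose_div_mul_sqrt, div_le_one (by positivity)]
  calc Real.pi * n ≤ (2 * n + 1) / (2 * n + 2) * (Real.pi / 2) * (2 * n + 1) := by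
        rw [div_mul_eq_mul_div, div_mul_eq_mul_div, le_div_iff₀ (by positivity)]
        nlinarith [Real.pi_pos]
    _ ≤ Real.Wallis.W n * (2 * n + 1) := by gcongr

theorem one_sub_le_choose_div_mul_sqrt {n : ℕ} (hn : n ≠ 0) :
    1 - 1 / n ≤ (2 * n).choose n / 4 ^ n * √(Real.pi * n) := by
  have hn' : (0 : ℝ) < n := by positivity
  have hW := Real.Wallis.W_pos n
  have hWallis := Real.Wallis.W_le n
  calc 1 - 1 / (n : ℝ) ≤ 1 - 1 / (2 * n + 1) := by gcongr; linarith
    _ = Real.pi * n / (Real.pi / 2 * (2 * n + 1)) := by field_simp; ring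
    _ ≤ Real.pi * n / (Real.Wallis.W n * (2 * n + 1)) := by gcongr
    _ = _ := (sq_choose_div_mul_sqrt n).symm
    _ ≤ _ := pow_le_of_le_one (by positivity) (choose_div_mul_sqrt_le_one n) two_ne_zero

theorem quadratic_mul_exp_neg_le {v : ℝ} (hv : 0 < v) :
    (1 + v / 2 + 2 * v ^ 2) * Real.exp (-v) ≤ 258 / v ^ 3 := by
  have hthree := pow_mul_exp_neg_le 3 hv.le
  have hfour := pow_mul_exp_neg_le 4 hv.le
  have hfive := pow_mul_exp_neg_le 5 hv.le
  norm_num [Nat.factorial] at hthree hfour hfive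
  rw [le_div_iff₀ (by positivity)]
  nlinarith

theorem choose_div_mul_sqrt_eq (n m : ℕ) :
    (2 * n).choose (n + m) / 4 ^ n * √(Real.pi * n) =
      (2 * n).choose n / 4 ^ n * √(Real.pi * n) * chooseGaussianRatio n m
        * Real.exp (-(m ^ 2 / (n + 1 / 2))) := by
  have hchoose := centralBinom_cast_pos n
  rw [chooseGaussianRatio, Real.exp_neg]
  field_simp

theorem exp_neg_sub_exp_neg_le (a b : ℝ) :
    Real.exp (-a) - Real.exp (-b) ≤ (b - a) * Real.exp (-a) := by
  have hexp : Real.exp (-b) = Real.exp (-(b - a)) * Real.exp (-a) := by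
    rw [← Real.exp_add]; ring_nf
  rw [hexp]
  nlinarith [Real.one_sub_le_exp_neg (b - a), Real.exp_pos (-a)]

theorem one_sub_le_choose_div_mul_sqrt_mul_ratio {n : ℕ} (hn : n ≠ 0) (m : ℕ) :
    1 - (1 + 2 * (m ^ 2 / (n + 1 / 2)) ^ 2) / n
      ≤ (2 * n).choose n / 4 ^ n * √(Real.pi * n) * chooseGaussianRatio n m := by
  have hcentral := one_sub_le_choose_div_mul_sqrt hn
  have hratio : 1 - 2 * (m ^ 2 / (n + 1 / 2 : ℝ)) ^ 2 / n ≤ chooseGaussianRatio n m := by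
    refine le_trans ?_ (one_sub_le_chooseGaussianRatio n m)
    rw [show 2 * (m : ℝ) ^ 4 / (n + 1 / 2) ^ 3 = 2 * (m ^ 2 / (n + 1 / 2)) ^ 2 / (n + 1 / 2) by
      field_simp]
    gcongr
    linarith
  have hmul := mul_nonneg (sub_nonneg.2 (choose_div_mul_sqrt_le_one n))
    (sub_nonneg.2 (chooseGaussianRatio_le_one n m))
  rw [add_div]
  linarith

theorem abs_choose_sub_gaussian_le {n m : ℕ} (hn : n ≠ 0) (hm : m ≠ 0) :
    |(2 * n).choose (n + m) / 4 ^ n * √(Real.pi * n) - Real.exp (-(m ^ 2 / n))|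
      ≤ 1000 / (n * (m ^ 2 / n) ^ 3) := by
  have hn' : (1 : ℝ) ≤ n := Nat.one_le_cast.2 (Nat.one_le_iff_ne_zero.2 hn)
  have hlower := one_sub_le_choose_div_mul_sqrt_mul_ratio hn m
  have hupper := mul_le_one₀ (choose_div_mul_sqrt_le_one n) (chooseGaussianRatio_nonneg n m)
    (chooseGaussianRatio_le_one n m)
  rw [choose_div_mul_sqrt_eq]
  set q := (2 * n).choose n / 4 ^ n * √(Real.pi * n) * chooseGaussianRatio n m
  set v : ℝ := m ^ 2 / n with hv
  set w : ℝ := m ^ 2 / (n + 1 / 2) with hw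
  have hw_pos : 0 < w := by positivity
  have hsub : v - w = w / (2 * n) := by
    rw [hv, hw]
    field_simp
    ring
  have hexp_le : Real.exp (-v) ≤ Real.exp (-w) :=
    Real.exp_le_exp.2 (neg_le_neg (sub_nonneg.1 (hsub ▸ by positivity)))
  have hexp_sub := exp_neg_sub_exp_neg_le w v
  rw [hsub] at hexp_sub
  have hlower_exp := mul_le_mul_of_nonneg_right hlower (Real.exp_pos (-w)).le
  have hupper_exp := mul_le_of_le_one_left (Real.exp_pos (-w)).le hupper
  calc |q * Real.exp (-w) - Real.exp (-v)|
      ≤ (1 + 2 * w ^ 2) / n * Real.exp (-w) + w / (2 * n) * Real.exp (-w) := by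
        rw [abs_le]
        constructor <;> linarith
    _ = 1 / n * ((1 + w / 2 + 2 * w ^ 2) * Real.exp (-w)) := by field_simp; ring
    _ ≤ 1 / n * (258 / w ^ 3) := by gcongr; exact quadratic_mul_exp_neg_le hw_pos
    _ ≤ 1 / n * (258 / (2 / 3 * v) ^ 3) := by
        have hwv : 2 / 3 * v ≤ w := by
          rw [hv, hw, ← mul_div_assoc, div_le_div_iff₀ (by positivity) (by positivity)]
          nlinarith [sq_nonneg (m : ℝ)]
        gcongr
    _ = 870.75 / (n * v ^ 3) := by field_simp; norm_num
    _ ≤ 1000 / (n * v ^ 3) := by gcongr; norm_num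

namespace LatticePath

section LargeHeight

variable (r n : ℕ)

theorem two_pow_eq_sqrt_mul_sqrt :
    (2 : ℝ) ^ r = √(4 ^ r / (n + 1)) * √(n + 1) := by
  rw [← Real.sqrt_mul (by positivity), div_mul_cancel₀ _ (by positivity),
    show (4 : ℝ) = 2 ^ 2 by norm_num, ← pow_mul, mul_comm, pow_mul, Real.sqrt_sq (by positivity)]

theorem hasSum_gaussian_limitTail :
    HasSum (fun l : ℕ => 4 * 2 ^ r / (n + 1) * (((l : ℝ) + 1) * 2 ^ r) ^ 2
      * (Real.exp (-((l + 1) * 2 ^ r) ^ 2 / (n + 1)) / √(Real.pi * (n + 1))))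
      (limitTail (4 ^ r / (n + 1))) := by
  have hpow := two_pow_eq_sqrt_mul_sqrt r n
  have hsqrt : √((n : ℝ) + 1) ^ 2 = n + 1 := Real.sq_sqrt (by positivity)
  set t : ℝ := 4 ^ r / (n + 1)
  have ht_pos : 0 < t := by positivity
  have hsqrt_t : √t ^ 2 = t := Real.sq_sqrt ht_pos.le
  have hsq : ((2 : ℝ) ^ r) ^ 2 = t * (n + 1) := by rw [hpow, mul_pow, hsqrt, hsqrt_t]
  have hrpow : t ^ (3 / 2 : ℝ) = t * √t := by
    rw [Real.sqrt_eq_rpow, ← Real.rpow_one_add' ht_pos.le (by norm_num)]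
    norm_num
  convert! (summable_thetaSum 1 ht_pos).hasSum.mul_left (4 / √Real.pi * t ^ (3 / 2 : ℝ)) using 1
  ext l
  have harg : -((l + 1) * 2 ^ r) ^ 2 / ((n : ℝ) + 1) = -((l : ℝ) + 1) ^ 2 * t := by
    rw [mul_pow, hsq]
    field_simp
  rw [harg, mul_pow, hsq, hrpow, hpow, Real.sqrt_mul Real.pi_pos.le]
  field_simp

theorem two_pow_div_sqrt_le (hrn : (n : ℝ) + 1 ≤ 4 ^ r) :
    2 ^ r / √(Real.pi * (n + 1)) ≤ (4 : ℝ) ^ r / (n + 1) := by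
  set t : ℝ := 4 ^ r / (n + 1)
  have ht_one : 1 ≤ t := (one_le_div (by positivity)).2 hrn
  rw [two_pow_eq_sqrt_mul_sqrt r n]
  calc √t * √(n + 1) / √(Real.pi * (n + 1)) ≤ √t * √(n + 1) / √(n + 1) := by
        gcongr
        exact le_mul_of_one_le_left (by positivity) (by linarith [Real.pi_gt_three])
    _ = √t := mul_div_cancel_right₀ _ (by positivity)
    _ ≤ t := Real.sqrt_le_iff.2 ⟨by linarith, by nlinarith⟩

theorem abs_choose_term_sub_gaussian_term_le (hrn : (n : ℝ) + 1 ≤ 4 ^ r) (l : ℕ) :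
    |4 * 2 ^ r / (n + 1) * ((l + 1) * 2 ^ r) ^ 2
        * ((2 * (n + 1)).choose (n + 1 + (l + 1) * 2 ^ r) / 4 ^ (n + 1) : ℝ)
      - 4 * 2 ^ r / (n + 1) * (((l : ℝ) + 1) * 2 ^ r) ^ 2
        * (Real.exp (-((l + 1) * 2 ^ r) ^ 2 / (n + 1)) / √(Real.pi * (n + 1)))|
      ≤ 4000 / (n + 1) * (4 ^ r / ((n : ℝ) + 1))⁻¹ * (1 / (l + 1) ^ 2) := by
  have hgauss := abs_choose_sub_gaussian_le (Nat.succ_ne_zero n)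
    (by positivity : (l + 1) * 2 ^ r ≠ 0)
  have hfactor := two_pow_div_sqrt_le r n hrn
  push_cast at hgauss
  have harg : (((l : ℝ) + 1) * 2 ^ r) ^ 2 / (n + 1) = (l + 1) ^ 2 * (4 ^ r / (n + 1)) := by
    rw [mul_pow, ← pow_mul', pow_mul]
    norm_num
    ring
  set t : ℝ := 4 ^ r / (n + 1)
  set b : ℝ := (2 * (n + 1)).choose (n + 1 + (l + 1) * 2 ^ r) / 4 ^ (n + 1)
  set G := Real.exp (-(((l + 1) * 2 ^ r) ^ 2 / ((n : ℝ) + 1)))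
  have hterm : 4 * 2 ^ r / (n + 1) * ((l + 1) * 2 ^ r) ^ 2 * b
      - 4 * 2 ^ r / (n + 1) * (((l : ℝ) + 1) * 2 ^ r) ^ 2 * (G / √(Real.pi * (n + 1)))
      = 4 * (2 ^ r / √(Real.pi * (n + 1))) * (((l + 1) * 2 ^ r) ^ 2 / (n + 1))
        * (b * √(Real.pi * (n + 1)) - G) := by
    field_simp
  rw [neg_div, hterm, abs_mul, abs_of_nonneg (by positivity)]
  rw [harg] at hgauss ⊢
  calc 4 * (2 ^ r / √(Real.pi * (n + 1))) * ((l + 1) ^ 2 * t) * |b * √(Real.pi * (n + 1)) - G|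
      ≤ 4 * t * ((l + 1) ^ 2 * t) * (1000 / ((n + 1) * ((l + 1) ^ 2 * t) ^ 3)) := by gcongr
    _ = 4000 / (n + 1) * t⁻¹ * (1 / (l + 1) ^ 2) * (1 / ((l : ℝ) + 1) ^ 2) := by
        field_simp
        norm_num
    _ ≤ 4000 / (n + 1) * t⁻¹ * (1 / (l + 1) ^ 2) := by
        refine mul_le_of_le_one_right (by positivity) ((div_le_one (by positivity)).2 ?_)
        exact one_le_pow₀ (by linarith [(l.cast_nonneg : (0 : ℝ) ≤ l)])

theorem abs_degreeTail_sub_limitTail_le_inv (hrn : (n : ℝ) + 1 ≤ 4 ^ r) :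
    |degreeTail r (n + 1) - limitTail (4 ^ r / (n + 1))|
      ≤ 8000 / (n + 1) * (4 ^ r / ((n : ℝ) + 1))⁻¹ := by
  have hgauss := hasSum_gaussian_limitTail r n
  have hbasel :=
    hasSum_one_div_succ_sq.mul_left (4000 / ((n : ℝ) + 1) * (4 ^ r / ((n : ℝ) + 1))⁻¹)
  have hterm := abs_choose_term_sub_gaussian_term_le r n hrn
  have hchoose : Summable fun l : ℕ => 4 * 2 ^ r / (n + 1) * ((l + 1) * 2 ^ r) ^ 2
      * ((2 * (n + 1)).choose (n + 1 + (l + 1) * 2 ^ r) / 4 ^ (n + 1) : ℝ) := by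
    simpa using (Summable.of_norm_bounded hbasel.summable hterm).add hgauss.summable
  rw [degreeTail_eq_tsum_choose, ← hgauss.tsum_eq, ← hchoose.tsum_sub hgauss.summable,
    ← Real.norm_eq_abs]
  calc _ ≤ _ := tsum_of_norm_bounded hbasel hterm
    _ = 4000 * (Real.pi ^ 2 / 6) / (n + 1) * (4 ^ r / ((n : ℝ) + 1))⁻¹ := by ring
    _ ≤ 8000 / (n + 1) * (4 ^ r / ((n : ℝ) + 1))⁻¹ := by
        gcongr
        nlinarith [Real.pi_lt_d2, Real.pi_gt_three]

end LargeHeight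

end LatticePath

/-! ### Regularised sums of translates of a smooth step -/

theorem summable_int_mul_exp_neg_abs :
    Summable fun r : ℤ => (2 * |(r : ℝ)| + 1) * Real.exp (-|(r : ℝ)|) := by
  have hnat : Summable fun n : ℕ => (2 * (n : ℝ) + 1) * Real.exp (-(n : ℝ)) := by
    refine (((Real.summable_pow_mul_exp_neg_nat_mul 1 one_pos).mul_left 2).add
      (Real.summable_pow_mul_exp_neg_nat_mul 0 one_pos)).congr fun n => ?_
    simp only [pow_one, pow_zero, one_mul, neg_mul]
    ring
  exact Summable.of_nat_of_neg (by simpa using hnat) (by simpa using hnat)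

theorem integrable_mul_exp_neg_abs :
    Integrable fun t : ℝ => (2 * |t| + 1) * Real.exp (-|t|) := by
  refine (integrable_inv_one_add_sq.const_mul 17).mono'
    (Continuous.aestronglyMeasurable (by fun_prop)) (Eventually.of_forall fun t => ?_)
  have ht : 0 ≤ |t| := abs_nonneg t
  have hzero : Real.exp (-|t|) ≤ 1 := Real.exp_le_one_iff.2 (by linarith)
  have hone := pow_mul_exp_neg_le 1 ht
  have htwo := pow_mul_exp_neg_le 2 ht
  have hthree := pow_mul_exp_neg_le 3 ht
  norm_num only [Nat.factorial] at hone htwo hthree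
  rw [Real.norm_of_nonneg (by positivity), ← div_eq_mul_inv, le_div_iff₀ (by positivity),
    ← sq_abs t]
  linarith

theorem exp_neg_abs_sub_le {x y M : ℝ} (hx : |x| ≤ M) :
    Real.exp (-|x - y|) ≤ Real.exp M * Real.exp (-|y|) := by
  rw [← Real.exp_add]
  refine Real.exp_le_exp.2 ?_
  linarith [abs_sub_abs_le_abs_sub y x, abs_sub_comm x y]

theorem sub_intCast_pos_iff {x : ℝ} (hx : x ∈ Set.Ioc 0 1) (r : ℤ) : 0 < x - r ↔ r ≤ 0 := by
  constructor
  · intro hr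
    have hlt : (r : ℝ) < 1 := (sub_pos.1 hr).trans_le hx.2
    exact Int.lt_add_one_iff.1 (by exact_mod_cast hlt)
  · intro hr
    exact sub_pos.2 ((Int.cast_nonpos.2 hr).trans_lt hx.1)

/-- A continuously differentiable function that tends to the unit step function exponentially fast
at both ends. -/
structure SmoothStep (q q' : ℝ → ℝ) (C : ℝ) : Prop where
  hasDerivAt : ∀ u, HasDerivAt q (q' u) u
  continuous_deriv : Continuous q'
  bound : ∀ u, |q u - (if 0 < u then 1 else 0)| ≤ C * Real.exp (-|u|)
  bound_deriv : ∀ u, |q' u| ≤ C * Real.exp (-|u|)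

/-- The sum of the integer translates `q (x - r)` with weights `w r`, made convergent by subtracting
`w r` for every `r ≤ 0`. -/
noncomputable def shiftSum (q : ℝ → ℝ) (w : ℤ → ℝ) (x : ℝ) : ℝ :=
  ∑' r : ℤ, w r * (q (x - r) - if r ≤ 0 then 1 else 0)

namespace SmoothStep

variable {q q' : ℝ → ℝ} {C : ℝ}

theorem nonneg (h : SmoothStep q q' C) : 0 ≤ C := by
  simpa using (abs_nonneg _).trans (h.bound_deriv 0)

theorem continuous (h : SmoothStep q q' C) : Continuous q :=
  continuous_iff_continuousAt.2 fun u => (h.hasDerivAt u).continuousAt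

section Weights

variable {w : ℤ → ℝ}

theorem norm_deriv_term_le (h : SmoothStep q q' C) (hw : ∀ r, |w r| ≤ 2 * |(r : ℝ)| + 1)
    {M y : ℝ} (hy : |y| ≤ M) (r : ℤ) :
    ‖w r * q' (y - r)‖ ≤ C * Real.exp M * ((2 * |(r : ℝ)| + 1) * Real.exp (-|(r : ℝ)|)) := by
  have hC := h.nonneg
  rw [norm_mul, Real.norm_eq_abs, Real.norm_eq_abs]
  calc |w r| * |q' (y - r)| ≤ (2 * |(r : ℝ)| + 1) * (C * Real.exp (-|y - r|)) :=
        mul_le_mul (hw r) (h.bound_deriv _) (abs_nonneg _) (by positivity)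
    _ ≤ (2 * |(r : ℝ)| + 1) * (C * (Real.exp M * Real.exp (-|(r : ℝ)|))) := by
        gcongr
        exact exp_neg_abs_sub_le hy
    _ = _ := by ring

theorem summable_shiftSum_of_mem_Ioc (h : SmoothStep q q' C)
    (hw : ∀ r, |w r| ≤ 2 * |(r : ℝ)| + 1) {x : ℝ} (hx : x ∈ Set.Ioc 0 1) :
    Summable fun r : ℤ => w r * (q (x - r) - if r ≤ 0 then 1 else 0) := by
  have hC := h.nonneg
  refine Summable.of_norm_bounded (summable_int_mul_exp_neg_abs.mul_left (C * Real.exp 1))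
    fun r => ?_
  rw [← ite_congr (propext (sub_intCast_pos_iff hx r)) (fun _ => rfl) (fun _ => rfl), norm_mul,
    Real.norm_eq_abs, Real.norm_eq_abs]
  calc _ ≤ (2 * |(r : ℝ)| + 1) * (C * Real.exp (-|x - (r : ℝ)|)) :=
        mul_le_mul (hw r) (h.bound _) (abs_nonneg _) (by positivity)
    _ ≤ (2 * |(r : ℝ)| + 1) * (C * (Real.exp 1 * Real.exp (-|(r : ℝ)|))) := by
        gcongr
        exact exp_neg_abs_sub_le (by rw [abs_of_pos hx.1]; exact hx.2)
    _ = _ := by ring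

theorem hasDerivAt_term (h : SmoothStep q q' C) (w : ℤ → ℝ) (r : ℤ) (y : ℝ) :
    HasDerivAt (fun y : ℝ => w r * (q (y - r) - if r ≤ 0 then 1 else 0)) (w r * q' (y - r)) y :=
  (((h.hasDerivAt (y - r)).comp_sub_const y (r : ℝ)).sub_const _).const_mul _

theorem one_mem_ball (x : ℝ) : (1 : ℝ) ∈ Metric.ball 0 (|x| + 2) := by
  rw [mem_ball_zero_iff, norm_one]
  linarith [abs_nonneg x]

theorem mem_ball_abs_add_two (x : ℝ) : x ∈ Metric.ball 0 (|x| + 2) := by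
  simp

theorem summable (h : SmoothStep q q' C) (hw : ∀ r, |w r| ≤ 2 * |(r : ℝ)| + 1) (x : ℝ) :
    Summable fun r : ℤ => w r * (q (x - r) - if r ≤ 0 then 1 else 0) :=
  summable_of_summable_hasDerivAt_of_isPreconnected
    (summable_int_mul_exp_neg_abs.mul_left (C * Real.exp (|x| + 2))) Metric.isOpen_ball
    (convex_ball _ _).isPreconnected (fun r y _ => h.hasDerivAt_term w r y)
    (fun r _ hy => h.norm_deriv_term_le hw (mem_ball_zero_iff.1 hy).le r) (one_mem_ball x)
    (h.summable_shiftSum_of_mem_Ioc hw (Set.right_mem_Ioc.2 one_pos)) (mem_ball_abs_add_two x)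

theorem hasDerivAt_shiftSum (h : SmoothStep q q' C) (hw : ∀ r, |w r| ≤ 2 * |(r : ℝ)| + 1)
    (x : ℝ) : HasDerivAt (shiftSum q w) (∑' r : ℤ, w r * q' (x - r)) x :=
  hasDerivAt_tsum_of_isPreconnected
    (summable_int_mul_exp_neg_abs.mul_left (C * Real.exp (|x| + 2))) Metric.isOpen_ball
    (convex_ball _ _).isPreconnected (fun r y _ => h.hasDerivAt_term w r y)
    (fun r _ hy => h.norm_deriv_term_le hw (mem_ball_zero_iff.1 hy).le r) (one_mem_ball x)
    (h.summable_shiftSum_of_mem_Ioc hw (Set.right_mem_Ioc.2 one_pos)) (mem_ball_abs_add_two x)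

theorem continuous_tsum_deriv (h : SmoothStep q q' C) (hw : ∀ r, |w r| ≤ 2 * |(r : ℝ)| + 1) :
    Continuous fun x => ∑' r : ℤ, w r * q' (x - r) := by
  refine continuous_iff_continuousAt.2 fun x => ?_
  have hcont : ContinuousOn (fun x => ∑' r : ℤ, w r * q' (x - r)) (Metric.ball 0 (|x| + 2)) :=
    continuousOn_tsum (fun r => (continuous_const.mul
      (h.continuous_deriv.comp (continuous_sub_right _))).continuousOn)
      (summable_int_mul_exp_neg_abs.mul_left (C * Real.exp (|x| + 2)))
      (fun r _ hy => h.norm_deriv_term_le hw (mem_ball_zero_iff.1 hy).le r)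
  exact hcont.continuousAt (Metric.isOpen_ball.mem_nhds (mem_ball_abs_add_two x))

theorem shiftSum_add_one (h : SmoothStep q q' C)
    (hw : ∀ r, |w (r + 1)| ≤ 2 * |(r : ℝ)| + 1) (x : ℝ) :
    shiftSum q w (x + 1) = shiftSum q (fun r => w (r + 1)) x + w 1 := by
  have hjump : HasSum (fun r : ℤ => if r = 0 then w 1 else 0) (w 1) := by
    simpa using hasSum_ite_eq (0 : ℤ) (w 1)
  rw [shiftSum, ← (Equiv.addRight (1 : ℤ)).tsum_eq, shiftSum,
    ← ((h.summable hw x).hasSum.add hjump).tsum_eq]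
  refine tsum_congr fun r => ?_
  have harg : x + 1 - ((r + 1 : ℤ) : ℝ) = x - r := by push_cast; ring
  change w (r + 1) * (q (x + 1 - ((r + 1 : ℤ) : ℝ)) - if r + 1 ≤ 0 then 1 else 0) = _
  rw [harg]
  rcases lt_trichotomy r 0 with hr | rfl | hr
  · rw [if_pos (by omega), if_pos (by omega), if_neg (by omega), add_zero]
  · simp [mul_sub]
  · rw [if_neg (by omega), if_neg (by omega), if_neg (by omega), add_zero]

end Weights

section Unfolding

variable {a : ℝ → ℂ}

theorem norm_mul_sub_step_le (h : SmoothStep q q' C) (hbound : ∀ t, ‖a t‖ ≤ 2 * |t| + 1) (t : ℝ) :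
    ‖a t * ((q t - (if 0 < t then 1 else 0) : ℝ) : ℂ)‖
      ≤ C * ((2 * |t| + 1) * Real.exp (-|t|)) := by
  rw [norm_mul, Complex.norm_real, Real.norm_eq_abs]
  calc _ ≤ (2 * |t| + 1) * (C * Real.exp (-|t|)) :=
        mul_le_mul (hbound t) (h.bound t) (abs_nonneg _) (by positivity)
    _ = _ := by ring

theorem norm_mul_sub_step_add_int_le (h : SmoothStep q q' C)
    (hbound : ∀ t, ‖a t‖ ≤ 2 * |t| + 1) {x : ℝ} (hx : |x| ≤ 1) (r : ℤ) :
    ‖a (x + r) * ((q (x + r) - (if 0 < x + r then 1 else 0) : ℝ) : ℂ)‖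
      ≤ C * Real.exp 1 * 3 * ((2 * |(r : ℝ)| + 1) * Real.exp (-|(r : ℝ)|)) := by
  have hC := h.nonneg
  have hexp := exp_neg_abs_sub_le (y := -r) hx
  rw [sub_neg_eq_add, abs_neg] at hexp
  have hlin : 2 * |x + r| + 1 ≤ 3 * (2 * |(r : ℝ)| + 1) := by
    linarith [abs_add_le x r, abs_nonneg (r : ℝ)]
  calc _ ≤ C * ((2 * |x + r| + 1) * Real.exp (-|x + r|)) := h.norm_mul_sub_step_le hbound _
    _ ≤ C * ((3 * (2 * |(r : ℝ)| + 1)) * (Real.exp 1 * Real.exp (-|(r : ℝ)|))) := by gcongr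
    _ = _ := by ring

theorem measurable_mul_sub_step (h : SmoothStep q q' C) (ha : Continuous a) :
    Measurable fun t => a t * ((q t - (if 0 < t then 1 else 0) : ℝ) : ℂ) :=
  ha.measurable.mul (Complex.measurable_ofReal.comp (h.continuous.measurable.sub
    (Measurable.ite measurableSet_Ioi measurable_const measurable_const)))

theorem integrable_mul_sub_step (h : SmoothStep q q' C) (ha : Continuous a)
    (hbound : ∀ t, ‖a t‖ ≤ 2 * |t| + 1) :
    Integrable fun t => a t * ((q t - (if 0 < t then 1 else 0) : ℝ) : ℂ) :=
  (integrable_mul_exp_neg_abs.const_mul C).mono' (h.measurable_mul_sub_step ha).aestronglyMeasurable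
    (Eventually.of_forall (h.norm_mul_sub_step_le hbound))

theorem integral_unfold (h : SmoothStep q q' C) (ha : Continuous a)
    (hbound : ∀ t, ‖a t‖ ≤ 2 * |t| + 1) {G : ℝ → ℂ}
    (hG : ∀ x, HasSum (fun r : ℤ => a (x - r) * ((q (x - r) - (if r ≤ 0 then 1 else 0) : ℝ) : ℂ))
      (G x)) :
    ∫ x in (0 : ℝ)..1, G x = ∫ t, a t * ((q t - (if 0 < t then 1 else 0) : ℝ) : ℂ) := by
  set F : ℝ → ℂ := fun t => a t * ((q t - (if 0 < t then 1 else 0) : ℝ) : ℂ)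
  have hmeas (r : ℤ) : Measurable fun x : ℝ => F (x + r) :=
    (h.measurable_mul_sub_step ha).comp (measurable_add_const (r : ℝ))
  have hsum (x : ℝ) (hx : x ∈ Set.Ioc 0 1) : HasSum (fun r : ℤ => F (x + r)) (G x) := by
    rw [← (Equiv.neg ℤ).hasSum_iff]
    convert! hG x using 1
    ext r
    simp only [F, Function.comp_apply, Equiv.neg_apply, Int.cast_neg, ← sub_eq_add_neg,
      sub_intCast_pos_iff hx]
  refine HasSum.unique ?_ (h.integrable_mul_sub_step ha hbound).hasSum_intervalIntegral_comp_add_int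
  refine intervalIntegral.hasSum_integral_of_dominated_convergence
    (fun r _ => C * Real.exp 1 * 3 * ((2 * |(r : ℝ)| + 1) * Real.exp (-|(r : ℝ)|)))
    (fun r => (hmeas r).aestronglyMeasurable) (fun r => Eventually.of_forall fun x hx => ?_)
    (Eventually.of_forall fun x _ => summable_int_mul_exp_neg_abs.mul_left _)
    intervalIntegrable_const (Eventually.of_forall fun x hx => ?_)
  all_goals rw [Set.uIoc_of_le zero_le_one] at hx
  · exact h.norm_mul_sub_step_add_int_le hbound (by rw [abs_of_pos hx.1]; exact hx.2) r
  · exact hsum x hx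

end Unfolding

end SmoothStep

/-! ### Fourier series of continuously differentiable periodic functions -/

/-- The character `t ↦ e ^ (-2 π i k t)` against which Fourier coefficients are computed, as a
function on the real line rather than on the circle. -/
noncomputable def fourierExp (k : ℤ) (t : ℝ) : ℂ :=
  Complex.exp (-(2 * k * Real.pi * Complex.I * t))

theorem continuous_fourierExp (k : ℤ) : Continuous (fourierExp k) := by
  unfold fourierExp
  fun_prop

theorem norm_fourierExp (k : ℤ) (t : ℝ) : ‖fourierExp k t‖ = 1 := by
  have harg : -(2 * k * Real.pi * Complex.I * t)
      = ((-(2 * k * Real.pi * t) : ℝ) : ℂ) * Complex.I := by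
    push_cast
    ring
  rw [fourierExp, harg, Complex.norm_exp_ofReal_mul_I]

theorem fourierExp_sub_int (k : ℤ) (t : ℝ) (r : ℤ) : fourierExp k (t - r) = fourierExp k t := by
  refine Complex.exp_eq_exp_iff_exists_int.2 ⟨k * r, ?_⟩
  push_cast
  ring

theorem fourierExp_zero_left (t : ℝ) : fourierExp 0 t = 1 := by
  simp [fourierExp]

theorem fourierExp_zero_right (k : ℤ) : fourierExp k 0 = 1 := by
  simp [fourierExp]

theorem fourierExp_one_right (k : ℤ) : fourierExp k 1 = 1 := by
  simpa [fourierExp_zero_right] using (fourierExp_sub_int k 1 1).symm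

theorem hasDerivAt_fourierExp (k : ℤ) (t : ℝ) :
    HasDerivAt (fourierExp k) (-(2 * k * Real.pi * Complex.I) * fourierExp k t) t := by
  convert! ((hasDerivAt_id (t : ℂ)).const_mul (2 * k * Real.pi * Complex.I)).neg.cexp.comp_ofReal
    using 1
  simp [fourierExp, mul_comm]

theorem fourier_neg_coe_eq_fourierExp {T : ℝ} (hT : T = 1) (k : ℤ) (t : ℝ) :
    fourier (-k) (t : AddCircle T) = fourierExp k t := by
  subst hT
  rw [fourier_coe_apply, fourierExp]
  congr 1
  push_cast
  ring

theorem fourierCoeffOn_zero_lt_one (f : ℝ → ℂ) (k : ℤ) :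
    fourierCoeffOn zero_lt_one f k = ∫ y in (0 : ℝ)..1, fourierExp k y * f y := by
  rw [fourierCoeffOn_eq_integral, sub_zero, one_div_one, one_smul]
  simp only [smul_eq_mul, fourier_neg_coe_eq_fourierExp rfl]

theorem fourierCoeff_unitAddCircle (F : UnitAddCircle → ℂ) (k : ℤ) :
    fourierCoeff F k = ∫ y in (0 : ℝ)..1, fourierExp k y * F y := by
  rw [fourierCoeff_eq_intervalIntegral F k 0, zero_add, one_div_one, one_smul]
  simp only [smul_eq_mul, fourier_neg_coe_eq_fourierExp rfl]

theorem norm_fourierCoeffOn_le_of_hasDerivAt {f f' : ℝ → ℂ} (hderiv : ∀ x, HasDerivAt f (f' x) x)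
    (hcont : Continuous f') (hends : f 1 = f 0) {k : ℤ} (hk : k ≠ 0) :
    ‖fourierCoeffOn zero_lt_one f k‖
      ≤ ‖fourierCoeffOn zero_lt_one f' k‖ ^ 2 + 1 / (k : ℝ) ^ 2 := by
  have hk_pos : (0 : ℝ) < |(k : ℝ)| := by positivity
  rw [fourierCoeffOn_of_hasDerivAt zero_lt_one hk (fun x _ => hderiv x)
    (hcont.intervalIntegrable _ _), hends]
  simp only [sub_self, mul_zero, zero_sub, Complex.ofReal_one, Complex.ofReal_zero, sub_zero,
    one_mul, mul_neg, norm_neg, norm_mul, norm_div, norm_one, Complex.norm_I, mul_one,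
    Complex.norm_intCast, Complex.norm_real, Real.norm_eq_abs, abs_of_pos Real.pi_pos,
    RCLike.norm_ofNat]
  set c := ‖fourierCoeffOn zero_lt_one f' k‖
  calc 1 / (2 * Real.pi * |(k : ℝ)|) * c ≤ 1 / |(k : ℝ)| * c := by
        gcongr
        exact le_mul_of_one_le_left hk_pos.le (by linarith [Real.pi_gt_three])
    _ ≤ c ^ 2 + (1 / |(k : ℝ)|) ^ 2 := by
        nlinarith [sq_nonneg (1 / |(k : ℝ)| - c), sq_nonneg (1 / |(k : ℝ)|), sq_nonneg c]
    _ = c ^ 2 + 1 / (k : ℝ) ^ 2 := by rw [div_pow, sq_abs, one_pow]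

theorem summable_fourierCoeffOn_of_hasDerivAt {f f' : ℝ → ℂ}
    (hderiv : ∀ x, HasDerivAt f (f' x) x) (hcont : Continuous f') (hends : f 1 = f 0) :
    Summable (fourierCoeffOn zero_lt_one f) := by
  obtain ⟨M, hM⟩ := isCompact_Icc.exists_bound_of_continuousOn (s := Set.Icc (0 : ℝ) 1)
    hcont.continuousOn
  have hmem : MemLp f' 2 (volume.restrict (Set.Ioc 0 1)) := by
    refine MemLp.of_bound hcont.aestronglyMeasurable M ?_
    filter_upwards [ae_restrict_mem measurableSet_Ioc] with x hx
    exact hM x (Set.Ioc_subset_Icc_self hx)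
  have hmajorant := (hasSum_sq_fourierCoeffOn zero_lt_one hmem).summable.add
    (Real.summable_one_div_int_pow.2 one_lt_two)
  refine Summable.of_norm_bounded_eventually hmajorant ?_
  filter_upwards [(Set.finite_singleton (0 : ℤ)).compl_mem_cofinite] with k hk
  exact norm_fourierCoeffOn_le_of_hasDerivAt hderiv hcont hends hk

theorem hasSum_fourier_of_hasDerivAt {f f' : ℝ → ℝ} (hper : Function.Periodic f 1)
    (hderiv : ∀ x, HasDerivAt f (f' x) x) (hcont : Continuous f') (x : ℝ) :
    HasSum (fun k : ℤ => (∫ y in (0 : ℝ)..1, fourierExp k y * f y)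
      * Complex.exp (2 * k * Real.pi * Complex.I * x)) (f x : ℂ) := by
  have hf : Continuous f := continuous_iff_continuousAt.2 fun u => (hderiv u).continuousAt
  have hper' : Function.Periodic (fun y => (f y : ℂ)) 1 := fun y => by simp [hper y]
  let F : C(UnitAddCircle, ℂ) :=
    ⟨hper'.lift, continuous_coinduced_dom.mpr (Complex.continuous_ofReal.comp hf)⟩
  have hcoeff (k : ℤ) : fourierCoeff F k = ∫ y in (0 : ℝ)..1, fourierExp k y * f y :=
    fourierCoeff_unitAddCircle F k
  have hsummable : Summable (fourierCoeff F) := by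
    refine (summable_fourierCoeffOn_of_hasDerivAt (f := fun y => (f y : ℂ))
      (fun y => (hderiv y).ofReal_comp) (Complex.continuous_ofReal.comp hcont)
      (by simpa using hper' 0)).congr fun k => ?_
    rw [hcoeff, fourierCoeffOn_zero_lt_one]
  convert! has_pointwise_sum_fourier_series_of_summable hsummable (x : UnitAddCircle) using 1
  ext k
  rw [smul_eq_mul, hcoeff, fourier_coe_apply]
  congr 2
  push_cast
  ring

theorem intervalIntegrable_fourierExp_mul {f : ℝ → ℂ} (hf : Continuous f) (k : ℤ) (a b : ℝ) :
    IntervalIntegrable (fun x => fourierExp k x * f x) volume a b :=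
  ((continuous_fourierExp k).mul hf).intervalIntegrable _ _

theorem two_mul_int_mul_pi_mul_I_ne_zero {k : ℤ} (hk : k ≠ 0) :
    2 * k * Real.pi * Complex.I ≠ (0 : ℂ) := by
  simp [hk, Real.pi_ne_zero]

theorem integral_fourierExp {k : ℤ} (hk : k ≠ 0) : ∫ x in (0 : ℝ)..1, fourierExp k x = 0 := by
  have hint := intervalIntegral.integral_eq_sub_of_hasDerivAt
    (fun x (_ : x ∈ Set.uIcc 0 1) => hasDerivAt_fourierExp k x)
    ((continuous_const.mul (continuous_fourierExp k)).intervalIntegrable _ _)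
  rw [intervalIntegral.integral_const_mul, fourierExp_one_right, fourierExp_zero_right,
    sub_self] at hint
  exact (mul_eq_zero.1 hint).resolve_left (neg_ne_zero.2 (two_mul_int_mul_pi_mul_I_ne_zero hk))

theorem integral_fourierExp_mul_pow_succ {k : ℤ} (hk : k ≠ 0) (n : ℕ) :
    ∫ x in (0 : ℝ)..1, fourierExp k x * (x : ℂ) ^ (n + 1) =
      ((n + 1) * (∫ x in (0 : ℝ)..1, fourierExp k x * (x : ℂ) ^ n) - 1)
        / (2 * k * Real.pi * Complex.I) := by
  set a : ℂ := 2 * k * Real.pi * Complex.I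
  have hderiv (x : ℝ) : HasDerivAt (fun x : ℝ => fourierExp k x * (x : ℂ) ^ (n + 1))
      ((n + 1) * (fourierExp k x * (x : ℂ) ^ n) - a * (fourierExp k x * (x : ℂ) ^ (n + 1))) x := by
    convert! (hasDerivAt_fourierExp k x).mul (hasDerivAt_pow (n + 1) (x : ℂ)).comp_ofReal using 1
    push_cast
    ring
  have hpow (m : ℕ) (c : ℂ) : IntervalIntegrable
      (fun x : ℝ => c * (fourierExp k x * (x : ℂ) ^ m)) volume 0 1 :=
    (intervalIntegrable_fourierExp_mul (by fun_prop) k 0 1).const_mul c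
  have hint := intervalIntegral.integral_eq_sub_of_hasDerivAt
    (fun x (_ : x ∈ Set.uIcc 0 1) => hderiv x) ((hpow n _).sub (hpow (n + 1) a))
  rw [intervalIntegral.integral_sub (hpow n _) (hpow (n + 1) a),
    intervalIntegral.integral_const_mul, intervalIntegral.integral_const_mul,
    fourierExp_one_right, Complex.ofReal_one, one_pow, Complex.ofReal_zero,
    zero_pow n.succ_ne_zero, mul_zero, mul_one, sub_zero] at hint
  rw [eq_div_iff (two_mul_int_mul_pi_mul_I_ne_zero hk)]
  linear_combination -hint

theorem integral_fourierExp_mul_id {k : ℤ} (hk : k ≠ 0) :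
    ∫ x in (0 : ℝ)..1, fourierExp k x * x = -(1 / (2 * k * Real.pi * Complex.I)) := by
  simpa [integral_fourierExp hk, neg_div] using integral_fourierExp_mul_pow_succ hk 0

theorem integral_fourierExp_mul_sq {k : ℤ} (hk : k ≠ 0) :
    ∫ x in (0 : ℝ)..1, fourierExp k x * (x : ℂ) ^ 2 = -(1 / (2 * k * Real.pi * Complex.I))
      - 2 / (2 * k * Real.pi * Complex.I) ^ 2 := by
  rw [integral_fourierExp_mul_pow_succ hk 1]
  simp only [pow_one, integral_fourierExp_mul_id hk, Nat.cast_one]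
  ring

/-! ### Periodic parts of the regularised sums -/

/-- The regularised sum of all integer translates of `q`. With `q x` the limiting probability that
the degree exceeds its typical value by `-x`, it is the limiting expectation. -/
noncomputable def firstSum (q : ℝ → ℝ) : ℝ → ℝ := shiftSum q fun _ => 1

/-- The regularised sum of all integer translates of `q` with weights `2 r - 1`. These are the
weights that give a second moment, because `r ^ 2 = ∑ i ≤ r, (2 i - 1)`. -/
noncomputable def secondSum (q : ℝ → ℝ) : ℝ → ℝ := shiftSum q fun r => 2 * r - 1

/-- The combination of `firstSum` and `secondSum` that is `1`-periodic; it is the second moment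
about `x`. -/
noncomputable def secondPeriodic (q : ℝ → ℝ) (x : ℝ) : ℝ :=
  secondSum q x - 2 * x * firstSum q x + x ^ 2

theorem abs_one_le_two_mul_abs_add_one (r : ℤ) : |(1 : ℝ)| ≤ 2 * |(r : ℝ)| + 1 := by
  rw [abs_one]
  linarith [abs_nonneg (r : ℝ)]

theorem abs_two_mul_sub_one_le_two_mul_abs_add_one (r : ℤ) :
    |2 * (r : ℝ) - 1| ≤ 2 * |(r : ℝ)| + 1 := by
  simpa [abs_mul] using abs_sub (2 * (r : ℝ)) 1

namespace SmoothStep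

variable {q q' : ℝ → ℝ} {C : ℝ}

theorem firstSum_add_one (h : SmoothStep q q' C) (x : ℝ) :
    firstSum q (x + 1) = firstSum q x + 1 :=
  h.shiftSum_add_one abs_one_le_two_mul_abs_add_one x

theorem secondSum_add_one (h : SmoothStep q q' C) (x : ℝ) :
    secondSum q (x + 1) = secondSum q x + 2 * firstSum q x + 1 := by
  have hweight (r : ℤ) : 2 * ((r + 1 : ℤ) : ℝ) - 1 = 2 * r + 1 := by push_cast; ring
  have hsum := (h.summable abs_two_mul_sub_one_le_two_mul_abs_add_one x).hasSum.add
    ((h.summable abs_one_le_two_mul_abs_add_one x).hasSum.mul_left 2)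
  rw [secondSum, h.shiftSum_add_one, firstSum, shiftSum, shiftSum, shiftSum, ← hsum.tsum_eq]
  · congr 1
    · refine tsum_congr fun r => ?_
      rw [hweight]
      ring
    · norm_num
  · intro r
    rw [hweight]
    simpa [abs_mul] using abs_add_le (2 * (r : ℝ)) 1

theorem periodic_firstSum_sub (h : SmoothStep q q' C) :
    Function.Periodic (fun x => firstSum q x - x) 1 := fun x => by
  simp only [h.firstSum_add_one]
  ring

theorem periodic_secondPeriodic (h : SmoothStep q q' C) :
    Function.Periodic (secondPeriodic q) 1 := fun x => by
  simp only [secondPeriodic, h.firstSum_add_one, h.secondSum_add_one]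
  ring

theorem hasDerivAt_firstSum (h : SmoothStep q q' C) (x : ℝ) :
    HasDerivAt (firstSum q) (∑' r : ℤ, 1 * q' (x - r)) x :=
  h.hasDerivAt_shiftSum abs_one_le_two_mul_abs_add_one x

theorem hasDerivAt_secondSum (h : SmoothStep q q' C) (x : ℝ) :
    HasDerivAt (secondSum q) (∑' r : ℤ, (2 * (r : ℝ) - 1) * q' (x - r)) x :=
  h.hasDerivAt_shiftSum abs_two_mul_sub_one_le_two_mul_abs_add_one x

theorem continuous_firstSum (h : SmoothStep q q' C) : Continuous (firstSum q) :=
  continuous_iff_continuousAt.2 fun x => (h.hasDerivAt_firstSum x).continuousAt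

theorem continuous_secondSum (h : SmoothStep q q' C) : Continuous (secondSum q) :=
  continuous_iff_continuousAt.2 fun x => (h.hasDerivAt_secondSum x).continuousAt

theorem exists_hasDerivAt_firstSum_sub (h : SmoothStep q q' C) :
    ∃ f' : ℝ → ℝ, (∀ x, HasDerivAt (fun x => firstSum q x - x) (f' x) x) ∧ Continuous f' :=
  ⟨_, fun x => (h.hasDerivAt_firstSum x).sub (hasDerivAt_id x),
    (h.continuous_tsum_deriv abs_one_le_two_mul_abs_add_one).sub continuous_const⟩

theorem exists_hasDerivAt_secondPeriodic (h : SmoothStep q q' C) :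
    ∃ f' : ℝ → ℝ, (∀ x, HasDerivAt (secondPeriodic q) (f' x) x) ∧ Continuous f' := by
  have hfirst := h.continuous_firstSum
  have hfirst' := h.continuous_tsum_deriv abs_one_le_two_mul_abs_add_one
  have hsecond' := h.continuous_tsum_deriv abs_two_mul_sub_one_le_two_mul_abs_add_one
  exact ⟨_, fun x => ((h.hasDerivAt_secondSum x).sub
    (((hasDerivAt_id x).const_mul 2).mul (h.hasDerivAt_firstSum x))).add (hasDerivAt_pow 2 x),
    by fun_prop⟩

theorem integral_fourierExp_mul_firstSum_sub (h : SmoothStep q q' C) (k : ℤ) :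
    ∫ y in (0 : ℝ)..1, fourierExp k y * ((firstSum q y - y : ℝ) : ℂ) =
      (∫ t, fourierExp k t * ((q t - (if 0 < t then 1 else 0) : ℝ) : ℂ))
        - ∫ y in (0 : ℝ)..1, fourierExp k y * y := by
  have hbound (t : ℝ) : ‖fourierExp k t‖ ≤ 2 * |t| + 1 := by
    rw [norm_fourierExp]
    linarith [abs_nonneg t]
  have hsum (x : ℝ) : HasSum (fun r : ℤ => fourierExp k (x - r)
      * ((q (x - r) - (if r ≤ 0 then 1 else 0) : ℝ) : ℂ)) (fourierExp k x * firstSum q x) := by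
    simpa only [fourierExp_sub_int, one_mul, firstSum, shiftSum] using (Complex.hasSum_ofReal.2
      (h.summable abs_one_le_two_mul_abs_add_one x).hasSum).mul_left (fourierExp k x)
  rw [← h.integral_unfold (continuous_fourierExp k) hbound hsum,
    ← intervalIntegral.integral_sub]
  · simp only [Complex.ofReal_sub, mul_sub]
  · exact intervalIntegrable_fourierExp_mul
      (Complex.continuous_ofReal.comp h.continuous_firstSum) k 0 1
  · exact intervalIntegrable_fourierExp_mul Complex.continuous_ofReal k 0 1

theorem integral_fourierExp_mul_secondPeriodic (h : SmoothStep q q' C) (k : ℤ) :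
    ∫ y in (0 : ℝ)..1, fourierExp k y * (secondPeriodic q y : ℂ) =
      (∫ t, fourierExp k t * (-(2 * t + 1)) * ((q t - (if 0 < t then 1 else 0) : ℝ) : ℂ))
        + ∫ y in (0 : ℝ)..1, fourierExp k y * (y : ℂ) ^ 2 := by
  have hbound (t : ℝ) : ‖fourierExp k t * (-(2 * t + 1))‖ ≤ 2 * |t| + 1 := by
    rw [norm_mul, norm_fourierExp, one_mul, norm_neg]
    exact (norm_add_le _ _).trans (by simp)
  have hsum (x : ℝ) : HasSum (fun r : ℤ => fourierExp k (x - r) * (-(2 * (x - r : ℝ) + 1))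
      * ((q (x - r) - (if r ≤ 0 then 1 else 0) : ℝ) : ℂ))
      (fourierExp k x * ((secondSum q x - 2 * x * firstSum q x : ℝ) : ℂ)) := by
    convert! (Complex.hasSum_ofReal.2
      ((h.summable abs_two_mul_sub_one_le_two_mul_abs_add_one x).hasSum.sub
      ((h.summable abs_one_le_two_mul_abs_add_one x).hasSum.mul_left (2 * x)))).mul_left
      (fourierExp k x) using 1
    ext r
    rw [fourierExp_sub_int]
    push_cast
    ring
  have hcont : Continuous fun t : ℝ => fourierExp k t * (-(2 * t + 1)) :=
    (continuous_fourierExp k).mul (by fun_prop)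
  rw [← h.integral_unfold hcont hbound hsum,
    ← intervalIntegral.integral_add]
  · simp only [secondPeriodic, Complex.ofReal_add, Complex.ofReal_pow, mul_add]
  · exact intervalIntegrable_fourierExp_mul (Complex.continuous_ofReal.comp
      (h.continuous_secondSum.sub ((by fun_prop : Continuous fun x : ℝ => 2 * x).mul
        h.continuous_firstSum))) k 0 1
  · exact intervalIntegrable_fourierExp_mul (by fun_prop) k 0 1

end SmoothStep

/-! ### The limiting tail in logarithmic scale and its Mellin transform -/

theorem exists_abs_comp_exp_neg_mul_le {f : ℝ → ℝ} {c : ℝ} (hc : 1 ≤ c)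
    (hzero : f =O[𝓟 (Set.Ioo 0 1)] fun t => t) (htop : f =O[𝓟 (Set.Ici 1)] fun t => t⁻¹) :
    ∃ C, ∀ u, |f (Real.exp (-(u * c)))| ≤ C * Real.exp (-|u|) := by
  obtain ⟨A, hA, hzero⟩ := hzero.exists_nonneg
  obtain ⟨B, hB, htop⟩ := htop.exists_nonneg
  rw [isBigOWith_principal] at hzero htop
  refine ⟨max A B, fun u => ?_⟩
  rcases lt_or_ge 0 u with hu | hu
  · have hlt : Real.exp (-(u * c)) < 1 := Real.exp_lt_one_iff.2 (by nlinarith)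
    have hle : Real.exp (-(u * c)) ≤ Real.exp (-|u|) := by
      rw [abs_of_pos hu]
      exact Real.exp_le_exp.2 (by nlinarith)
    calc |f (Real.exp (-(u * c)))| ≤ A * ‖Real.exp (-(u * c))‖ := hzero _ ⟨Real.exp_pos _, hlt⟩
      _ ≤ max A B * Real.exp (-|u|) := by
        rw [Real.norm_of_nonneg (Real.exp_nonneg _)]
        gcongr
        exact le_max_left A B
  · have hge : 1 ≤ Real.exp (-(u * c)) := Real.one_le_exp (by nlinarith)
    have hle : (Real.exp (-(u * c)))⁻¹ ≤ Real.exp (-|u|) := by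
      rw [abs_of_nonpos hu, ← Real.exp_neg]
      exact Real.exp_le_exp.2 (by nlinarith)
    calc |f (Real.exp (-(u * c)))| ≤ B * ‖(Real.exp (-(u * c)))⁻¹‖ := htop _ hge
      _ ≤ max A B * Real.exp (-|u|) := by
        rw [Real.norm_of_nonneg (by positivity)]
        gcongr
        exact le_max_right A B

theorem one_le_log_four : 1 ≤ Real.log 4 := by
  rw [Real.log_four_eq]
  linarith [Real.log_two_gt_d9]

theorem log_four_pos : 0 < Real.log 4 := one_pos.trans_le one_le_log_four

theorem ofReal_log_four_ne_zero : (Real.log 4 : ℂ) ≠ 0 :=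
  Complex.ofReal_ne_zero.2 log_four_pos.ne'

theorem hasMellin_step {s : ℂ} (hs : 0 < s.re) :
    HasMellin (fun t : ℝ => (if t < 1 then (1 : ℂ) else 0)) s (1 / s) := by
  have hae : (fun t : ℝ => (t : ℂ) ^ (s - 1) • (Set.Ioc 0 1).indicator (fun _ => (1 : ℂ)) t)
      =ᵐ[volume.restrict (Set.Ioi 0)]
      fun t : ℝ => (t : ℂ) ^ (s - 1) • (if t < 1 then (1 : ℂ) else 0) := by
    filter_upwards [ae_restrict_mem measurableSet_Ioi,
      ae_restrict_of_ae (Measure.ae_ne volume (1 : ℝ))] with t ht hne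
    have hiff : t ∈ Set.Ioc 0 1 ↔ t < 1 := ⟨fun h => h.2.lt_of_ne hne, fun h => ⟨ht, h.le⟩⟩
    simp only [Set.indicator, hiff]
  obtain ⟨hconv, hval⟩ := hasMellin_one_Ioc hs
  refine ⟨hconv.congr hae, ?_⟩
  rw [mellin, ← integral_congr_ae hae]
  exact hval

theorem mellin_thetaSum_one {s : ℂ} (hs : 0 < s.re) :
    mellin (fun t => (thetaSum 1 t : ℂ)) (s + 3 / 2)
      = Complex.Gamma (s + 3 / 2) * riemannZeta (2 * s + 1) := by
  have hre : (s + 3 / 2).re = s.re + 3 / 2 := by simp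
  have hpos (i : ℕ) : (0 : ℝ) < (i : ℝ) + 1 := i.cast_add_one_pos
  have hpow (i : ℕ) : ((((i : ℝ) + 1) ^ 2 : ℝ) : ℂ) ^ (s + 3 / 2)
      = ((i : ℂ) + 1) ^ (2 * s + 1) * ((i : ℂ) + 1) ^ 2 := by
    have hi : (i : ℂ) + 1 ≠ 0 := i.cast_add_one_ne_zero
    rw [sq, Complex.ofReal_mul, Complex.mul_cpow_ofReal_nonneg (hpos i).le (hpos i).le,
      Complex.ofReal_add, Complex.ofReal_natCast, Complex.ofReal_one, ← Complex.cpow_natCast,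
      ← Complex.cpow_add _ _ hi, ← Complex.cpow_add _ _ hi]
    congr 1
    push_cast
    ring
  have hterm (i : ℕ) : Complex.Gamma (s + 3 / 2) * ((i : ℂ) + 1) ^ 2
      / ((((i : ℝ) + 1) ^ 2 : ℝ) : ℂ) ^ (s + 3 / 2)
      = Complex.Gamma (s + 3 / 2) * (1 / ((i : ℂ) + 1) ^ (2 * s + 1)) := by
    have hi : (i : ℂ) + 1 ≠ 0 := i.cast_add_one_ne_zero
    rw [hpow, mul_div_mul_right _ _ (pow_ne_zero 2 hi), mul_one_div]
  have hsummable : Summable fun i : ℕ =>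
      ‖((i : ℂ) + 1) ^ 2‖ / (((i : ℝ) + 1) ^ 2) ^ (s + 3 / 2).re := by
    refine ((summable_nat_add_iff 1).2
      (Real.summable_one_div_nat_rpow.2 (by linarith : 1 < 2 * s.re + 1))).congr fun i => ?_
    have hnorm : ‖((i : ℂ) + 1) ^ 2‖ = ((i : ℝ) + 1) ^ 2 := by
      rw [norm_pow, ← Nat.cast_add_one, Complex.norm_natCast, Nat.cast_add_one]
    rw [hnorm, hre, ← Real.rpow_natCast_mul (hpos i).le, ← Real.rpow_natCast,
      ← Real.rpow_sub (hpos i), Nat.cast_add_one, one_div, ← Real.rpow_neg (hpos i).le]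
    congr 1
    push_cast
    ring
  have hmellin := hasSum_mellin (a := fun i : ℕ => ((i : ℂ) + 1) ^ 2)
    (p := fun i : ℕ => ((i : ℝ) + 1) ^ 2) (F := fun t => (thetaSum 1 t : ℂ)) (s := s + 3 / 2)
    (fun i => Or.inr (by positivity)) (by rw [hre]; linarith) (fun t ht => ?_) hsummable
  · rw [← hmellin.tsum_eq, zeta_eq_tsum_one_div_nat_add_one_cpow (by simpa using hs),
      ← tsum_mul_left]
    exact tsum_congr hterm
  · convert! Complex.hasSum_ofReal.2 (summable_thetaSum 1 ht).hasSum using 1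
    ext i
    push_cast
    ring

namespace LatticePath

/-- `limitTail` in logarithmic scale: `logTail (log₄ n - r)` approximates the probability
that the reduction degree of a random path of length `n` is at least `r`. -/
noncomputable def logTail (u : ℝ) : ℝ := limitTail (Real.exp (-(u * Real.log 4)))

theorem isBigO_limitTail_sub_step_top :
    (fun t => limitTail t - if t < 1 then 1 else 0) =O[𝓟 (Set.Ici 1)] fun t => t⁻¹ :=
  isBigO_limitTail.congr' (mem_principal.2 fun t ht => by
    simp only [Set.mem_ofPred_eq, if_neg (not_lt.2 (Set.mem_Ici.1 ht)), sub_zero]) EventuallyEq.rfl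

theorem isBigO_limitTail_sub_step_zero :
    (fun t => limitTail t - if t < 1 then 1 else 0) =O[𝓟 (Set.Ioo 0 1)] fun t => t :=
  (isBigO_limitTail_sub_one.mono (principal_mono.2 Set.Ioo_subset_Ioc_self)).congr'
    (mem_principal.2 fun t ht => by simp only [Set.mem_ofPred_eq, if_pos ht.2]) EventuallyEq.rfl

theorem exp_neg_mul_log_four_lt_one_iff (u : ℝ) : Real.exp (-(u * Real.log 4)) < 1 ↔ 0 < u := by
  rw [Real.exp_lt_one_iff, neg_lt_zero, mul_pos_iff_of_pos_right log_four_pos]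

theorem exists_smoothStep_logTail : ∃ q' C, SmoothStep logTail q' C := by
  set τ : ℝ → ℝ := fun u => Real.exp (-(u * Real.log 4))
  have hτ_deriv (u : ℝ) : HasDerivAt τ (τ u * -Real.log 4) u := by
    simpa using (((hasDerivAt_id u).mul_const (Real.log 4)).neg).exp
  have hτ_cont : Continuous τ := by fun_prop
  obtain ⟨A, hA⟩ := exists_abs_comp_exp_neg_mul_le one_le_log_four isBigO_limitTail_sub_step_zero
    isBigO_limitTail_sub_step_top
  obtain ⟨B, hB⟩ := exists_abs_comp_exp_neg_mul_le one_le_log_four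
    ((isBigO_mul_limitTailDeriv_Ioc.mono (principal_mono.2 Set.Ioo_subset_Ioc_self)).const_mul_left
      (-Real.log 4)) (isBigO_mul_limitTailDeriv.const_mul_left (-Real.log 4))
  refine ⟨fun u => -Real.log 4 * (τ u * limitTailDeriv (τ u)), max A B, fun u => ?_, ?_,
    fun u => ?_, fun u => ?_⟩
  · refine ((hasDerivAt_limitTail (t := τ u) (Real.exp_pos _)).comp u (hτ_deriv u)).congr_deriv ?_
    ring
  · exact continuous_const.mul (hτ_cont.mul
      (continuousOn_limitTailDeriv.comp_continuous hτ_cont fun u => Real.exp_pos _))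
  · have hstep := hA u
    simp only [exp_neg_mul_log_four_lt_one_iff] at hstep
    exact hstep.trans (by gcongr; exact le_max_left A B)
  · exact (hB u).trans (by gcongr; exact le_max_right A B)

/-- `limitTail` minus the unit step `1_{t < 1}`, which makes its Mellin transform converge
in a strip around `0`. -/
noncomputable def reducedTail (t : ℝ) : ℂ := ((limitTail t - (if t < 1 then 1 else 0) : ℝ) : ℂ)

theorem reducedTail_eq_sub (t : ℝ) :
    reducedTail t = limitTail t - if t < 1 then 1 else 0 := by
  rw [reducedTail]
  split_ifs <;> simp

theorem locallyIntegrableOn_reducedTail : LocallyIntegrableOn reducedTail (Set.Ioi 0) := by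
  have htail : LocallyIntegrableOn (fun t => (limitTail t : ℂ)) (Set.Ioi 0) :=
    (Complex.continuous_ofReal.comp_continuousOn continuousOn_limitTail).locallyIntegrableOn
      measurableSet_Ioi
  have hstep : LocallyIntegrableOn ((Set.Iio 1).indicator fun _ : ℝ => (1 : ℂ)) (Set.Ioi 0) :=
    ((locallyIntegrable_const 1).indicator measurableSet_Iio).locallyIntegrableOn _
  convert! htail.sub hstep using 1
  ext t
  simp only [reducedTail_eq_sub, Pi.sub_apply, Set.indicator, Set.mem_Iio]

theorem isBigO_reducedTail_top : reducedTail =O[atTop] (fun t : ℝ => t ^ (-(1 : ℝ))) := by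
  simp only [Real.rpow_neg_one]
  exact Complex.isBigO_ofReal_left.2
    (isBigO_limitTail_sub_step_top.mono (le_principal_iff.2 (Ici_mem_atTop 1)))

theorem isBigO_reducedTail_zero : reducedTail =O[𝓝[>] 0] (fun t : ℝ => t ^ (-(-1 : ℝ))) := by
  simp only [neg_neg, Real.rpow_one]
  exact Complex.isBigO_ofReal_left.2
    (isBigO_limitTail_sub_step_zero.mono (le_principal_iff.2 (Ioo_mem_nhdsGT one_pos)))

theorem hasDerivAt_mellin_reducedTail {s : ℂ} (hs : s.re < 1) (hs' : -1 < s.re) :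
    HasDerivAt (mellin reducedTail) (mellin (fun t => Real.log t • reducedTail t) s) s :=
  (mellin_hasDerivAt_of_isBigO_rpow locallyIntegrableOn_reducedTail isBigO_reducedTail_top hs
    isBigO_reducedTail_zero hs').2

theorem mellinConvergent_limitTail {s : ℂ} (hs : 0 < s.re) (hs' : s.re < 1) :
    MellinConvergent (fun t => (limitTail t : ℂ)) s := by
  have hreduced : MellinConvergent reducedTail s :=
    mellinConvergent_of_isBigO_rpow locallyIntegrableOn_reducedTail isBigO_reducedTail_top hs'
      isBigO_reducedTail_zero (by linarith)
  simpa only [reducedTail_eq_sub, sub_add_cancel] using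
    (hasMellin_add hreduced (hasMellin_step hs).1).1

theorem mellin_reducedTail_eq_sub {s : ℂ} (hs : 0 < s.re) (hs' : s.re < 1) :
    mellin reducedTail s = mellin (fun t => (limitTail t : ℂ)) s - 1 / s := by
  rw [← (hasMellin_step hs).2,
    ← (hasMellin_sub (mellinConvergent_limitTail hs hs') (hasMellin_step hs).1).2]
  exact congrArg (mellin · s) (funext reducedTail_eq_sub)

theorem mellin_limitTail {s : ℂ} (hs : 0 < s.re) :
    mellin (fun t => (limitTail t : ℂ)) s
      = 4 / Real.sqrt Real.pi * (Complex.Gamma (s + 3 / 2) * riemannZeta (2 * s + 1)) := by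
  rw [← mellin_thetaSum_one hs, ← mellin_cpow_smul, ← smul_eq_mul, ← mellin_const_smul]
  refine setIntegral_congr_fun measurableSet_Ioi fun t ht => ?_
  have ht_nonneg : (0 : ℝ) ≤ t := (Set.mem_Ioi.1 ht).le
  simp only [limitTail, smul_eq_mul]
  push_cast
  rw [Complex.ofReal_cpow ht_nonneg]
  push_cast
  ring

theorem chi_div_two (k : ℤ) : chi k / 2 = ((2 * Real.pi * k / Real.log 4 : ℝ) : ℂ) * Complex.I := by
  rw [chi, Real.log_four_eq]
  push_cast
  ring

theorem mellin_chi_div_two (f : ℝ → ℂ) (k : ℤ) :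
    mellin f (chi k / 2) = Real.log 4 *
      ∫ t : ℝ, fourierExp k t * f (Real.exp (-(t * Real.log 4))) := by
  have hl := ofReal_log_four_ne_zero
  have hpi : (Real.pi : ℂ) ≠ 0 := Complex.ofReal_ne_zero.2 Real.pi_ne_zero
  set g : ℝ → ℂ := fun v =>
    Complex.exp (-(2 * Real.pi * k / Real.log 4 * v * Complex.I)) * f (Real.exp (-v))
  have hmellin : mellin f (chi k / 2) = ∫ v, g v := by
    rw [mellin_eq_fourier, chi_div_two, Real.fourier_real_eq_integral_exp_smul]
    refine integral_congr_ae (Eventually.of_forall fun v => ?_)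
    simp only [g, Complex.re_ofReal_mul, Complex.I_re, Complex.im_ofReal_mul, Complex.I_im,
      mul_zero, neg_zero, zero_mul, Real.exp_zero, one_smul, smul_eq_mul, mul_one]
    congr 2
    push_cast
    field_simp
  have hscale (t : ℝ) : fourierExp k t * f (Real.exp (-(t * Real.log 4))) = g (t * Real.log 4) := by
    simp only [g, fourierExp]
    congr 2
    push_cast
    field_simp
  simp only [hscale]
  rw [hmellin, Measure.integral_comp_mul_right, abs_inv, abs_of_pos log_four_pos,
    Complex.real_smul, ← mul_assoc, ← Complex.ofReal_mul, mul_inv_cancel₀ log_four_pos.ne',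
    Complex.ofReal_one, one_mul]

theorem reducedTail_exp (t : ℝ) : reducedTail (Real.exp (-(t * Real.log 4))) =
    ((logTail t - (if 0 < t then 1 else 0) : ℝ) : ℂ) := by
  simp only [reducedTail, logTail, exp_neg_mul_log_four_lt_one_iff]

theorem integral_fourierExp_mul_logTail (k : ℤ) :
    ∫ t, fourierExp k t * ((logTail t - (if 0 < t then 1 else 0) : ℝ) : ℂ)
      = mellin reducedTail (chi k / 2) / Real.log 4 := by
  rw [mellin_chi_div_two, mul_div_cancel_left₀ _ ofReal_log_four_ne_zero]
  simp only [reducedTail_exp]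

theorem chi_div_two_re (k : ℤ) : (chi k / 2).re = 0 := by
  rw [chi_div_two, Complex.re_ofReal_mul, Complex.I_re, mul_zero]

theorem deriv_mellin_reducedTail_chi_div_two (k : ℤ) :
    deriv (mellin reducedTail) (chi k / 2) = -(Real.log 4 ^ 2 *
      ∫ t, fourierExp k t * t * ((logTail t - (if 0 < t then 1 else 0) : ℝ) : ℂ)) := by
  have hre := chi_div_two_re k
  rw [(hasDerivAt_mellin_reducedTail (by rw [hre]; norm_num) (by rw [hre]; norm_num)).deriv,
    mellin_chi_div_two, sq, mul_assoc, ← mul_neg, neg_mul_eq_neg_mul]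
  refine congrArg _ ?_
  rw [← integral_const_mul]
  refine integral_congr_ae (Eventually.of_forall fun t => ?_)
  simp only [reducedTail_exp, Real.log_exp, Complex.real_smul]
  push_cast
  ring

theorem integral_fourierExp_mul_linear_mul_logTail (k : ℤ) :
    ∫ t, fourierExp k t * (-(2 * t + 1)) * ((logTail t - (if 0 < t then 1 else 0) : ℝ) : ℂ)
      = (2 / Real.log 4 * deriv (mellin reducedTail) (chi k / 2)
          - mellin reducedTail (chi k / 2)) / Real.log 4 := by
  have hl := ofReal_log_four_ne_zero
  obtain ⟨q', C, h⟩ := exists_smoothStep_logTail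
  have hint := h.integrable_mul_sub_step (continuous_fourierExp k) fun t => by
    rw [norm_fourierExp]
    linarith [abs_nonneg t]
  have hint_id := h.integrable_mul_sub_step
    (a := fun t => fourierExp k t * t) ((continuous_fourierExp k).mul Complex.continuous_ofReal)
    fun t => by
      rw [norm_mul, norm_fourierExp, one_mul, Complex.norm_real, Real.norm_eq_abs]
      linarith [abs_nonneg t]
  calc _ = ∫ t, (-2 * (fourierExp k t * t * ((logTail t - (if 0 < t then 1 else 0) : ℝ) : ℂ))
        - fourierExp k t * ((logTail t - (if 0 < t then 1 else 0) : ℝ) : ℂ)) :=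
        integral_congr_ae (Eventually.of_forall fun t => by ring)
    _ = -2 * (∫ t, fourierExp k t * t * ((logTail t - (if 0 < t then 1 else 0) : ℝ) : ℂ))
        - mellin reducedTail (chi k / 2) / Real.log 4 := by
        rw [integral_sub (hint_id.const_mul _) hint, integral_const_mul,
          integral_fourierExp_mul_logTail]
    _ = _ := by
        rw [deriv_mellin_reducedTail_chi_div_two]
        field_simp

end LatticePath

/-! ### Gamma, digamma and zeta functions -/

theorem ofReal_sqrt_pi_ne_zero : ((√Real.pi : ℝ) : ℂ) ≠ 0 :=
  Complex.ofReal_ne_zero.2 (Real.sqrt_pos.2 Real.pi_pos).ne'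

theorem pi_cpow_one_half : (Real.pi : ℂ) ^ (1 / 2 : ℂ) = ((√Real.pi : ℝ) : ℂ) := by
  rw [Real.sqrt_eq_rpow, Complex.ofReal_cpow Real.pi_pos.le]
  norm_num

theorem complex_log_two : Complex.log 2 = (Real.log 2 : ℂ) := by
  rw [Complex.ofReal_log zero_le_two, Complex.ofReal_ofNat]

theorem isOpen_re_preimage_Ioo (a b : ℝ) : IsOpen (Complex.re ⁻¹' Set.Ioo a b) :=
  isOpen_Ioo.preimage Complex.continuous_re

theorem ne_neg_natCast_of_re_pos {s : ℂ} (hs : 0 < s.re) (m : ℕ) : s ≠ -m := by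
  rintro rfl
  simp only [Complex.neg_re, Complex.natCast_re, Left.neg_pos_iff] at hs
  exact hs.not_ge m.cast_nonneg

theorem differentiableAt_Gamma_of_re_pos {s : ℂ} (hs : 0 < s.re) :
    DifferentiableAt ℂ Complex.Gamma s :=
  Complex.differentiableAt_Gamma s (ne_neg_natCast_of_re_pos hs)

theorem analyticAt_Gamma_of_re_pos {s : ℂ} (hs : 0 < s.re) : AnalyticAt ℂ Complex.Gamma s :=
  DifferentiableOn.analyticAt (s := {s : ℂ | 0 < s.re})
    (fun _ hz => (differentiableAt_Gamma_of_re_pos hz).differentiableWithinAt)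
    ((isOpen_lt continuous_const Complex.continuous_re).mem_nhds hs)

theorem hasDerivAt_Gamma_of_re_pos {s : ℂ} (hs : 0 < s.re) :
    HasDerivAt Complex.Gamma (Complex.Gamma s * Complex.digamma s) s := by
  refine (differentiableAt_Gamma_of_re_pos hs).hasDerivAt.congr_deriv ?_
  rw [Complex.digamma_def, logDeriv_apply, mul_div_cancel₀ _ (Complex.Gamma_ne_zero_of_re_pos hs)]

theorem two_mul_digamma_two_mul {z : ℂ} (hz : 0 < z.re) :
    2 * Complex.digamma (2 * z)
      = Complex.digamma z + Complex.digamma (z + 1 / 2) + 2 * Complex.log 2 := by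
  have hz_two : 0 < (2 * z).re := by simpa using hz
  have hz_half : 0 < (z + 1 / 2).re := by
    rw [Complex.add_re]
    exact add_pos hz (by norm_num)
  have hlinear : HasDerivAt (fun s : ℂ => 2 * s) 2 z := by
    simpa using (hasDerivAt_id z).const_mul 2
  have hdouble : HasDerivAt (fun s => Complex.Gamma (2 * s))
      (Complex.Gamma (2 * z) * Complex.digamma (2 * z) * 2) z :=
    (hasDerivAt_Gamma_of_re_pos hz_two).comp z hlinear
  have hleft : HasDerivAt (fun s => Complex.Gamma s * Complex.Gamma (s + 1 / 2)) _ z :=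
    (hasDerivAt_Gamma_of_re_pos hz).mul
      ((hasDerivAt_Gamma_of_re_pos hz_half).comp_add_const z (1 / 2))
  have hright : HasDerivAt (fun s => Complex.Gamma (2 * s) * (2 : ℂ) ^ (1 - 2 * s)
      * ((√Real.pi : ℝ) : ℂ)) _ z :=
    (hdouble.mul ((hlinear.const_sub 1).const_cpow (c := 2) (Or.inl two_ne_zero))).mul_const _
  have hderiv := (hleft.congr_of_eventuallyEq (Eventually.of_forall fun s =>
    (Complex.Gamma_mul_Gamma_add_half s).symm)).unique hright
  apply mul_left_cancel₀ (mul_ne_zero (Complex.Gamma_ne_zero_of_re_pos hz)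
    (Complex.Gamma_ne_zero_of_re_pos hz_half))
  linear_combination -hderiv
    + (2 * Complex.digamma (2 * z) - 2 * Complex.log 2) * Complex.Gamma_mul_Gamma_add_half z

theorem Gammaℝ_mul_riemannZeta_one_sub {s : ℂ} (hs : s.Gammaℝ ≠ 0) (hs' : (1 - s).Gammaℝ ≠ 0) :
    s.Gammaℝ * riemannZeta s = (1 - s).Gammaℝ * riemannZeta (1 - s) := by
  have hne {w : ℂ} (hw : w.Gammaℝ ≠ 0) : w ≠ 0 := by
    rintro rfl
    exact hw (Complex.Gammaℝ_eq_zero_iff.2 ⟨0, by simp⟩)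
  rw [riemannZeta_def_of_ne_zero (hne hs), riemannZeta_def_of_ne_zero (hne hs'),
    mul_div_cancel₀ _ hs, mul_div_cancel₀ _ hs', completedRiemannZeta_one_sub]

theorem Gamma_add_half_mul_riemannZeta {s : ℂ} (hs : s ≠ 0) (hre : s.re ∈ Set.Ioo (-(1 / 2)) 1) :
    Complex.Gamma (s + 1 / 2) * riemannZeta (2 * s + 1)
      = √Real.pi * (Real.pi : ℂ) ^ (2 * s) * (Complex.Gamma (-s) * riemannZeta (-2 * s)) := by
  have hpi : (Real.pi : ℂ) ≠ 0 := Complex.ofReal_ne_zero.2 Real.pi_ne_zero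
  have hGamma : (2 * s + 1).Gammaℝ ≠ 0 := Complex.Gammaℝ_ne_zero_of_re_pos (by
    simp only [Complex.add_re, Complex.mul_re, Complex.re_ofNat, Complex.im_ofNat, zero_mul,
      sub_zero, Complex.one_re]
    linarith [hre.1])
  have hGamma' : (1 - (2 * s + 1)).Gammaℝ ≠ 0 := by
    rw [Ne, Complex.Gammaℝ_eq_zero_iff]
    rintro ⟨n, hn⟩
    obtain rfl : s = n := by linear_combination -hn / 2
    have hn_lt : n < 1 := by exact_mod_cast (Complex.natCast_re n).symm.trans_lt hre.2
    exact hs (by simp [Nat.lt_one_iff.1 hn_lt])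
  have hfunctional := Gammaℝ_mul_riemannZeta_one_sub hGamma hGamma'
  have hpow : (Real.pi : ℂ) ^ (-(2 * s + 1) / 2) * ((Real.pi : ℂ) ^ s * √Real.pi) = 1 := by
    rw [← pi_cpow_one_half, ← Complex.cpow_add _ _ hpi, ← Complex.cpow_add _ _ hpi,
      ← Complex.cpow_zero (Real.pi : ℂ)]
    congr 1
    ring
  have hsq : (Real.pi : ℂ) ^ (2 * s) = (Real.pi : ℂ) ^ s * (Real.pi : ℂ) ^ s := by
    rw [← Complex.cpow_add _ _ hpi, two_mul]
  rw [show 1 - (2 * s + 1) = -2 * s by ring, Complex.Gammaℝ_def, Complex.Gammaℝ_def,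
    show (2 * s + 1) / 2 = s + 1 / 2 by ring, show -(-2 * s) / 2 = s by ring,
    show -2 * s / 2 = -s by ring] at hfunctional
  rw [hsq]
  linear_combination ((Real.pi : ℂ) ^ s * √Real.pi) * hfunctional
    - Complex.Gamma (s + 1 / 2) * riemannZeta (2 * s + 1) * hpow

theorem conj_comp_deriv_comp_conj {f : ℂ → ℂ} (hf : starRingEnd ℂ ∘ f ∘ starRingEnd ℂ = f) :
    starRingEnd ℂ ∘ deriv f ∘ starRingEnd ℂ = deriv f := by
  rw [← deriv_conj_conj, hf]

theorem iteratedDeriv_two_riemannZeta_zero_im : (iteratedDeriv 2 riemannZeta 0).im = 0 := by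
  have hzeta : starRingEnd ℂ ∘ riemannZeta ∘ starRingEnd ℂ = riemannZeta :=
    funext fun s => by simp [riemannZeta_conj]
  have hderiv := congrFun (conj_comp_deriv_comp_conj (conj_comp_deriv_comp_conj hzeta)) 0
  rw [iteratedDeriv_succ, iteratedDeriv_one]
  simpa only [Function.comp_apply, map_zero, Complex.conj_eq_iff_im] using hderiv

/-! ### Second order Taylor expansions -/

/-- The Taylor expansion of the analytic function `f` at `0` is `a + b z + (c / 2) z ^ 2 + ⋯`. -/
structure HasTaylorTwo (f : ℂ → ℂ) (a b c : ℂ) : Prop where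
  analyticAt : AnalyticAt ℂ f 0
  value : f 0 = a
  deriv_eq : deriv f 0 = b
  deriv_deriv_eq : deriv (deriv f) 0 = c

namespace HasTaylorTwo

variable {f g : ℂ → ℂ} {a b c a' b' c' : ℂ}

theorem congr_of_eventuallyEq (hf : HasTaylorTwo f a b c) (h : g =ᶠ[𝓝 0] f) :
    HasTaylorTwo g a b c :=
  ⟨hf.analyticAt.congr h.symm, h.eq_of_nhds.trans hf.value, h.deriv_eq.trans hf.deriv_eq,
    h.deriv.deriv_eq.trans hf.deriv_deriv_eq⟩

theorem const (a : ℂ) : HasTaylorTwo (fun _ => a) a 0 0 :=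
  ⟨analyticAt_const, rfl, by simp, by simp⟩

theorem hasDerivAt (hf : HasTaylorTwo f a b c) : HasDerivAt f b 0 :=
  hf.deriv_eq ▸ hf.analyticAt.differentiableAt.hasDerivAt

theorem hasDerivAt_deriv (hf : HasTaylorTwo f a b c) : HasDerivAt (deriv f) c 0 :=
  hf.deriv_deriv_eq ▸ hf.analyticAt.deriv.differentiableAt.hasDerivAt

theorem add (hf : HasTaylorTwo f a b c) (hg : HasTaylorTwo g a' b' c') :
    HasTaylorTwo (fun z => f z + g z) (a + a') (b + b') (c + c') := by
  have hderiv : deriv (fun z => f z + g z) =ᶠ[𝓝 0] fun z => deriv f z + deriv g z := by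
    filter_upwards [hf.analyticAt.eventually_analyticAt, hg.analyticAt.eventually_analyticAt]
      with z hfz hgz
    exact (hfz.differentiableAt.hasDerivAt.add hgz.differentiableAt.hasDerivAt).deriv
  exact ⟨hf.analyticAt.add hg.analyticAt, by rw [hf.value, hg.value],
    (hf.hasDerivAt.add hg.hasDerivAt).deriv,
    hderiv.deriv_eq.trans (hf.hasDerivAt_deriv.add hg.hasDerivAt_deriv).deriv⟩

theorem mul (hf : HasTaylorTwo f a b c) (hg : HasTaylorTwo g a' b' c') :
    HasTaylorTwo (fun z => f z * g z) (a * a') (b * a' + a * b')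
      (c * a' + 2 * (b * b') + a * c') := by
  have hderiv : deriv (fun z => f z * g z) =ᶠ[𝓝 0] fun z => deriv f z * g z + f z * deriv g z := by
    filter_upwards [hf.analyticAt.eventually_analyticAt, hg.analyticAt.eventually_analyticAt]
      with z hfz hgz
    exact (hfz.differentiableAt.hasDerivAt.mul hgz.differentiableAt.hasDerivAt).deriv
  refine ⟨hf.analyticAt.mul hg.analyticAt, by rw [hf.value, hg.value], ?_, ?_⟩
  · rw [hderiv.eq_of_nhds, hf.value, hg.value, hf.deriv_eq, hg.deriv_eq]
  · refine hderiv.deriv_eq.trans (((hf.hasDerivAt_deriv.mul hg.hasDerivAt).add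
      (hf.hasDerivAt.mul hg.hasDerivAt_deriv)).deriv.trans ?_)
    rw [hf.value, hg.value, hf.deriv_eq, hg.deriv_eq]
    ring

theorem comp_affine (z₀ m : ℂ) (hf : AnalyticAt ℂ f z₀) :
    HasTaylorTwo (fun z => f (z₀ + m * z)) (f z₀) (m * deriv f z₀)
      (m ^ 2 * deriv (deriv f) z₀) := by
  have hderiv (F : ℂ → ℂ) : deriv (fun z => F (z₀ + m * z))
      = fun z => m * deriv F (z₀ + m * z) := by
    ext z
    rw [deriv_comp_mul_left m (fun z => F (z₀ + z)), deriv_comp_const_add, smul_eq_mul]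
  refine ⟨?_, by simp, by simp [hderiv], ?_⟩
  · have hf' : AnalyticAt ℂ f (z₀ + m * 0) := by simpa using hf
    exact hf'.fun_comp (f := fun z => z₀ + m * z) (by fun_prop)
  · simp only [hderiv, deriv_const_mul_field, mul_zero, add_zero]
    ring

theorem affine (a m : ℂ) : HasTaylorTwo (fun z => a + m * z) a m 0 := by
  simpa using comp_affine (f := id) a m (by fun_prop)

theorem exp_mul (m : ℂ) : HasTaylorTwo (fun z => Complex.exp (m * z)) 1 m (m ^ 2) := by
  simpa using comp_affine (f := Complex.exp) 0 m (by fun_prop)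

theorem cos_mul (m : ℂ) : HasTaylorTwo (fun z => Complex.cos (m * z)) 1 0 (-m ^ 2) := by
  simpa using comp_affine (f := Complex.cos) 0 m (by fun_prop)

end HasTaylorTwo

theorem Gamma_half_add_mul_Gamma_half_sub_mul_cos {z : ℂ} (hz : Complex.cos (Real.pi * z) ≠ 0) :
    Complex.Gamma (1 / 2 + 1 * z) * Complex.Gamma (1 / 2 + -1 * z) * Complex.cos (Real.pi * z)
      = Real.pi := by
  have hreflection := Complex.Gamma_mul_Gamma_one_sub (1 / 2 + z)
  rw [show Real.pi * (1 / 2 + z) = Real.pi * z + Real.pi / 2 by ring, Complex.sin_add_pi_div_two]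
    at hreflection
  rw [one_mul, show 1 / 2 + -1 * z = 1 - (1 / 2 + z) by ring, hreflection, div_mul_cancel₀ _ hz]

/-- The second Taylor coefficient of the reflection formula
`Γ(1/2 + z) Γ(1/2 - z) cos (π z) = π` at `0` determines `Γ''(1/2)` from `Γ'(1/2)`. -/
theorem deriv_deriv_Gamma_one_half : deriv (deriv Complex.Gamma) (1 / 2)
    = (√Real.pi : ℂ) * ((Real.eulerMascheroniConstant + 2 * Complex.log 2) ^ 2
      + (Real.pi : ℂ) ^ 2 / 2) := by
  have hGamma : AnalyticAt ℂ Complex.Gamma (1 / 2) := analyticAt_Gamma_of_re_pos (by norm_num)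
  have hproduct := ((HasTaylorTwo.comp_affine (1 / 2) 1 hGamma).mul
    (HasTaylorTwo.comp_affine (1 / 2) (-1) hGamma)).mul (HasTaylorTwo.cos_mul Real.pi)
  have hconst : (fun z => Complex.Gamma (1 / 2 + 1 * z) * Complex.Gamma (1 / 2 + -1 * z)
      * Complex.cos (Real.pi * z)) =ᶠ[𝓝 0] fun _ => (Real.pi : ℂ) := by
    have hcos : ∀ᶠ z in 𝓝 (0 : ℂ), Complex.cos (Real.pi * z) ≠ 0 :=
      (HasTaylorTwo.cos_mul Real.pi).analyticAt.continuousAt.eventually_ne (by simp)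
    filter_upwards [hcos] with z hz using Gamma_half_add_mul_Gamma_half_sub_mul_cos hz
  have hsecond := hproduct.deriv_deriv_eq.symm.trans
    ((HasTaylorTwo.const (Real.pi : ℂ)).congr_of_eventuallyEq hconst).deriv_deriv_eq
  rw [Complex.hasDerivAt_Gamma_one_half.deriv, Complex.Gamma_one_half_eq, pi_cpow_one_half]
    at hsecond
  apply mul_left_cancel₀ ofReal_sqrt_pi_ne_zero
  linear_combination hsecond / 2

/-- The second Taylor coefficient of the duplication formula at `1/2` determines `Γ''(1)`. -/
theorem deriv_deriv_Gamma_one : deriv (deriv Complex.Gamma) 1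
    = (Real.eulerMascheroniConstant : ℂ) ^ 2 + (Real.pi : ℂ) ^ 2 / 6 := by
  have hGamma : AnalyticAt ℂ Complex.Gamma 1 := analyticAt_Gamma_of_re_pos (by norm_num)
  have hleft := (HasTaylorTwo.comp_affine (1 / 2) 1
    (analyticAt_Gamma_of_re_pos (s := 1 / 2) (by norm_num))).mul
    (HasTaylorTwo.comp_affine 1 1 hGamma)
  have hright := ((HasTaylorTwo.comp_affine 1 2 hGamma).mul
    (HasTaylorTwo.exp_mul (-(2 * Complex.log 2)))).mul (HasTaylorTwo.const (√Real.pi : ℂ))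
  have hduplication (z : ℂ) : Complex.Gamma (1 / 2 + 1 * z) * Complex.Gamma (1 + 1 * z)
      = Complex.Gamma (1 + 2 * z) * Complex.exp (-(2 * Complex.log 2) * z) * (√Real.pi : ℂ) := by
    have h := Complex.Gamma_mul_Gamma_add_half (1 / 2 + 1 * z)
    rwa [show 1 / 2 + 1 * z + 1 / 2 = 1 + 1 * z by ring,
      show 2 * (1 / 2 + 1 * z) = 1 + 2 * z by ring, Complex.cpow_def_of_ne_zero two_ne_zero,
      show Complex.log 2 * (1 - (1 + 2 * z)) = -(2 * Complex.log 2) * z by ring] at h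
  have hsecond := hleft.deriv_deriv_eq.symm.trans
    (hright.congr_of_eventuallyEq (Eventually.of_forall hduplication)).deriv_deriv_eq
  rw [deriv_deriv_Gamma_one_half, Complex.hasDerivAt_Gamma_one_half.deriv,
    Complex.Gamma_one_half_eq, Complex.hasDerivAt_Gamma_one.deriv, Complex.Gamma_one,
    pi_cpow_one_half] at hsecond
  apply mul_left_cancel₀ ofReal_sqrt_pi_ne_zero
  linear_combination -hsecond / 3

/-! ### Mellin transform of the reduced limit tail -/

namespace LatticePath

/-- The function `s ↦ 1 + s * mellin reducedTail s`, in a form that is analytic on the strip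
`|Re s| < 1 / 2`. -/
noncomputable def mellinFactor (s : ℂ) : ℂ :=
  -2 * riemannZeta (-2 * s) * (Real.pi : ℂ) ^ (2 * s) * Complex.Gamma (1 + -1 * s) * (1 + 2 * s)

theorem mul_Gamma_mul_riemannZeta_eq_mellinFactor {s : ℂ} (hs : s ≠ 0)
    (hre : s.re ∈ Set.Ioo (-(1 / 2)) 1) :
    s * (4 / (√Real.pi : ℂ) * (Complex.Gamma (s + 3 / 2) * riemannZeta (2 * s + 1)))
      = mellinFactor s := by
  have hsqrt := ofReal_sqrt_pi_ne_zero
  have hhalf : s + 1 / 2 ≠ 0 := by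
    intro h
    have hre_eq := congrArg Complex.re h
    norm_num at hre_eq
    linarith [hre.1]
  have hGamma_succ : Complex.Gamma (s + 3 / 2) = (s + 1 / 2) * Complex.Gamma (s + 1 / 2) := by
    rw [← Complex.Gamma_add_one _ hhalf]
    congr 1
    ring
  have hGamma_neg : Complex.Gamma (1 + -1 * s) = -s * Complex.Gamma (-s) := by
    rw [← Complex.Gamma_add_one _ (neg_ne_zero.2 hs)]
    congr 1
    ring
  rw [mellinFactor, hGamma_succ, hGamma_neg, mul_assoc _ _ (riemannZeta _),
    Gamma_add_half_mul_riemannZeta hs hre]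
  field_simp
  ring

theorem differentiableAt_mellinFactor {s : ℂ} (hre : s.re ∈ Set.Ioo (-(1 / 2)) 1) :
    DifferentiableAt ℂ mellinFactor s := by
  have hpole : -2 * s ≠ 1 := by
    intro h
    have hre_eq := congrArg Complex.re h
    simp only [Complex.mul_re, Complex.neg_re, Complex.re_ofNat, Complex.neg_im, Complex.im_ofNat,
      Complex.one_re] at hre_eq
    linarith [hre.1]
  have hzeta : DifferentiableAt ℂ (fun s : ℂ => riemannZeta (-2 * s)) s :=
    (differentiableAt_riemannZeta hpole).comp s (by fun_prop)
  have hGamma : DifferentiableAt ℂ (fun s : ℂ => Complex.Gamma (1 + -1 * s)) s :=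
    (differentiableAt_Gamma_of_re_pos (by simpa using hre.2)).comp s (by fun_prop)
  have hpow : DifferentiableAt ℂ (fun s : ℂ => (Real.pi : ℂ) ^ (2 * s)) s :=
    DifferentiableAt.const_cpow (by fun_prop) (Or.inl (Complex.ofReal_ne_zero.2 Real.pi_ne_zero))
  unfold mellinFactor
  fun_prop

theorem differentiableAt_mellin_reducedTail {s : ℂ} (hre : s.re ∈ Set.Ioo (-(1 / 2)) 1) :
    DifferentiableAt ℂ (mellin reducedTail) s :=
  (hasDerivAt_mellin_reducedTail hre.2 (by linarith [hre.1])).differentiableAt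

theorem mul_mellin_reducedTail_add_one_of_re_pos {s : ℂ} (hs : 0 < s.re) (hs' : s.re < 1) :
    s * mellin reducedTail s + 1 = mellinFactor s := by
  have hs_ne : s ≠ 0 := by
    rintro rfl
    exact lt_irrefl _ hs
  rw [mellin_reducedTail_eq_sub hs hs', mellin_limitTail hs,
    ← mul_Gamma_mul_riemannZeta_eq_mellinFactor hs_ne ⟨by linarith, hs'⟩, mul_sub,
    mul_one_div_cancel hs_ne, sub_add_cancel]

theorem mul_mellin_reducedTail_add_one {s : ℂ} (hre : s.re ∈ Set.Ioo (-(1 / 2)) 1) :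
    s * mellin reducedTail s + 1 = mellinFactor s := by
  have hopen := isOpen_re_preimage_Ioo (-(1 / 2)) 1
  have hleft : AnalyticOnNhd ℂ (fun s => s * mellin reducedTail s + 1)
      (Complex.re ⁻¹' Set.Ioo (-(1 / 2)) 1) :=
    DifferentiableOn.analyticOnNhd (fun z hz => ((differentiableAt_id.mul
      (differentiableAt_mellin_reducedTail hz)).add_const _).differentiableWithinAt) hopen
  have hright : AnalyticOnNhd ℂ mellinFactor (Complex.re ⁻¹' Set.Ioo (-(1 / 2)) 1) :=
    DifferentiableOn.analyticOnNhd
      (fun z hz => (differentiableAt_mellinFactor hz).differentiableWithinAt) hopen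
  refine hleft.eqOn_of_preconnected_of_eventuallyEq hright
    ((convex_Ioo (-(1 / 2) : ℝ) 1).linear_preimage Complex.reLm).isPreconnected (z₀ := 1 / 2)
    ?_ ?_ hre
  · norm_num
  · filter_upwards [(isOpen_re_preimage_Ioo 0 1).mem_nhds (x := (1 / 2 : ℂ)) (by norm_num)]
      with z hz using mul_mellin_reducedTail_add_one_of_re_pos hz.1 hz.2

theorem mellin_reducedTail_eq {s : ℂ} (hs : s ≠ 0) (hre : s.re ∈ Set.Ioo (-(1 / 2)) 1) :
    mellin reducedTail s
      = 4 / (√Real.pi : ℂ) * (Complex.Gamma (s + 3 / 2) * riemannZeta (2 * s + 1)) - 1 / s := by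
  apply mul_left_cancel₀ hs
  rw [mul_sub, mul_Gamma_mul_riemannZeta_eq_mellinFactor hs hre,
    ← mul_mellin_reducedTail_add_one hre, mul_one_div_cancel hs, add_sub_cancel_right]

theorem deriv_mellin_reducedTail {s : ℂ} (hs : s ≠ 0) (hre : s.re ∈ Set.Ioo (-(1 / 2)) 1) :
    deriv (mellin reducedTail) s
      = 4 / (√Real.pi : ℂ) * (Complex.Gamma (s + 3 / 2)
        * (Complex.digamma (s + 3 / 2) * riemannZeta (2 * s + 1)
          + 2 * deriv riemannZeta (2 * s + 1))) + 1 / s ^ 2 := by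
  have hlocal : mellin reducedTail =ᶠ[𝓝 s] fun s =>
      4 / (√Real.pi : ℂ) * (Complex.Gamma (s + 3 / 2) * riemannZeta (2 * s + 1)) - 1 / s := by
    filter_upwards [(isOpen_re_preimage_Ioo _ _).mem_nhds hre, isOpen_ne.mem_nhds hs]
      with z hz_re hz using mellin_reducedTail_eq hz hz_re
  have hre_pos : 0 < (s + 3 / 2).re := by
    norm_num
    linarith [hre.1]
  have hGamma : HasDerivAt (fun s : ℂ => Complex.Gamma (s + 3 / 2))
      (Complex.Gamma (s + 3 / 2) * Complex.digamma (s + 3 / 2)) s :=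
    (hasDerivAt_Gamma_of_re_pos hre_pos).comp_add_const s (3 / 2)
  have hlinear : HasDerivAt (fun s : ℂ => 2 * s + 1) 2 s := by
    simpa using ((hasDerivAt_id s).const_mul 2).add_const 1
  have hzeta : HasDerivAt (fun s : ℂ => riemannZeta (2 * s + 1))
      (deriv riemannZeta (2 * s + 1) * 2) s :=
    (differentiableAt_riemannZeta (by simpa using hs)).hasDerivAt.comp s hlinear
  have hinv : HasDerivAt (fun s : ℂ => 1 / s) (-(s ^ 2)⁻¹) s := by
    simpa using hasDerivAt_inv hs
  refine hlocal.deriv_eq.trans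
    ((((hGamma.mul hzeta).const_mul (4 / (√Real.pi : ℂ))).sub hinv).deriv.trans ?_)
  ring

theorem hasTaylorTwo_mellinFactor : HasTaylorTwo mellinFactor 1
    (2 + Real.eulerMascheroniConstant - 2 * Real.log 2)
    ((2 + Real.eulerMascheroniConstant - 2 * Real.log 2) ^ 2 - 4 + (Real.pi : ℂ) ^ 2 / 6
      - 8 * iteratedDeriv 2 riemannZeta 0
      - 4 * (Real.log 2 + Real.log Real.pi : ℂ) ^ 2) := by
  have hpi : (Real.pi : ℂ) ≠ 0 := Complex.ofReal_ne_zero.2 Real.pi_ne_zero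
  have hzeta := HasTaylorTwo.comp_affine 0 (-2) (analyticOn_riemannZeta 0 (by simp))
  have hpow : HasTaylorTwo (fun s => (Real.pi : ℂ) ^ (2 * s)) 1 (2 * Real.log Real.pi)
      ((2 * Real.log Real.pi) ^ 2) := by
    refine (HasTaylorTwo.exp_mul (2 * Real.log Real.pi)).congr_of_eventuallyEq
      (Eventually.of_forall fun z => ?_)
    beta_reduce
    rw [Complex.cpow_def_of_ne_zero hpi, Complex.ofReal_log Real.pi_pos.le]
    ring_nf
  have hGamma := HasTaylorTwo.comp_affine 1 (-1) (analyticAt_Gamma_of_re_pos (s := 1) (by norm_num))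
  have hproduct := ((((HasTaylorTwo.const (-2)).mul hzeta).mul hpow).mul hGamma).mul
    (HasTaylorTwo.affine 1 2)
  have hlog : Complex.log (2 * Real.pi) = Real.log 2 + Real.log Real.pi := by
    rw [← Complex.ofReal_add, ← Real.log_mul two_ne_zero Real.pi_ne_zero,
      Complex.ofReal_log (by positivity), Complex.ofReal_mul, Complex.ofReal_ofNat]
  simp only [zero_add, deriv_deriv_Gamma_one, Complex.hasDerivAt_Gamma_one.deriv, Complex.Gamma_one,
    riemannZeta_zero, deriv_riemannZeta_zero, hlog] at hproduct
  rw [iteratedDeriv_succ, iteratedDeriv_one]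
  convert! hproduct using 1 <;> ring

theorem hasTaylorTwo_mul_mellin_reducedTail_add_one :
    HasTaylorTwo (fun s => s * mellin reducedTail s + 1) 1 (mellin reducedTail 0)
      (2 * deriv (mellin reducedTail) 0) := by
  have hanalytic : AnalyticAt ℂ (mellin reducedTail) 0 :=
    DifferentiableOn.analyticAt
      (fun z hz => (differentiableAt_mellin_reducedTail hz).differentiableWithinAt)
      ((isOpen_re_preimage_Ioo _ _).mem_nhds (by norm_num))
  have htaylor : HasTaylorTwo (mellin reducedTail) _ _ _ := ⟨hanalytic, rfl, rfl, rfl⟩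
  simpa using ((HasTaylorTwo.affine 0 1).mul htaylor).add (HasTaylorTwo.const 1)

theorem mul_mellin_reducedTail_add_one_eventuallyEq :
    (fun s => s * mellin reducedTail s + 1) =ᶠ[𝓝 0] mellinFactor := by
  filter_upwards [(isOpen_re_preimage_Ioo (-(1 / 2)) 1).mem_nhds (x := (0 : ℂ)) (by norm_num)]
    with z hz using mul_mellin_reducedTail_add_one hz

theorem mellin_reducedTail_zero :
    mellin reducedTail 0 = 2 + Real.eulerMascheroniConstant - 2 * Real.log 2 :=
  hasTaylorTwo_mul_mellin_reducedTail_add_one.deriv_eq.symm.trans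
    (hasTaylorTwo_mellinFactor.congr_of_eventuallyEq
      mul_mellin_reducedTail_add_one_eventuallyEq).deriv_eq

theorem two_mul_deriv_mellin_reducedTail_zero :
    2 * deriv (mellin reducedTail) 0 =
      (2 + Real.eulerMascheroniConstant - 2 * Real.log 2) ^ 2 - 4 + (Real.pi : ℂ) ^ 2 / 6
      - 8 * iteratedDeriv 2 riemannZeta 0 - 4 * (Real.log 2 + Real.log Real.pi : ℂ) ^ 2 :=
  hasTaylorTwo_mul_mellin_reducedTail_add_one.deriv_deriv_eq.symm.trans
    (hasTaylorTwo_mellinFactor.congr_of_eventuallyEq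
      mul_mellin_reducedTail_add_one_eventuallyEq).deriv_deriv_eq

/-! ### Fourier coefficients of the periodic parts -/

theorem chi_div_two_mul (k : ℤ) :
    2 * k * Real.pi * Complex.I = chi k / 2 * (2 * (Real.log 2 : ℂ)) := by
  have hlog : (Real.log 2 : ℂ) ≠ 0 := Complex.ofReal_ne_zero.2 (Real.log_pos one_lt_two).ne'
  rw [chi]
  field_simp

theorem chi_div_two_ne_zero {k : ℤ} (hk : k ≠ 0) : chi k / 2 ≠ 0 :=
  left_ne_zero_of_mul (chi_div_two_mul k ▸ two_mul_int_mul_pi_mul_I_ne_zero hk)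

theorem chi_div_two_re_mem_Ioo (k : ℤ) : (chi k / 2).re ∈ Set.Ioo (-(1 / 2)) 1 := by
  rw [chi_div_two_re]
  norm_num

theorem integral_fourierExp_mul_firstSum_logTail {k : ℤ} (hk : k ≠ 0) :
    ∫ y in (0 : ℝ)..1, fourierExp k y * ((firstSum logTail y - y : ℝ) : ℂ)
      = Real.log 2 * coeffC k := by
  obtain ⟨q', C, hsmooth⟩ := exists_smoothStep_logTail
  have hchi := chi_div_two_ne_zero hk
  have hlog : (Real.log 2 : ℂ) ≠ 0 := Complex.ofReal_ne_zero.2 (Real.log_pos one_lt_two).ne'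
  have hsqrt := ofReal_sqrt_pi_ne_zero
  rw [hsmooth.integral_fourierExp_mul_firstSum_sub, integral_fourierExp_mul_logTail,
    integral_fourierExp_mul_id hk, Real.log_four_eq, chi_div_two_mul,
    mellin_reducedTail_eq hchi (chi_div_two_re_mem_Ioo k), coeffC,
    show (3 + chi k) / 2 = chi k / 2 + 3 / 2 by ring, show 1 + chi k = 2 * (chi k / 2) + 1 by ring]
  generalize chi k / 2 = s at *
  push_cast
  field_simp
  ring

theorem digamma_two_add_chi (k : ℤ) :
    Complex.digamma (2 + chi k) = (Complex.digamma (1 + chi k / 2)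
      + Complex.digamma (chi k / 2 + 3 / 2) + 2 * (Real.log 2 : ℂ)) / 2 := by
  have hre : 0 < (1 + chi k / 2).re := by
    rw [Complex.add_re, chi_div_two_re]
    norm_num
  have hduplication := two_mul_digamma_two_mul hre
  rw [show 2 * (1 + chi k / 2) = 2 + chi k by ring,
    show 1 + chi k / 2 + 1 / 2 = chi k / 2 + 3 / 2 by ring, complex_log_two] at hduplication
  linear_combination hduplication / 2

theorem integral_fourierExp_mul_secondPeriodic_logTail {k : ℤ} (hk : k ≠ 0) :
    ∫ y in (0 : ℝ)..1, fourierExp k y * ((secondPeriodic logTail y : ℝ) : ℂ)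
      = coeffD k - coeffC k * Complex.digamma (1 + chi k / 2) := by
  obtain ⟨q', C, hsmooth⟩ := exists_smoothStep_logTail
  have hchi := chi_div_two_ne_zero hk
  have hlog : (Real.log 2 : ℂ) ≠ 0 := Complex.ofReal_ne_zero.2 (Real.log_pos one_lt_two).ne'
  have hsqrt := ofReal_sqrt_pi_ne_zero
  rw [hsmooth.integral_fourierExp_mul_secondPeriodic, integral_fourierExp_mul_linear_mul_logTail,
    integral_fourierExp_mul_sq hk, Real.log_four_eq, chi_div_two_mul,
    mellin_reducedTail_eq hchi (chi_div_two_re_mem_Ioo k),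
    deriv_mellin_reducedTail hchi (chi_div_two_re_mem_Ioo k), coeffD, coeffC, digamma_two_add_chi,
    show (3 + chi k) / 2 = chi k / 2 + 3 / 2 by ring, show 1 + chi k = 2 * (chi k / 2) + 1 by ring]
  generalize chi k / 2 = s at *
  push_cast
  field_simp
  ring

theorem HasFourierSeries.congr {a b : ℤ → ℂ} {f : ℝ → ℝ} (hf : HasFourierSeries a f)
    (hab : ∀ k ≠ 0, a k = b k) : HasFourierSeries b f := fun x => by
  refine (hf x).congr_fun fun k => ?_
  rw [hab k k.2]

theorem hasFourierSeries_sub_integral {f f' : ℝ → ℝ} (hper : Function.Periodic f 1)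
    (hderiv : ∀ x, HasDerivAt f (f' x) x) (hcont : Continuous f') :
    HasFourierSeries (fun k => ∫ y in (0 : ℝ)..1, fourierExp k y * f y)
      fun x => f x - ∫ y in (0 : ℝ)..1, f y := fun x => by
  set F : ℤ → ℂ := fun k => (∫ y in (0 : ℝ)..1, fourierExp k y * f y)
    * Complex.exp (2 * k * Real.pi * Complex.I * x)
  have hF_zero : F 0 = ((∫ y in (0 : ℝ)..1, f y : ℝ) : ℂ) := by
    simp [F, fourierExp_zero_left, intervalIntegral.integral_ofReal]
  have hsingleton : HasSum (F ∘ ((↑) : ({0} : Set ℤ) → ℤ)) (F 0) := hasSum_unique _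
  refine hsingleton.hasSum_compl_iff.2 ?_
  rw [hF_zero, Complex.ofReal_sub, add_sub_cancel]
  exact hasSum_fourier_of_hasDerivAt hper hderiv hcont x

theorem isPeriodicMeanZero_sub_integral {f : ℝ → ℝ} (hper : Function.Periodic f 1)
    (hcont : Continuous f) : IsPeriodicMeanZero fun x => f x - ∫ y in (0 : ℝ)..1, f y := by
  refine ⟨fun x => by simp only [hper x], (hcont.sub continuous_const).intervalIntegrable _ _, ?_⟩
  rw [intervalIntegral.integral_sub (hcont.intervalIntegrable _ _) (by simp)]
  simp

/-- The mean of the `1`-periodic function `firstSum logTail x - x`: the constant term of the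
expectation. -/
noncomputable def firstMean : ℝ :=
  (Real.eulerMascheroniConstant + 2 - 3 * Real.log 2) / (2 * Real.log 2)

/-- The constant term of the variance. -/
noncomputable def varianceConst : ℝ :=
  (Real.pi ^ 2 - 24 * Real.log Real.pi ^ 2 - 48 * (iteratedDeriv 2 riemannZeta 0).re - 24)
    / (24 * Real.log 2 ^ 2) - 2 * Real.log Real.pi / Real.log 2 - 11 / 12

theorem chi_zero_div_two : chi 0 / 2 = 0 := by
  simp [chi]

theorem integral_firstSum_logTail_sub :
    ∫ y in (0 : ℝ)..1, (firstSum logTail y - y) = firstMean := by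
  obtain ⟨q', C, hsmooth⟩ := exists_smoothStep_logTail
  have hlog : (Real.log 2 : ℂ) ≠ 0 := Complex.ofReal_ne_zero.2 (Real.log_pos one_lt_two).ne'
  have hid : ∫ y in (0 : ℝ)..1, (y : ℂ) = 1 / 2 := by
    rw [intervalIntegral.integral_ofReal, integral_id]
    norm_num
  have hcoeff := hsmooth.integral_fourierExp_mul_firstSum_sub 0
  rw [integral_fourierExp_mul_logTail, chi_zero_div_two, mellin_reducedTail_zero,
    Real.log_four_eq] at hcoeff
  simp only [fourierExp_zero_left, one_mul, hid] at hcoeff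
  rw [intervalIntegral.integral_ofReal] at hcoeff
  apply Complex.ofReal_injective
  rw [hcoeff, firstMean]
  push_cast
  field_simp
  ring

theorem integral_secondPeriodic_logTail :
    ∫ y in (0 : ℝ)..1, secondPeriodic logTail y = firstMean ^ 2 + varianceConst := by
  obtain ⟨q', C, hsmooth⟩ := exists_smoothStep_logTail
  have hlog : (Real.log 2 : ℂ) ≠ 0 := Complex.ofReal_ne_zero.2 (Real.log_pos one_lt_two).ne'
  have hsq : ∫ y in (0 : ℝ)..1, (y : ℂ) ^ 2 = 1 / 3 := by
    simp only [← Complex.ofReal_pow]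
    rw [intervalIntegral.integral_ofReal, integral_pow]
    norm_num
  have hzeta : ((iteratedDeriv 2 riemannZeta 0).re : ℂ) = iteratedDeriv 2 riemannZeta 0 :=
    Complex.conj_eq_iff_re.1 (Complex.conj_eq_iff_im.2 iteratedDeriv_two_riemannZeta_zero_im)
  have hderiv := eq_div_of_mul_eq two_ne_zero
    ((mul_comm _ _).trans two_mul_deriv_mellin_reducedTail_zero)
  have hcoeff := hsmooth.integral_fourierExp_mul_secondPeriodic 0
  rw [integral_fourierExp_mul_linear_mul_logTail, chi_zero_div_two, mellin_reducedTail_zero,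
    hderiv, Real.log_four_eq] at hcoeff
  simp only [fourierExp_zero_left, one_mul, hsq] at hcoeff
  rw [intervalIntegral.integral_ofReal] at hcoeff
  apply Complex.ofReal_injective
  rw [hcoeff, firstMean, varianceConst]
  push_cast
  rw [hzeta]
  field_simp
  ring

/-- The periodic fluctuation `δ₁` in the expectation. -/
noncomputable def deltaOne (x : ℝ) : ℝ := firstSum logTail x - x - firstMean

/-- The periodic fluctuation `δ₂` that enters the variance linearly. -/
noncomputable def deltaTwo (x : ℝ) : ℝ :=
  secondPeriodic logTail x - (firstMean ^ 2 + varianceConst)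

theorem hasFourierSeries_deltaOne :
    HasFourierSeries (fun k => Real.log 2 * coeffC k) deltaOne := by
  obtain ⟨q', C, hsmooth⟩ := exists_smoothStep_logTail
  obtain ⟨f', hderiv, hcont⟩ := hsmooth.exists_hasDerivAt_firstSum_sub
  unfold deltaOne
  rw [← integral_firstSum_logTail_sub]
  exact (hasFourierSeries_sub_integral hsmooth.periodic_firstSum_sub hderiv hcont).congr
    fun k hk => integral_fourierExp_mul_firstSum_logTail hk

theorem hasFourierSeries_deltaTwo :
    HasFourierSeries (fun k => coeffD k - coeffC k * Complex.digamma (1 + chi k / 2))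
      deltaTwo := by
  obtain ⟨q', C, hsmooth⟩ := exists_smoothStep_logTail
  obtain ⟨f', hderiv, hcont⟩ := hsmooth.exists_hasDerivAt_secondPeriodic
  unfold deltaTwo
  rw [← integral_secondPeriodic_logTail]
  exact (hasFourierSeries_sub_integral hsmooth.periodic_secondPeriodic hderiv hcont).congr
    fun k hk => integral_fourierExp_mul_secondPeriodic_logTail hk

theorem continuous_deltaOne : Continuous deltaOne := by
  obtain ⟨q', C, hsmooth⟩ := exists_smoothStep_logTail
  exact (hsmooth.continuous_firstSum.sub continuous_id).sub continuous_const

theorem isPeriodicMeanZero_deltaOne : IsPeriodicMeanZero deltaOne := by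
  obtain ⟨q', C, hsmooth⟩ := exists_smoothStep_logTail
  unfold deltaOne
  rw [← integral_firstSum_logTail_sub]
  exact isPeriodicMeanZero_sub_integral hsmooth.periodic_firstSum_sub
    (hsmooth.continuous_firstSum.sub continuous_id)

theorem isPeriodicMeanZero_deltaTwo : IsPeriodicMeanZero deltaTwo := by
  obtain ⟨q', C, hsmooth⟩ := exists_smoothStep_logTail
  obtain ⟨f', hderiv, -⟩ := hsmooth.exists_hasDerivAt_secondPeriodic
  unfold deltaTwo
  rw [← integral_secondPeriodic_logTail]
  exact isPeriodicMeanZero_sub_integral hsmooth.periodic_secondPeriodic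
    (continuous_iff_continuousAt.2 fun x => (hderiv x).continuousAt)

theorem exists_abs_deltaOne_le : ∃ M, ∀ x, |deltaOne x| ≤ M := by
  have hcompact := isPeriodicMeanZero_deltaOne.1.compact_of_continuous one_ne_zero
    continuous_deltaOne
  obtain ⟨M, hM⟩ := hcompact.isBounded.exists_norm_le
  exact ⟨M, fun x => hM _ ⟨x, rfl⟩⟩

end LatticePath

/-! ### Moments as sums of tail probabilities -/

theorem hasSum_weight_mul_tail_sub_step {M : Type*} [Ring M] [TopologicalSpace M] (w : ℤ → M)
    (d : ℕ) :
    HasSum (fun r : ℤ => w r * ((if r.toNat ≤ d then 1 else 0) - if r ≤ 0 then 1 else 0))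
      (∑ i ∈ Finset.range d, w (i + 1)) := by
  set s := (Finset.range d).image fun i : ℕ => (i : ℤ) + 1
  have hsum : ∑ r ∈ s, w r * ((if r.toNat ≤ d then 1 else 0) - if r ≤ 0 then 1 else 0) =
      ∑ i ∈ Finset.range d, w (i + 1) := by
    rw [Finset.sum_image fun a _ b _ h => by simpa using h]
    refine Finset.sum_congr rfl fun i hi => ?_
    have hi_lt := Finset.mem_range.1 hi
    rw [if_pos (by omega), if_neg (by omega), sub_zero, mul_one]
  rw [← hsum]
  refine hasSum_sum_of_ne_finset_zero fun r hr => ?_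
  by_cases hr_nonpos : r ≤ 0
  · simp [hr_nonpos, Int.toNat_of_nonpos hr_nonpos]
  · have hr_gt : ¬ r.toNat ≤ d := fun hd =>
      hr (Finset.mem_image.2 ⟨r.toNat - 1, Finset.mem_range.2 (by omega), by omega⟩)
    simp [hr_nonpos, hr_gt]

theorem sum_range_two_mul_add_one_sub_one {R : Type*} [CommRing R] (d : ℕ) :
    ∑ i ∈ Finset.range d, (2 * ((i : R) + 1) - 1) = (d : R) ^ 2 := by
  induction d with
  | zero => simp
  | succ d ih =>
    rw [Finset.sum_range_succ, ih]
    push_cast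
    ring

namespace LatticePath

theorem card_step : Fintype.card Step = 4 := rfl

instance isProbabilityMeasure_uniformPath (n : ℕ) : IsProbabilityMeasure (uniformPath n) :=
  have : Nonempty (Fin n → Step) := ⟨fun _ => .up⟩
  ProbabilityTheory.isProbabilityMeasure_uniformOn Set.finite_univ Set.univ_nonempty

theorem integral_uniformPath (n : ℕ) (F : List Step → ℝ) :
    ∫ p, F (List.ofFn p) ∂(uniformPath n) = pathSum n F / 4 ^ n := by
  have hsingleton (p : Fin n → Step) : (uniformPath n).real {p} = 1 / 4 ^ n := by
    rw [uniformPath, ProbabilityTheory.uniformOn, Measure.real,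
      ProbabilityTheory.cond_apply MeasurableSet.univ]
    simp [Measure.count_univ, card_step]
  rw [integral_fintype Integrable.of_finite, pathSum, Finset.sum_div]
  refine Finset.sum_congr rfl fun p _ => ?_
  rw [hsingleton, smul_eq_mul]
  ring

theorem hasSum_weight_mul_degreeTail_sub_step (w : ℤ → ℝ) (n : ℕ) :
    HasSum (fun r : ℤ => w r * (degreeTail r.toNat n - if r ≤ 0 then 1 else 0))
      (∫ p, ∑ i ∈ Finset.range (rdeg (List.ofFn p)), w (i + 1) ∂(uniformPath n)) := by
  rw [integral_uniformPath n fun l => ∑ i ∈ Finset.range (rdeg l), w (i + 1)]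
  refine ((hasSum_sum (s := Finset.univ) fun (p : Fin n → Step) _ =>
    hasSum_weight_mul_tail_sub_step w (rdeg (List.ofFn p))).div_const (4 ^ n)).congr_fun fun r => ?_
  have hconst := pathSum_const n (if r ≤ 0 then 1 else 0)
  rw [pathSum] at hconst
  rw [← Finset.mul_sum, Finset.sum_sub_distrib, hconst, degreeTail, pathSum]
  field_simp

theorem expectedD_eq_tsum (n : ℕ) : expectedD n =
    ∑' r : ℤ, 1 * (degreeTail r.toNat n - if r ≤ 0 then 1 else 0) := by
  rw [(hasSum_weight_mul_degreeTail_sub_step (fun _ => 1) n).tsum_eq]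
  simp [expectedD, D]

theorem varianceD_add_sq_eq_tsum (n : ℕ) : varianceD n + expectedD n ^ 2 =
    ∑' r : ℤ, (2 * (r : ℝ) - 1) * (degreeTail r.toNat n - if r ≤ 0 then 1 else 0) := by
  rw [varianceD, ProbabilityTheory.variance_eq_sub MemLp.of_discrete, expectedD, sub_add_cancel,
    (hasSum_weight_mul_degreeTail_sub_step (fun r => 2 * r - 1) n).tsum_eq]
  simp only [Pi.pow_apply, D, Int.cast_add, Int.cast_natCast, Int.cast_one,
    sum_range_two_mul_add_one_sub_one]

/-! ### Replacing the degree tail by its limit -/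

theorem four_zpow_div_eq_exp {ν : ℝ} (hν : 0 < ν) (r : ℤ) :
    4 ^ r / ν = Real.exp (-((Real.logb 4 ν - r) * Real.log 4)) := by
  rw [sub_mul, Real.logb, div_mul_cancel₀ _ log_four_pos.ne', neg_sub, Real.exp_sub,
    Real.exp_log hν, mul_comm, ← Real.rpow_def_of_pos (by norm_num), Real.rpow_intCast]

theorem logTail_logb_sub {ν : ℝ} (hν : 0 < ν) (r : ℤ) :
    logTail (Real.logb 4 ν - r) = limitTail (4 ^ r / ν) := by
  rw [logTail, four_zpow_div_eq_exp hν]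

theorem abs_le_mul_log_four {u : ℝ} (hu : 0 ≤ u) : |u| ≤ u * Real.log 4 := by
  rw [abs_of_nonneg hu]
  exact le_mul_of_one_le_right hu one_le_log_four

theorem exists_abs_one_sub_logTail_le : ∃ C, 0 < C ∧ ∀ ν : ℝ, 1 ≤ ν → ∀ r : ℤ, r ≤ 0 →
    |1 - logTail (Real.logb 4 ν - r)| ≤ C / ν * Real.exp (-|(r : ℝ)|) := by
  obtain ⟨C, hC, hbound⟩ := isBigO_limitTail_sub_one.exists_pos
  refine ⟨C, hC, fun ν hν r hr => ?_⟩
  have hν_pos : 0 < ν := one_pos.trans_le hν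
  have hpow : (4 : ℝ) ^ r ≤ Real.exp (-|(r : ℝ)|) := by
    have hr' : (0 : ℝ) ≤ -r := by exact_mod_cast neg_nonneg.2 hr
    rw [← div_one ((4 : ℝ) ^ r), four_zpow_div_eq_exp one_pos, Real.logb_one, zero_sub,
      ← abs_neg (r : ℝ)]
    gcongr
    exact abs_le_mul_log_four hr'
  have hmem : (4 : ℝ) ^ r / ν ∈ Set.Ioc 0 1 :=
    ⟨by positivity, (div_le_one hν_pos).2
      ((hpow.trans (Real.exp_le_one_iff.2 (by simp))).trans hν)⟩
  have hlim := isBigOWith_principal.1 hbound _ hmem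
  rw [Real.norm_eq_abs, Real.norm_of_nonneg hmem.1.le, abs_sub_comm] at hlim
  rw [logTail_logb_sub hν_pos]
  calc |1 - limitTail (4 ^ r / ν)| ≤ C * (4 ^ r / ν) := hlim
    _ = C / ν * 4 ^ r := by ring
    _ ≤ _ := by gcongr

theorem abs_degreeTail_succ_sub_logTail_le (m n : ℕ) :
    |degreeTail (m + 1) (n + 1) - logTail (Real.logb 4 (n + 1) - (m + 1 : ℕ))|
      ≤ 8000 / (n + 1) * Real.exp (-|Real.logb 4 (n + 1) - (m + 1 : ℕ)|) := by
  have hn : (0 : ℝ) < n + 1 := by positivity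
  have htail := logTail_logb_sub hn (m + 1 : ℕ)
  have hexp := four_zpow_div_eq_exp hn (m + 1 : ℕ)
  rw [zpow_natCast, Int.cast_natCast] at htail hexp
  rw [htail]
  set u := Real.logb 4 ((n : ℝ) + 1) - (m + 1 : ℕ)
  rcases le_total 0 u with hu | hu
  · calc |degreeTail (m + 1) (n + 1) - limitTail (4 ^ (m + 1) / (n + 1))|
        ≤ 2000 / (n + 1) * (4 ^ (m + 1) / (n + 1)) := abs_degreeTail_sub_limitTail_le_mul m n
      _ ≤ _ := by
        rw [hexp]
        gcongr
        · norm_num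
        · exact abs_le_mul_log_four hu
  · have hone : (1 : ℝ) ≤ 4 ^ (m + 1) / (n + 1) := by
      rw [hexp]
      exact Real.one_le_exp (neg_nonneg.2 (mul_nonpos_of_nonpos_of_nonneg hu log_four_pos.le))
    calc |degreeTail (m + 1) (n + 1) - limitTail (4 ^ (m + 1) / (n + 1))|
        ≤ 8000 / (n + 1) * (4 ^ (m + 1) / ((n : ℝ) + 1))⁻¹ :=
          abs_degreeTail_sub_limitTail_le_inv (m + 1) n ((one_le_div hn).1 hone)
      _ ≤ _ := by
        rw [hexp, ← Real.exp_neg, ← neg_mul, ← abs_neg u]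
        gcongr
        exact abs_le_mul_log_four (neg_nonneg.2 hu)

theorem exists_abs_degreeTail_sub_logTail_le : ∃ C : ℝ, 0 < C ∧ ∀ (n : ℕ) (r : ℤ),
    |degreeTail r.toNat (n + 1) - logTail (Real.logb 4 (n + 1) - r)|
      ≤ C / (n + 1) * (Real.exp (-|Real.logb 4 (n + 1) - r|) + Real.exp (-|(r : ℝ)|)) := by
  obtain ⟨C, hC, hbound⟩ := exists_abs_one_sub_logTail_le
  refine ⟨C + 8000, by positivity, fun n r => ?_⟩
  rcases le_or_gt r 0 with hr | hr
  · rw [Int.toNat_of_nonpos hr, degreeTail_zero]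
    refine (hbound _ (by simp) r hr).trans ?_
    gcongr
    · linarith
    · linarith [Real.exp_pos (-|Real.logb 4 ((n : ℝ) + 1) - r|)]
  · obtain ⟨m, rfl⟩ : ∃ m : ℕ, r = (m + 1 : ℕ) := ⟨r.toNat - 1, by omega⟩
    rw [Int.toNat_natCast, Int.cast_natCast]
    refine (abs_degreeTail_succ_sub_logTail_le m n).trans ?_
    gcongr
    · linarith
    · linarith [Real.exp_pos (-|((m + 1 : ℕ) : ℝ)|)]

section WeightGrowth

variable {w : ℤ → ℝ} {B x : ℝ}

theorem abs_weight_mul_exp_neg_abs_sub_le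
    (hw : ∀ j : ℤ, |w (⌊x⌋ + j)| ≤ B * (2 * |(j : ℝ)| + 1)) (j : ℤ) :
    |w (⌊x⌋ + j)| * Real.exp (-|x - (⌊x⌋ + j : ℤ)|)
      ≤ B * Real.exp 1 * ((2 * |(j : ℝ)| + 1) * Real.exp (-|(j : ℝ)|)) := by
  have hfract : |Int.fract x| ≤ 1 := by
    rw [abs_of_nonneg (Int.fract_nonneg x)]
    exact (Int.fract_lt_one x).le
  have hexp := exp_neg_abs_sub_le (y := j) hfract
  rw [Int.fract, sub_sub] at hexp
  rw [Int.cast_add]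
  calc _ ≤ B * (2 * |(j : ℝ)| + 1) * (Real.exp 1 * Real.exp (-|(j : ℝ)|)) :=
        mul_le_mul (hw j) hexp (Real.exp_pos _).le ((abs_nonneg _).trans (hw j))
    _ = _ := by ring

theorem summable_abs_weight_mul_exp_neg_abs_sub
    (hw : ∀ j : ℤ, |w (⌊x⌋ + j)| ≤ B * (2 * |(j : ℝ)| + 1)) :
    Summable fun r : ℤ => |w r| * Real.exp (-|x - r|) :=
  (Equiv.addLeft ⌊x⌋).summable_iff.1 <|
    (summable_int_mul_exp_neg_abs.mul_left (B * Real.exp 1)).of_nonneg_of_le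
      (fun _ => mul_nonneg (abs_nonneg _) (Real.exp_pos _).le)
      (abs_weight_mul_exp_neg_abs_sub_le hw)

theorem tsum_abs_weight_mul_exp_neg_abs_sub_le
    (hw : ∀ j : ℤ, |w (⌊x⌋ + j)| ≤ B * (2 * |(j : ℝ)| + 1)) :
    ∑' r : ℤ, |w r| * Real.exp (-|x - r|)
      ≤ B * Real.exp 1 * ∑' r : ℤ, (2 * |(r : ℝ)| + 1) * Real.exp (-|(r : ℝ)|) := by
  rw [← tsum_mul_left, ← (Equiv.addLeft ⌊x⌋).tsum_eq]
  have hsummable := (Equiv.addLeft ⌊x⌋).summable_iff.2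
    (summable_abs_weight_mul_exp_neg_abs_sub (x := x) hw)
  exact hsummable.tsum_le_tsum (abs_weight_mul_exp_neg_abs_sub_le hw)
    (summable_int_mul_exp_neg_abs.mul_left (B * Real.exp 1))

end WeightGrowth

theorem exists_abs_tsum_degreeTail_sub_shiftSum_le : ∃ C : ℝ, ∀ (n : ℕ) (w : ℤ → ℝ) (B : ℝ),
    1 ≤ B → (∀ r : ℤ, |w r| ≤ 2 * |(r : ℝ)| + 1) →
    (∀ j : ℤ, |w (⌊Real.logb 4 (n + 1)⌋ + j)| ≤ B * (2 * |(j : ℝ)| + 1)) →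
    |(∑' r : ℤ, w r * (degreeTail r.toNat (n + 1) - if r ≤ 0 then 1 else 0))
      - shiftSum logTail w (Real.logb 4 (n + 1))| ≤ C * B / (n + 1) := by
  obtain ⟨C, hC, hbound⟩ := exists_abs_degreeTail_sub_logTail_le
  obtain ⟨q', K, hsmooth⟩ := exists_smoothStep_logTail
  set S := ∑' r : ℤ, (2 * |(r : ℝ)| + 1) * Real.exp (-|(r : ℝ)|)
  have hS : 0 ≤ S := tsum_nonneg fun r => by positivity
  refine ⟨C * (Real.exp 1 + 1) * S, fun n w B hB hw hwB => ?_⟩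
  set x := Real.logb 4 ((n : ℝ) + 1)
  have hshift := summable_abs_weight_mul_exp_neg_abs_sub hwB
  have hle (r : ℤ) : |w r| * Real.exp (-|(r : ℝ)|) ≤ (2 * |(r : ℝ)| + 1) * Real.exp (-|(r : ℝ)|) :=
    mul_le_mul_of_nonneg_right (hw r) (Real.exp_pos _).le
  have hcentre : Summable fun r : ℤ => |w r| * Real.exp (-|(r : ℝ)|) :=
    summable_int_mul_exp_neg_abs.of_nonneg_of_le (fun r => by positivity) hle
  have hterm (r : ℤ) : ‖w r * (degreeTail r.toNat (n + 1) - if r ≤ 0 then 1 else 0)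
      - w r * (logTail (x - r) - if r ≤ 0 then 1 else 0)‖
      ≤ C / (n + 1) * (|w r| * Real.exp (-|x - r|) + |w r| * Real.exp (-|(r : ℝ)|)) := by
    rw [← mul_sub, sub_sub_sub_cancel_right, norm_mul, Real.norm_eq_abs, Real.norm_eq_abs]
    exact (mul_le_mul_of_nonneg_left (hbound n r) (abs_nonneg _)).trans_eq (by ring)
  rw [shiftSum, ← (hasSum_weight_mul_degreeTail_sub_step w (n + 1)).summable.tsum_sub
    (hsmooth.summable hw x)]
  calc _ ≤ ∑' r : ℤ, C / (n + 1) * (|w r| * Real.exp (-|x - r|) + |w r| * Real.exp (-|(r : ℝ)|)) :=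
        tsum_of_norm_bounded ((hshift.add hcentre).mul_left _).hasSum hterm
    _ = C / (n + 1) * (∑' r : ℤ, |w r| * Real.exp (-|x - r|)
          + ∑' r : ℤ, |w r| * Real.exp (-|(r : ℝ)|)) := by
        rw [tsum_mul_left, hshift.tsum_add hcentre]
    _ ≤ C / (n + 1) * (B * Real.exp 1 * S + B * S) := by
        gcongr
        · exact tsum_abs_weight_mul_exp_neg_abs_sub_le hwB
        · exact (hcentre.tsum_le_tsum hle summable_int_mul_exp_neg_abs).trans
            (le_mul_of_one_le_left hS hB)
    _ = C * (Real.exp 1 + 1) * S * B / (n + 1) := by ring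

end LatticePath

/-! ### Asymptotics of the expectation and the variance -/

theorem isBigO_natCast_of_abs_succ_le {f : ℕ → ℝ} {g : ℝ → ℝ} {C : ℝ}
    (h : ∀ n : ℕ, |f (n + 1)| ≤ C * g (n + 1)) : f =O[atTop] fun n => g n := by
  have h_pos (n : ℕ) : |f (n + 1)| ≤ |C| * |g (n + 1)| :=
    (h n).trans ((le_abs_self _).trans_eq (abs_mul _ _))
  refine IsBigO.of_bound |C| ?_
  filter_upwards [eventually_ge_atTop 1] with n hn
  obtain ⟨m, rfl⟩ : ∃ m, n = m + 1 := ⟨n - 1, by omega⟩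
  rw [Real.norm_eq_abs, Real.norm_eq_abs, Nat.cast_succ]
  exact h_pos m

theorem isBigO_inv_natCast_one : (fun n : ℕ => (n : ℝ)⁻¹) =O[atTop] fun _ => (1 : ℝ) :=
  tendsto_inv_atTop_nhds_zero_nat.isBigO_one ℝ

theorem isBigO_one_log_natCast : (fun _ : ℕ => (1 : ℝ)) =O[atTop] fun n : ℕ => Real.log n :=
  Real.isLittleO_const_log_atTop.isBigO.natCast_atTop

theorem isBigO_logb_natCast (b : ℝ) :
    (fun n : ℕ => Real.logb b n) =O[atTop] fun n : ℕ => Real.log n :=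
  (Real.isBigO_logb_log.mono le_top).natCast_atTop

namespace LatticePath

theorem isBigO_expectedD_sub_firstSum :
    (fun n : ℕ => expectedD n - firstSum logTail (Real.logb 4 n)) =O[atTop]
      fun n : ℕ => (n : ℝ)⁻¹ := by
  obtain ⟨C, hbound⟩ := exists_abs_tsum_degreeTail_sub_shiftSum_le
  refine isBigO_natCast_of_abs_succ_le (C := C) (g := (·⁻¹)) fun n => ?_
  have hle := hbound n (fun _ => 1) 1 le_rfl abs_one_le_two_mul_abs_add_one fun j => by
    rw [one_mul]
    exact abs_one_le_two_mul_abs_add_one j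
  rwa [← div_eq_mul_inv, Nat.cast_succ, expectedD_eq_tsum,
    ← mul_one C]

theorem abs_two_mul_floor_add_sub_one_le {x : ℝ} (hx : 0 ≤ x) (j : ℤ) :
    |2 * ((⌊x⌋ + j : ℤ) : ℝ) - 1| ≤ (2 * x + 1) * (2 * |(j : ℝ)| + 1) := by
  rw [Int.cast_add, mul_add, add_sub_assoc]
  calc |2 * (⌊x⌋ : ℝ) + (2 * j - 1)| ≤ 2 * ⌊x⌋ + (2 * |(j : ℝ)| + 1) :=
        (abs_add_le _ _).trans (add_le_add (abs_of_nonneg (by positivity)).le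
          (abs_two_mul_sub_one_le_two_mul_abs_add_one j))
    _ ≤ 2 * x * (2 * |(j : ℝ)| + 1) + (2 * |(j : ℝ)| + 1) := by
        have hone : 1 ≤ 2 * |(j : ℝ)| + 1 := le_add_of_nonneg_left (by positivity)
        nlinarith [mul_le_mul_of_nonneg_left hone hx, Int.floor_le x]
    _ = _ := by ring

theorem isBigO_varianceD_add_sq_sub_secondSum :
    (fun n : ℕ => varianceD n + expectedD n ^ 2 - secondSum logTail (Real.logb 4 n)) =O[atTop]
      fun n : ℕ => (2 * Real.logb 4 n + 1) / n := by
  obtain ⟨C, hbound⟩ := exists_abs_tsum_degreeTail_sub_shiftSum_le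
  refine isBigO_natCast_of_abs_succ_le (C := C) (g := fun ν => (2 * Real.logb 4 ν + 1) / ν)
    fun n => ?_
  have hlogb : 0 ≤ Real.logb 4 ((n : ℝ) + 1) := Real.logb_nonneg (by norm_num) (by simp)
  have hle := hbound n (fun r => 2 * r - 1) (2 * Real.logb 4 (n + 1) + 1) (by linarith)
    abs_two_mul_sub_one_le_two_mul_abs_add_one (abs_two_mul_floor_add_sub_one_le hlogb)
  rwa [← mul_div_assoc, Nat.cast_succ, varianceD_add_sq_eq_tsum]

theorem isBigO_firstSum_logTail_logb :
    (fun n : ℕ => firstSum logTail (Real.logb 4 n)) =O[atTop] fun n : ℕ => Real.log n := by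
  obtain ⟨M, hM⟩ := exists_abs_deltaOne_le
  have hdelta : (fun n : ℕ => deltaOne (Real.logb 4 n)) =O[atTop] fun _ => (1 : ℝ) :=
    IsBigO.of_bound M (Eventually.of_forall fun n => by simpa using hM _)
  have hmean : (fun _ : ℕ => firstMean) =O[atTop] fun _ => (1 : ℝ) :=
    isBigO_const_const _ one_ne_zero _
  refine ((isBigO_logb_natCast 4).add ((hmean.add hdelta).trans isBigO_one_log_natCast)).congr_left
    fun n => ?_
  rw [deltaOne]
  ring

theorem isBigO_expectedD_sub :
    (fun n : ℕ => expectedD n - (Real.logb 4 n + firstMean + deltaOne (Real.logb 4 n)))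
      =O[atTop] fun n : ℕ => (n : ℝ)⁻¹ :=
  isBigO_expectedD_sub_firstSum.congr_left fun n => by
    rw [deltaOne]
    ring

theorem isBigO_varianceD_sub :
    (fun n : ℕ => varianceD n - (varianceConst + deltaTwo (Real.logb 4 n)
      - 2 * firstMean * deltaOne (Real.logb 4 n) - deltaOne (Real.logb 4 n) ^ 2))
      =O[atTop] fun n : ℕ => Real.log n / n := by
  have hexpectation := isBigO_expectedD_sub_firstSum
  have hsecond : (fun n : ℕ => varianceD n + expectedD n ^ 2 - secondSum logTail (Real.logb 4 n))
      =O[atTop] fun n : ℕ => Real.log n / n := by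
    simp only [div_eq_mul_inv _ (Nat.cast _ : ℝ)]
    refine isBigO_varianceD_add_sq_sub_secondSum.trans ?_
    exact (((isBigO_logb_natCast 4).const_mul_left 2).add isBigO_one_log_natCast).mul
      (isBigO_refl (fun n : ℕ => (n : ℝ)⁻¹) atTop)
  have hcross := (isBigO_firstSum_logTail_logb.const_mul_left 2).mul hexpectation
  have hsquare := ((hexpectation.trans isBigO_inv_natCast_one).trans isBigO_one_log_natCast).mul
    hexpectation
  refine ((hsecond.sub hcross).sub hsquare).congr_left fun n => ?_
  rw [deltaTwo, secondPeriodic, deltaOne]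
  ring

end LatticePath

theorem mainTheorem4 :
    ∃ δ₁ δ₂ : ℝ → ℝ,
      LatticePath.HasFourierSeries (fun k => Real.log 2 * LatticePath.coeffC k) δ₁ ∧
      LatticePath.HasFourierSeries
        (fun k => LatticePath.coeffD k
          - LatticePath.coeffC k * Complex.digamma (1 + LatticePath.chi k / 2)) δ₂ ∧
      LatticePath.IsPeriodicMeanZero δ₁ ∧
      LatticePath.IsPeriodicMeanZero δ₂ ∧
      (fun n : ℕ => LatticePath.expectedD n -
          (Real.logb 4 n
            + (Real.eulerMascheroniConstant + 2 - 3 * Real.log 2) / (2 * Real.log 2)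
            + δ₁ (Real.logb 4 n)))
        =O[Filter.atTop] (fun n : ℕ => (n : ℝ)⁻¹) ∧
      (iteratedDeriv 2 riemannZeta 0).im = 0 ∧
      (fun n : ℕ => LatticePath.varianceD n -
          ((Real.pi ^ 2 - 24 * Real.log Real.pi ^ 2 - 48 * (iteratedDeriv 2 riemannZeta 0).re - 24)
              / (24 * Real.log 2 ^ 2)
            - 2 * Real.log Real.pi / Real.log 2 - 11 / 12
            + δ₂ (Real.logb 4 n)
            - (Real.eulerMascheroniConstant + 2 - 3 * Real.log 2) / Real.log 2
              * δ₁ (Real.logb 4 n)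
            - δ₁ (Real.logb 4 n) ^ 2))
        =O[Filter.atTop] (fun n : ℕ => Real.log n / n) := by
  have hmean : (Real.eulerMascheroniConstant + 2 - 3 * Real.log 2) / Real.log 2
      = 2 * LatticePath.firstMean := by
    rw [LatticePath.firstMean]
    ring
  rw [hmean]
  exact ⟨LatticePath.deltaOne, LatticePath.deltaTwo, LatticePath.hasFourierSeries_deltaOne,
    LatticePath.hasFourierSeries_deltaTwo, LatticePath.isPeriodicMeanZero_deltaOne,
    LatticePath.isPeriodicMeanZero_deltaTwo, LatticePath.isBigO_expectedD_sub,
    iteratedDeriv_two_riemannZeta_zero_im, LatticePath.isBigO_varianceD_sub⟩
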